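/- Let $(\Omega,\mathcal F,\mathsf P)$ be a probability space, $L_0$ the space of (classes of) real random variables on it, and $T>0$. A \emph{stochastic measure} $\mu$ on the Borel subsets of $[0,T]$ is a mapping $\mu:\mathcal B([0,T])\to L_0$ that is $\sigma$-additive with respect to convergence in probability. For a simple function $f=\sum_i c_i\mathbf 1_{A_i}$ (with disjoint Borel $A_i$) put $\int_A f\,d\mu=\sum_i c_i\,\mu(A\cap A_i)$. A Borel function $h:[0,T]\to\mathbb R$ is \emph{$\mu$-integrable} if there are simple functions $f_n$ with $f_n\to h$ $\mu$-almost everywhere (that is, off a Borel set all of whose Borel subsets $B$ satisfy $\mu(B)=0$ a.s.) such that $\int_A f_n\,d\mu$ converges in probability for every Borel set $A$. Theorem. Let $\mu$ be a stochastic measure on the Borel subsets of $[0,T]$. Suppose that there is a finite measure $\mathsf m$ on the Borel subsets of $[0,T]$ such that every Borel function $h:[0,T]\to\mathbb R$ with $\int_{[0,T]}h^2\,d\mathsf m<\infty$ is $\mu$-integrable. Suppose that $(\mu_t)_{0\le t\le T}$ is a version of the process $\mu((0,t])$, that is, $\mu_t=\mu((0,t])$ a.s. for each $t\in[0,T]$,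 and that almost all paths $t\mapsto\mu_t$ are Riemann integrable on $[0,T]$. Let $0<T_1<T$. Then the integrals $$\int_{[0,T_1]}\frac{|\mu_{s+\varepsilon}-\mu_s|^2}{\varepsilon}\,ds,\qquad 0<\varepsilon<T-T_1,$$ exist almost surely, are random variables (measurable up to a $\mathsf P$-null set), and form a family bounded in probability: $$\lim_{C\to\infty}\ \sup_{0<\varepsilon<T-T_1}\mathsf P\Bigl\{\int_{[0,T_1]}\frac{|\mu_{s+\varepsilon}-\mu_s|^2}{\varepsilon}\,ds>C\Bigr\}=0 .$$ -/

import Mathlib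

open MeasureTheory Set Filter Topology

/-- A stochastic measure on a measurable space `X`: a mapping from the measurable subsets of `X`
to the space `L₀(Ω, P)` of (classes of) real random variables which is `σ`-additive with respect to
convergence in probability. The values on non-measurable sets are irrelevant and never used. -/
structure StochasticMeasure (X : Type*) [MeasurableSpace X] {Ω : Type*} [MeasurableSpace Ω]
    (P : Measure Ω) where
  /-- The random variable `μ(A)`. -/
  val : Set X → (Ω →ₘ[P] ℝ)
  /-- `σ`-additivity in probability. -/
  sigma_additive : ∀ A : ℕ → Set X, (∀ i, MeasurableSet (A i)) →
    (∀ i j, i ≠ j → Disjoint (A i) (A j)) →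
    TendstoInMeasure P (fun n : ℕ => ((∑ i ∈ Finset.range n, val (A i) : Ω →ₘ[P] ℝ) : Ω → ℝ))
      atTop (val (⋃ i, A i) : Ω → ℝ)

namespace StochasticMeasure

variable {X : Type*} [MeasurableSpace X] {Ω : Type*} [MeasurableSpace Ω] {P : Measure Ω}

/-- A measurable set all of whose measurable subsets have `μ`-measure zero (as elements of `L₀`). -/
def IsNull (μ : StochasticMeasure X P) (N : Set X) : Prop :=
  MeasurableSet N ∧ ∀ B : Set X, MeasurableSet B → B ⊆ N → μ.val B = 0

/-- The integral `∫_A f dμ = ∑_c c μ(A ∩ {f = c})` of a simple function `f`. -/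
noncomputable def simpleIntegral (μ : StochasticMeasure X P) (f : SimpleFunc X ℝ) (A : Set X) :
    Ω →ₘ[P] ℝ :=
  ∑ c ∈ f.range, c • μ.val (A ∩ f ⁻¹' {c})

/-- `h` is integrable with respect to `μ`: there are simple functions `fₙ` which converge to `h`
`μ`-almost everywhere and such that, for every measurable `A`, the integrals `∫_A fₙ dμ` converge
in probability. (The integral `∫_A h dμ` is then the limit of `∫_A fₙ dμ`.) -/
def IsIntegrable (μ : StochasticMeasure X P) (h : X → ℝ) : Prop :=
  ∃ f : ℕ → SimpleFunc X ℝ,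
    (∃ N : Set X, μ.IsNull N ∧ ∀ x, x ∉ N → Tendsto (fun n => f n x) atTop (𝓝 (h x))) ∧
    ∀ A : Set X, MeasurableSet A → ∃ Y : Ω →ₘ[P] ℝ,
      TendstoInMeasure P (fun n => (μ.simpleIntegral (f n) A : Ω → ℝ)) atTop (Y : Ω → ℝ)

/-- There is a finite measure `m` such that every measurable `h` with `∫ h² dm < ∞` is integrable
with respect to `μ`. -/
def SquareIntegrableImpliesIntegrable (μ : StochasticMeasure X P) : Prop :=
  ∃ m : Measure X, IsFiniteMeasure m ∧
    ∀ h : X → ℝ, Measurable h → Integrable (fun x => h x ^ 2) m → μ.IsIntegrable h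

end StochasticMeasure

/-- `f` is Riemann integrable on `[a, b]`: the Riemann sums over tagged partitions
`a = x₀ ≤ x₁ ≤ … ≤ xₙ = b`, `ξₖ ∈ [xₖ, xₖ₊₁]`, converge as the mesh tends to zero. -/
def RiemannIntegrableOn (f : ℝ → ℝ) (a b : ℝ) : Prop :=
  ∃ I : ℝ, ∀ η : ℝ, 0 < η → ∃ δ : ℝ, 0 < δ ∧
    ∀ (n : ℕ) (x ξ : ℕ → ℝ), x 0 = a → x n = b →
      (∀ k < n, x k ≤ ξ k ∧ ξ k ≤ x (k + 1) ∧ x (k + 1) - x k < δ) →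
      |∑ k ∈ Finset.range n, f (ξ k) * (x (k + 1) - x k) - I| < η

/-- The family `(Y i)` is bounded in probability: `sup_i P(|Y i| > C) → 0` as `C → ∞`. -/
def BoundedInProbability {Ω : Type*} [MeasurableSpace Ω] (P : Measure Ω) {ι : Type*}
    (Y : ι → Ω → ℝ) : Prop :=
  Tendsto (fun C : ℝ => ⨆ i, P {ω | C < |Y i ω|}) atTop (𝓝 0)

/-! Put h = T₁/n. A Riemann sum of the integral is almost surely 2 ∑ₖ (∫ fₖ dμ)² with fₖ = √(h/(2ε))
times the indicator of (kh, kh + ε]. A point lies in at most ε/h + 1 of these intervals, so ∑ fₖ² ≤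
1 once h ≤ ε. Everything therefore rests on a fact about arbitrary L₀-valued measures: the sums ∑ (∫
fᵢ dμ)² over finite simple families with ∑ fᵢ² ≤ 1 are bounded in probability, uniformly in the
family (`ExhaustiveContent.bounded_square_function`). The limit n → ∞ is taken path by path, by
Riemann integrability (`RiemannIntegrableOn.sq_increment`).

The fact has four layers; they use only finite additivity and exhaustivity of μ.

Range (`bounded_range`): if the values μ(A) were unbounded in probability, every finite partition
could be cut so that, with probability bounded below, some cell breaks into two huge parts. Iterated
cuts form a binary tree with many large cells. A random colouring of these cells detaches disjoint
sets one after another, each large with probability bounded below, which contradicts exhaustivity.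

Convex hull (`bounded_simpleInt`): a simple function with values in [0, 1] is the mean of a random
indicator. Bounded subset sums control ∑ μ(Aᵢ)² by Paley-Zygmund, hence the variance of the random
indicator's integral, and Chebyshev concludes.

Nikishin (`exists_weak_type`): greedily remove disjoint events on which some integral is too large
for a weak type (1,1) bound. Random signs merge the offending functions into one function bounded by
1, so the removed events have small total probability. Outside them f ↦ ∫ f dμ maps bounded
functions into L^{1/2}.

Maurey (`lintegral_square_function_le`): Khinchin turns a square function into an average of
integrals of random functions. Their truncations are bounded; the remainders again form a family
with small square function, which is absorbed into the best constant. -/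

/-! ### Averages over random subsets of a finite set -/

section RandomSubsets

variable {ι : Type*} [DecidableEq ι]

/-- The probability of `S` when every `i ∈ s` is put into `S` independently with probability
`p i`. -/
noncomputable def bernWeight (p : ι → ℝ) (s S : Finset ι) : ℝ :=
  (∏ i ∈ S, p i) * ∏ i ∈ s \ S, (1 - p i)

/-- The centred sum `∑ (1_S - p) x`. -/
noncomputable def bernDev (p x : ι → ℝ) (s S : Finset ι) : ℝ :=
  ∑ i ∈ s, ((if i ∈ S then 1 else 0) - p i) * x i

lemma bernWeight_nonneg {p : ι → ℝ} {s S : Finset ι} (hp : ∀ i ∈ s, 0 ≤ p i ∧ p i ≤ 1)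
    (hS : S ∈ s.powerset) : 0 ≤ bernWeight p s S := by
  rw [Finset.mem_powerset] at hS
  refine mul_nonneg (Finset.prod_nonneg fun i hi => (hp i (hS hi)).1)
    (Finset.prod_nonneg fun i hi => ?_)
  linarith [(hp i (Finset.mem_sdiff.1 hi).1).2]

lemma sum_bernWeight (p : ι → ℝ) (s : Finset ι) : ∑ S ∈ s.powerset, bernWeight p s S = 1 := by
  have h := Finset.prod_add p (fun i => 1 - p i) s
  simp only [add_sub_cancel, Finset.prod_const_one] at h
  exact h.symm

/-- Conditioning on whether `a` is selected. This recursion gives the moments below by induction on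
`s`. -/
lemma sum_bernWeight_insert (p x : ι → ℝ) {s : Finset ι} {a : ι} (ha : a ∉ s) (F : ℝ → ℝ) :
    ∑ S ∈ (insert a s).powerset, bernWeight p (insert a s) S * F (bernDev p x (insert a s) S) =
      ∑ S ∈ s.powerset, bernWeight p s S * ((1 - p a) * F (bernDev p x s S - p a * x a) +
        p a * F (bernDev p x s S + (1 - p a) * x a)) := by
  rw [Finset.sum_powerset_insert ha, ← Finset.sum_add_distrib]
  refine Finset.sum_congr rfl fun S hS => ?_
  rw [Finset.mem_powerset] at hS
  have haS : a ∉ S := fun h => ha (hS h)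
  have e1 : bernWeight p (insert a s) S = bernWeight p s S * (1 - p a) := by
    unfold bernWeight
    rw [Finset.insert_sdiff_of_notMem _ haS, Finset.prod_insert (by simp [ha])]
    ring
  have e2 : bernWeight p (insert a s) (insert a S) = bernWeight p s S * p a := by
    unfold bernWeight
    rw [Finset.insert_sdiff_insert, Finset.prod_insert haS, Finset.sdiff_insert_of_notMem ha]
    ring
  have e3 : bernDev p x (insert a s) S = bernDev p x s S - p a * x a := by
    unfold bernDev
    rw [Finset.sum_insert ha, if_neg haS]
    ring
  have e4 : bernDev p x (insert a s) (insert a S) = bernDev p x s S + (1 - p a) * x a := by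
    unfold bernDev
    rw [Finset.sum_insert ha, if_pos (Finset.mem_insert_self a S), add_comm]
    congr 1
    refine Finset.sum_congr rfl fun i hi => ?_
    have : i ≠ a := fun h => ha (h ▸ hi)
    simp [this]
  rw [e1, e2, e3, e4]
  ring

/-- Variance of a sum of independent centred variables: the cross terms cancel. -/
lemma sum_bernWeight_sq (p x : ι → ℝ) (s : Finset ι) :
    ∑ S ∈ s.powerset, bernWeight p s S * bernDev p x s S ^ 2 =
      ∑ i ∈ s, p i * (1 - p i) * x i ^ 2 := by
  induction s using Finset.induction_on with
  | empty => simp [bernWeight, bernDev]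
  | insert a s ha ih =>
    have h1 : p a * (1 - p a) * x a ^ 2 =
        ∑ S ∈ s.powerset, bernWeight p s S * (p a * (1 - p a) * x a ^ 2) := by
      rw [← Finset.sum_mul, sum_bernWeight, one_mul]
    rw [sum_bernWeight_insert p x ha (fun t => t ^ 2), Finset.sum_insert ha, ← ih, h1,
      ← Finset.sum_add_distrib]
    exact Finset.sum_congr rfl fun S _ => by ring

lemma sum_bernWeight_half_sq (x : ι → ℝ) (s : Finset ι) :
    ∑ S ∈ s.powerset, bernWeight (fun _ => 1 / 2) s S * bernDev (fun _ => 1 / 2) x s S ^ 2 =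
      (∑ i ∈ s, x i ^ 2) / 4 := by
  rw [sum_bernWeight_sq, Finset.sum_div]
  exact Finset.sum_congr rfl fun i _ => by ring

/-- At p = 1/2 the odd powers of the new term cancel. With variance V so far and v = (x a)²/4, the
step is 3V² + 6Vv + v² ≤ 3(V + v)². -/
lemma sum_bernWeight_half_pow_four_le (x : ι → ℝ) (s : Finset ι) :
    ∑ S ∈ s.powerset, bernWeight (fun _ => 1 / 2) s S * bernDev (fun _ => 1 / 2) x s S ^ 4 ≤
      3 * ((∑ i ∈ s, x i ^ 2) / 4) ^ 2 := by
  induction s using Finset.induction_on with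
  | empty => simp [bernWeight, bernDev]
  | insert a s ha ih =>
    have h2 := sum_bernWeight_half_sq x s
    have h0 := sum_bernWeight (fun _ : ι => (1 / 2 : ℝ)) s
    rw [sum_bernWeight_insert _ x ha (fun t => t ^ 4), Finset.sum_insert ha]
    have : ∑ S ∈ s.powerset, bernWeight (fun _ => 1 / 2) s S *
        ((1 - 1 / 2) * (bernDev (fun _ => 1 / 2) x s S - 1 / 2 * x a) ^ 4 +
          1 / 2 * (bernDev (fun _ => 1 / 2) x s S + (1 - 1 / 2) * x a) ^ 4) =
        ∑ S ∈ s.powerset, bernWeight (fun _ => 1 / 2) s S * bernDev (fun _ => 1 / 2) x s S ^ 4 +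
        6 * (x a ^ 2 / 4) * ∑ S ∈ s.powerset, bernWeight (fun _ => 1 / 2) s S *
          bernDev (fun _ => 1 / 2) x s S ^ 2 +
        (x a ^ 2 / 4) ^ 2 * ∑ S ∈ s.powerset, bernWeight (fun _ => 1 / 2) s S := by
      rw [Finset.mul_sum, Finset.mul_sum, ← Finset.sum_add_distrib, ← Finset.sum_add_distrib]
      exact Finset.sum_congr rfl fun S _ => by ring
    rw [this, h2, h0]
    nlinarith [sq_nonneg (x a ^ 2)]

lemma half_bernWeight_nonneg {s S : Finset ι} (hS : S ∈ s.powerset) :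
    0 ≤ bernWeight (fun _ => (1 / 2 : ℝ)) s S :=
  bernWeight_nonneg (fun _ _ => by norm_num) hS

/-- The Paley-Zygmund inequality for Rademacher sums. -/
lemma paley_zygmund_bernDev (x : ι → ℝ) (s : Finset ι) {r : ℝ}
    (hr : 8 * r ^ 2 < ∑ i ∈ s, x i ^ 2) :
    1 / 9 ≤ ∑ S ∈ s.powerset, bernWeight (fun _ => 1 / 2) s S *
      (if r < |bernDev (fun _ => 1 / 2) x s S| then 1 else 0) := by
  set Q : ℝ := (∑ i ∈ s, x i ^ 2) / 4 with hQ
  have hrQ : r ^ 2 < Q / 2 := by rw [hQ]; linarith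
  have hQ0 : 0 < Q := by nlinarith [sq_nonneg r]
  have h2 := sum_bernWeight_half_sq x s
  have h4 := sum_bernWeight_half_pow_four_le x s
  have h0 := sum_bernWeight (fun _ : ι => (1 / 2 : ℝ)) s
  rw [← hQ] at h2 h4
  -- As a polynomial in D², the left side vanishes at Q/2 and has maximum 81Q²/4 at 5Q, so it is at
  -- most 81Q²/4 times the indicator of D² > Q/2. Its mean is at least (-3 + 10 - 19/4) Q² = 9Q²/4,
  -- a ninth of the maximum.
  have key : ∑ S ∈ s.powerset, bernWeight (fun _ => 1 / 2) s S *
      (- bernDev (fun _ => 1 / 2) x s S ^ 4 + 10 * Q * bernDev (fun _ => 1 / 2) x s S ^ 2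
        - 19 / 4 * Q ^ 2) ≤
      (81 / 4 * Q ^ 2) * ∑ S ∈ s.powerset, bernWeight (fun _ => 1 / 2) s S *
      (if r < |bernDev (fun _ => 1 / 2) x s S| then 1 else 0) := by
    rw [Finset.mul_sum]
    refine Finset.sum_le_sum fun S hS => ?_
    rw [mul_left_comm]
    refine mul_le_mul_of_nonneg_left ?_ (half_bernWeight_nonneg hS)
    set D := bernDev (fun _ => 1 / 2) x s S
    split_ifs with h
    · nlinarith [sq_nonneg (D ^ 2 - 5 * Q)]
    · have hD : D ^ 2 ≤ r ^ 2 := by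
        rw [← sq_abs D]
        exact pow_le_pow_left₀ (abs_nonneg _) (not_lt.1 h) 2
      have h5 : 0 ≤ Q / 2 - D ^ 2 := by linarith
      nlinarith [mul_nonneg h5 h5]
  have e : ∑ S ∈ s.powerset, bernWeight (fun _ => 1 / 2) s S *
      (- bernDev (fun _ => 1 / 2) x s S ^ 4 + 10 * Q * bernDev (fun _ => 1 / 2) x s S ^ 2
        - 19 / 4 * Q ^ 2) = - ∑ S ∈ s.powerset, bernWeight (fun _ => 1 / 2) s S *
          bernDev (fun _ => 1 / 2) x s S ^ 4 + 10 * Q * Q - 19 / 4 * Q ^ 2 := by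
    have h1 : 19 / 4 * Q ^ 2 =
        ∑ S ∈ s.powerset, bernWeight (fun _ => 1 / 2) s S * (19 / 4 * Q ^ 2) := by
      rw [← Finset.sum_mul, h0, one_mul]
    have h3 : 10 * Q * Q = ∑ S ∈ s.powerset, 10 * Q *
        (bernWeight (fun _ => 1 / 2) s S * bernDev (fun _ => 1 / 2) x s S ^ 2) := by
      rw [← Finset.mul_sum, h2]
    conv_rhs => rw [h1, h3]
    rw [← Finset.sum_neg_distrib, ← Finset.sum_add_distrib, ← Finset.sum_sub_distrib]
    exact Finset.sum_congr rfl fun S _ => by ring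
  rw [e] at key
  by_contra! hcon
  nlinarith [mul_lt_mul_of_pos_left hcon (show 0 < 81 / 4 * Q ^ 2 by positivity)]

/-- If one term is large, then at least half of the subset sums are large. -/
lemma half_le_sum_bernWeight (x : ι → ℝ) (s : Finset ι) (a r : ℝ) {i : ι} (hi : i ∈ s)
    (hx : 2 * r < |x i|) :
    1 / 2 ≤ ∑ S ∈ s.powerset, bernWeight (fun _ => 1 / 2) s S *
      (if r < |a + ∑ j ∈ S, x j| then 1 else 0) := by
  obtain ⟨t, hit, rfl⟩ : ∃ t, i ∉ t ∧ s = insert i t :=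
    ⟨s.erase i, Finset.notMem_erase i s, (Finset.insert_erase hi).symm⟩
  have h0 := sum_bernWeight (fun _ : ι => (1 / 2 : ℝ)) t
  have h1 : (1 / 2 : ℝ) = ∑ S ∈ t.powerset, 1 / 2 * bernWeight (fun _ => 1 / 2) t S := by
    rw [← Finset.mul_sum, h0, mul_one]
  rw [Finset.sum_powerset_insert hit, ← Finset.sum_add_distrib]
  refine h1.le.trans ?_
  refine Finset.sum_le_sum fun S hS => ?_
  have hw := half_bernWeight_nonneg hS
  rw [Finset.mem_powerset] at hS
  have hiS : i ∉ S := fun h => hit (hS h)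
  have e1 : bernWeight (fun _ => (1 / 2 : ℝ)) (insert i t) S =
      1 / 2 * bernWeight (fun _ => 1 / 2) t S := by
    unfold bernWeight
    rw [Finset.insert_sdiff_of_notMem _ hiS, Finset.prod_insert (by simp [hit])]
    ring
  have e2 : bernWeight (fun _ => (1 / 2 : ℝ)) (insert i t) (insert i S) =
      1 / 2 * bernWeight (fun _ => 1 / 2) t S := by
    unfold bernWeight
    rw [Finset.insert_sdiff_insert, Finset.prod_insert hiS, Finset.sdiff_insert_of_notMem hit]
    ring
  rw [e1, e2, Finset.sum_insert hiS, ← mul_add]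
  -- The sums over `S` and `insert i S` differ by `x i`, so they cannot both be at most `r` in
  -- absolute value; one indicator of each pair equals 1.
  refine le_mul_of_one_le_right (by positivity) ?_
  split_ifs with h1 h2 h2
  · norm_num
  · norm_num
  · norm_num
  · exfalso
    have : |x i| ≤ |a + (x i + ∑ j ∈ S, x j)| + |a + ∑ j ∈ S, x j| := by
      have := abs_sub (a + (x i + ∑ j ∈ S, x j)) (a + ∑ j ∈ S, x j)
      rwa [show a + (x i + ∑ j ∈ S, x j) - (a + ∑ j ∈ S, x j) = x i by ring] at this
    linarith [not_lt.1 h1, not_lt.1 h2]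

end RandomSubsets

/-! ### Interchanging weighted averages and probabilities -/

section Averaging

variable {Ω : Type*} [MeasurableSpace Ω] {P : Measure Ω} [IsProbabilityMeasure P] {ι : Type*}

lemma sum_mul_measureReal_eq_integral (s : Finset ι) (w : ι → ℝ) {B : ι → Set Ω}
    (hB : ∀ i ∈ s, MeasurableSet (B i)) :
    ∑ i ∈ s, w i * P.real (B i) = ∫ ω, ∑ i ∈ s, w i * (B i).indicator 1 ω ∂P := by
  rw [integral_finsetSum]
  · refine Finset.sum_congr rfl fun i hi => ?_
    rw [integral_const_mul, integral_indicator_one (hB i hi)]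
  · intro i hi
    exact ((integrable_const (1 : ℝ)).indicator (hB i hi)).const_mul _

lemma integrable_sum_indicator (s : Finset ι) (w : ι → ℝ) {B : ι → Set Ω}
    (hB : ∀ i ∈ s, MeasurableSet (B i)) :
    Integrable (fun ω => ∑ i ∈ s, w i * (B i).indicator (1 : Ω → ℝ) ω) P :=
  integrable_finsetSum _ fun i hi =>
    ((integrable_const (1 : ℝ)).indicator (hB i hi)).const_mul _

/-- By Fubini the left side is the expectation of the weight of the indices `i` with `ω ∈ B i`,
which is at most 1 on `Q` and at most `κ` off `Q`. -/
lemma sum_mul_measureReal_le {s : Finset ι} {w : ι → ℝ} {B : ι → Set Ω} {Q : Set Ω} {κ : ℝ}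
    (hw : ∀ i ∈ s, 0 ≤ w i) (hw1 : ∑ i ∈ s, w i ≤ 1) (hB : ∀ i ∈ s, MeasurableSet (B i))
    (hQ : MeasurableSet Q) (hκ : 0 ≤ κ)
    (h : ∀ᵐ ω ∂P, ω ∉ Q → ∑ i ∈ s, w i * (B i).indicator 1 ω ≤ κ) :
    ∑ i ∈ s, w i * P.real (B i) ≤ P.real Q + κ := by
  rw [sum_mul_measureReal_eq_integral s w hB, ← integral_indicator_one hQ]
  have : ∫ ω, (Q.indicator (1 : Ω → ℝ) ω + κ) ∂P = ∫ ω, Q.indicator (1 : Ω → ℝ) ω ∂P + κ := by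
    have hi : Integrable (Q.indicator (1 : Ω → ℝ)) P := (integrable_const (1 : ℝ)).indicator hQ
    rw [integral_add hi (integrable_const κ)]
    simp
  rw [← this]
  refine integral_mono_ae (integrable_sum_indicator s w hB)
    (((integrable_const (1 : ℝ)).indicator hQ).add (integrable_const κ)) ?_
  filter_upwards [h] with ω h
  by_cases hω : ω ∈ Q
  · simp only [indicator_of_mem hω, Pi.one_apply]
    refine le_trans (Finset.sum_le_sum fun i hi => ?_) (hw1.trans (le_add_of_nonneg_right hκ))
    exact mul_le_of_le_one_right (hw i hi) (indicator_le_self' (by simp) ω)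
  · simpa only [indicator_of_notMem hω, zero_add] using h hω

lemma mul_measureReal_le_sum {s : Finset ι} {w : ι → ℝ} {B : ι → Set Ω} {G : Set Ω} {c : ℝ}
    (hw : ∀ i ∈ s, 0 ≤ w i) (hB : ∀ i ∈ s, MeasurableSet (B i)) (hG : MeasurableSet G)
    (h : ∀ᵐ ω ∂P, ω ∈ G → c ≤ ∑ i ∈ s, w i * (B i).indicator 1 ω) :
    c * P.real G ≤ ∑ i ∈ s, w i * P.real (B i) := by
  rw [sum_mul_measureReal_eq_integral s w hB, ← integral_indicator_one hG, ← integral_const_mul]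
  refine integral_mono_ae (((integrable_const (1 : ℝ)).indicator hG).const_mul c)
    (integrable_sum_indicator s w hB) ?_
  filter_upwards [h] with ω h
  by_cases hω : ω ∈ G
  · simpa only [indicator_of_mem hω, Pi.one_apply, mul_one] using h hω
  · simp only [indicator_of_notMem hω, mul_zero]
    exact Finset.sum_nonneg fun i hi =>
      mul_nonneg (hw i hi) (indicator_nonneg (by simp) ω)

/-- If the average of the numbers `a i` is at least `c`, one of them is at least `c`. -/
lemma exists_le_of_le_sum_mul {s : Finset ι} {w a : ι → ℝ} {c : ℝ} (hw : ∀ i ∈ s, 0 ≤ w i)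
    (hw1 : ∑ i ∈ s, w i = 1) (h : c ≤ ∑ i ∈ s, w i * a i) : ∃ i ∈ s, c ≤ a i := by
  by_contra! hcon
  have : ∃ i ∈ s, 0 < w i := by
    by_contra! h0
    have := Finset.sum_nonpos h0
    linarith
  obtain ⟨i, hi, hwi⟩ := this
  have : ∑ i ∈ s, w i * a i < ∑ i ∈ s, w i * c :=
    Finset.sum_lt_sum (fun j hj => mul_le_mul_of_nonneg_left (hcon j hj).le (hw j hj))
      ⟨i, hi, mul_lt_mul_of_pos_left (hcon i hi) hwi⟩
  rw [← Finset.sum_mul, hw1, one_mul] at this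
  linarith

end Averaging


/-! ### Finitely additive exhaustive random set functions and integrals of simple functions -/

/-- A family `y A` of random variables indexed by sets which is almost surely finitely additive on
measurable sets, and which tends to `0` in probability along disjoint sequences. -/
structure ExhaustiveContent {X : Type*} [MeasurableSpace X] {Ω : Type*} [MeasurableSpace Ω]
    (P : Measure Ω) (y : Set X → Ω → ℝ) : Prop where
  measurable : ∀ A, Measurable (y A)
  union : ∀ A B, MeasurableSet A → MeasurableSet B → Disjoint A B →
    ∀ᵐ ω ∂P, y (A ∪ B) ω = y A ω + y B ω
  exhaustive : ∀ B : ℕ → Set X, (∀ i, MeasurableSet (B i)) → (∀ i j, i ≠ j → Disjoint (B i) (B j)) →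
    ∀ r : ℝ, 0 < r → Tendsto (fun n => P.real {ω | r < |y (B n) ω|}) atTop (𝓝 0)

section Content

variable {X : Type*} [MeasurableSpace X] {Ω : Type*} [MeasurableSpace Ω] {P : Measure Ω}

namespace StochasticMeasure

variable [IsProbabilityMeasure P]

/-- `μ.val (A n)` is the difference of two consecutive partial sums, and these have the same limit.
-/
lemma tendsto_val_disjoint (μ : StochasticMeasure X P) {A : ℕ → Set X}
    (hA : ∀ i, MeasurableSet (A i)) (hd : ∀ i j, i ≠ j → Disjoint (A i) (A j)) {r : ℝ}
    (hr : 0 < r) :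
    Tendsto (fun n => P.real {ω | r < |(μ.val (A n) : Ω → ℝ) ω|}) atTop (𝓝 0) := by
  have h := tendstoInMeasure_iff_measureReal_norm.1 (μ.sigma_additive A hA hd) (r / 2) (by positivity)
  have h' := (h.comp (tendsto_add_atTop_nat 1)).add h
  rw [add_zero] at h'
  refine squeeze_zero (fun _ => measureReal_nonneg) (fun n => ?_) h'
  refine le_trans ?_ (measureReal_union_le _ _)
  refine ENNReal.toReal_mono (measure_ne_top _ _) (measure_mono_ae ?_)
  have e : (∑ i ∈ Finset.range (n + 1), μ.val (A i) : Ω →ₘ[P] ℝ) =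
      ∑ i ∈ Finset.range n, μ.val (A i) + μ.val (A n) := Finset.sum_range_succ _ _
  filter_upwards [AEEqFun.coeFn_add (∑ i ∈ Finset.range n, μ.val (A i)) (μ.val (A n))] with ω hω
  rw [← e] at hω
  intro h1
  simp only [Pi.add_apply] at hω ⊢
  by_contra hcon
  change ¬ ((r / 2 ≤ _) ∨ (r / 2 ≤ _)) at hcon
  push Not at hcon
  obtain ⟨h2, h3⟩ := hcon
  rw [Real.norm_eq_abs] at h2 h3
  change r < |(μ.val (A n) : Ω → ℝ) ω| at h1
  rw [hω] at h2
  rw [abs_lt] at h2 h3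
  rcases lt_abs.1 h1 with h | h <;> linarith

/-- The constant sequence `∅` is pairwise disjoint, so its constant tail probabilities tend to zero
and hence vanish. -/
lemma val_empty (μ : StochasticMeasure X P) : μ.val ∅ = 0 := by
  have h := fun (r : ℝ) (hr : 0 < r) => tendsto_nhds_unique tendsto_const_nhds
    (μ.tendsto_val_disjoint (A := fun _ => ∅) (fun _ => MeasurableSet.empty)
      (fun _ _ _ => by simp) hr)
  refine AEEqFun.ext ?_
  have h' : ∀ k : ℕ, ∀ᵐ ω ∂P, ¬ (1 / ((k : ℝ) + 1) < |(μ.val ∅ : Ω → ℝ) ω|) := fun k => by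
    rw [ae_iff]
    simp only [not_not]
    exact (measureReal_eq_zero_iff).1 (h _ Nat.one_div_pos_of_nat)
  filter_upwards [ae_all_iff.2 h', AEEqFun.coeFn_zero (α := Ω) (β := ℝ) (μ := P)] with ω h1 h2
  rw [h2]
  by_contra hne
  obtain ⟨k, hk⟩ := exists_nat_one_div_lt (abs_pos.2 hne)
  exact h1 k hk

lemma val_union (μ : StochasticMeasure X P) {A B : Set X} (hA : MeasurableSet A)
    (hB : MeasurableSet B) (hd : Disjoint A B) : μ.val (A ∪ B) = μ.val A + μ.val B := by
  -- Finite additivity comes from σ-additivity by padding with empty sets: the partial sums are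
  -- constant from index 2 on.
  set C : ℕ → Set X := fun n => if n = 0 then A else if n = 1 then B else ∅ with hC
  have hU : ⋃ i, C i = A ∪ B := by
    ext x
    simp only [mem_iUnion, mem_union, hC]
    constructor
    · rintro ⟨i, hi⟩
      split_ifs at hi with h0 h1
      · exact Or.inl hi
      · exact Or.inr hi
      · exact hi.elim
    · rintro (h | h)
      · exact ⟨0, by simpa using h⟩
      · exact ⟨1, by simpa using h⟩
  have h := μ.sigma_additive C
    (fun i => by simp only [hC]; split_ifs <;> first | exact hA | exact hB | exact MeasurableSet.empty)
    (fun i j hij => by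
      simp only [hC]
      split_ifs <;> first | (exfalso; omega) | exact hd | exact hd.symm | simp)
  rw [hU] at h
  have h2 : TendstoInMeasure P
      (fun _ : ℕ => ((μ.val A + μ.val B : Ω →ₘ[P] ℝ) : Ω → ℝ)) atTop (μ.val (A ∪ B) : Ω → ℝ) := by
    refine h.congr' ?_ EventuallyEq.rfl
    filter_upwards [eventually_ge_atTop 2] with n hn
    have : ∑ i ∈ Finset.range n, μ.val (C i) = μ.val A + μ.val B := by
      obtain ⟨m, rfl⟩ := Nat.exists_eq_add_of_le hn
      rw [add_comm 2 m, Finset.sum_range_succ', Finset.sum_range_succ']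
      simp [hC, val_empty, add_comm]
    rw [this]
  have h3 : TendstoInMeasure P
      (fun _ : ℕ => ((μ.val A + μ.val B : Ω →ₘ[P] ℝ) : Ω → ℝ)) atTop
      ((μ.val A + μ.val B : Ω →ₘ[P] ℝ) : Ω → ℝ) := by
    intro ε hε
    simp [hε.ne']
  exact AEEqFun.ext (tendstoInMeasure_ae_unique h2 h3)

/-- The boundedness arguments use the measure only through these properties. Each additivity
identity has its own null set, so pointwise arguments below collect finitely or countably many of
them. -/
lemma exhaustiveContent (μ : StochasticMeasure X P) :
    ExhaustiveContent P (fun A => (μ.val A : Ω → ℝ)) where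
  measurable A := (μ.val A).measurable
  union A B hA hB hd := by
    rw [μ.val_union hA hB hd]
    exact AEEqFun.coeFn_add _ _
  exhaustive _ hB hd _ hr := μ.tendsto_val_disjoint hB hd hr

end StochasticMeasure

/-- The integral of a simple function with respect to a set function with random values. -/
noncomputable def simpleInt (y : Set X → Ω → ℝ) (f : SimpleFunc X ℝ) (ω : Ω) : ℝ :=
  ∑ c ∈ f.range, c * y (f ⁻¹' {c}) ω

namespace ExhaustiveContent

variable {y : Set X → Ω → ℝ}

lemma measurable_simpleInt (hy : ExhaustiveContent P y) (f : SimpleFunc X ℝ) :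
    Measurable (simpleInt y f) :=
  Finset.measurable_sum _ fun _ _ => (hy.measurable _).const_mul _

lemma empty (hy : ExhaustiveContent P y) : ∀ᵐ ω ∂P, y ∅ ω = 0 := by
  filter_upwards [hy.union ∅ ∅ .empty .empty (by simp)] with ω h
  rw [union_self] at h
  linarith

lemma biUnion (hy : ExhaustiveContent P y) {β : Type*} (s : Finset β) {V : β → Set X}
    (hV : ∀ v ∈ s, MeasurableSet (V v)) (hd : (s : Set β).PairwiseDisjoint V) :
    ∀ᵐ ω ∂P, y (⋃ v ∈ s, V v) ω = ∑ v ∈ s, y (V v) ω := by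
  classical
  induction s using Finset.induction_on with
  | empty => simpa using hy.empty
  | insert a s ha ih =>
    have h1 := ih (fun v hv => hV v (Finset.mem_insert_of_mem hv))
      (hd.subset (by simp))
    have h2 := hy.union (V a) (⋃ v ∈ s, V v) (hV a (Finset.mem_insert_self a s))
      (Finset.measurableSet_biUnion s fun v hv => hV v (Finset.mem_insert_of_mem hv)) (by
        rw [disjoint_iUnion₂_right]
        intro v hv
        exact hd (by simp) (by simp [hv]) (fun h => ha (h ▸ hv)))
    filter_upwards [h1, h2] with ω h1 h2
    rw [Finset.set_biUnion_insert, h2, h1, Finset.sum_insert ha]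

lemma preimage_finset (hy : ExhaustiveContent P y) {β : Type*} (π : SimpleFunc X β)
    (s : Finset β) : ∀ᵐ ω ∂P, y (π ⁻¹' s) ω = ∑ v ∈ s, y (π ⁻¹' {v}) ω := by
  have h := hy.biUnion s (V := fun v => π ⁻¹' {v}) (fun v _ => π.measurableSet_fiber v)
    (fun v _ w _ hvw => Disjoint.preimage _ (by simpa using hvw))
  have e : (⋃ v ∈ s, π ⁻¹' {v}) = π ⁻¹' s := by ext; simp
  rwa [e] at h

/-- The integral of a simple function of a simple function. -/
lemma simpleInt_map (hy : ExhaustiveContent P y) {β : Type*} (π : SimpleFunc X β) (g : β → ℝ)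
    {s : Finset β} (hs : π.range ⊆ s) :
    ∀ᵐ ω ∂P, simpleInt y (π.map g) ω = ∑ v ∈ s, g v * y (π ⁻¹' {v}) ω := by
  classical
  have h1 : ∀ᵐ ω ∂P, ∀ c ∈ (π.map g).range, y ((π.map g) ⁻¹' {c}) ω =
      ∑ v ∈ π.range with g v = c, y (π ⁻¹' {v}) ω := by
    rw [Finset.eventually_all]
    intro c _
    filter_upwards [hy.preimage_finset π {v ∈ π.range | g v = c}] with ω hω
    rw [SimpleFunc.map_preimage_singleton, hω]
  have h2 : ∀ᵐ ω ∂P, ∀ v ∈ s \ π.range, y (π ⁻¹' {v}) ω = 0 := by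
    rw [Finset.eventually_all]
    intro v hv
    have : π ⁻¹' {v} = ∅ := by
      refine (SimpleFunc.preimage_eq_empty_iff π v).2 (Finset.mem_sdiff.1 hv).2
    rw [this]
    exact hy.empty
  filter_upwards [h1, h2] with ω h1 h2
  rw [← Finset.sum_sdiff hs, Finset.sum_eq_zero (s := s \ π.range), zero_add]
  · unfold simpleInt
    rw [← Finset.sum_fiberwise_of_maps_to (s := π.range) (t := (π.map g).range) (g := g)]
    · refine Finset.sum_congr rfl fun c hc => ?_
      rw [h1 c hc, Finset.mul_sum]
      refine Finset.sum_congr rfl fun v hv => ?_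
      rw [(Finset.mem_filter.1 hv).2]
    · intro v hv
      rw [SimpleFunc.range_map]
      exact Finset.mem_image_of_mem g hv
  · intro v hv
    rw [h2 v hv, mul_zero]

/-- Both functions factor through `f.pair g`, whose fibres are a common refinement of their level
sets. -/
lemma simpleInt_add (hy : ExhaustiveContent P y) (f g : SimpleFunc X ℝ) :
    ∀ᵐ ω ∂P, simpleInt y (f + g) ω = simpleInt y f ω + simpleInt y g ω := by
  have h1 := hy.simpleInt_map (f.pair g) (fun p => p.1 + p.2) subset_rfl
  have h2 := hy.simpleInt_map (f.pair g) Prod.fst subset_rfl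
  have h3 := hy.simpleInt_map (f.pair g) Prod.snd subset_rfl
  have e1 : (f.pair g).map (fun p => p.1 + p.2) = f + g := rfl
  have e2 : (f.pair g).map Prod.fst = f := rfl
  have e3 : (f.pair g).map Prod.snd = g := rfl
  rw [e1] at h1
  rw [e2] at h2
  rw [e3] at h3
  filter_upwards [h1, h2, h3] with ω h1 h2 h3
  rw [h1, h2, h3, ← Finset.sum_add_distrib]
  exact Finset.sum_congr rfl fun _ _ => by ring

lemma simpleInt_smul (hy : ExhaustiveContent P y) (a : ℝ) (f : SimpleFunc X ℝ) :
    ∀ᵐ ω ∂P, simpleInt y (a • f) ω = a * simpleInt y f ω := by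
  have h1 := hy.simpleInt_map f (fun c => a * c) subset_rfl
  have e1 : f.map (fun c => a * c) = a • f := rfl
  rw [e1] at h1
  filter_upwards [h1] with ω h1
  rw [h1, simpleInt, Finset.mul_sum]
  exact Finset.sum_congr rfl fun _ _ => by ring

lemma simpleInt_sum (hy : ExhaustiveContent P y) {ι : Type*} (s : Finset ι) (a : ι → ℝ)
    (f : ι → SimpleFunc X ℝ) :
    ∀ᵐ ω ∂P, simpleInt y (∑ i ∈ s, a i • f i) ω = ∑ i ∈ s, a i * simpleInt y (f i) ω := by
  classical
  induction s using Finset.induction_on with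
  | empty =>
    filter_upwards [hy.simpleInt_smul 0 (0 : SimpleFunc X ℝ)] with ω h
    rw [zero_smul, zero_mul] at h
    simpa using h
  | insert i s hi ih =>
    rw [Finset.sum_insert hi]
    filter_upwards [ih, hy.simpleInt_add (a i • f i) (∑ i ∈ s, a i • f i),
      hy.simpleInt_smul (a i) (f i)] with ω h1 h2 h3
    rw [h2, h3, h1, Finset.sum_insert hi]

lemma simpleInt_indicator (hy : ExhaustiveContent P y) {A : Set X} (hA : MeasurableSet A)
    (c : ℝ) : ∀ᵐ ω ∂P,
    simpleInt y (SimpleFunc.piecewise A hA (SimpleFunc.const X c) (SimpleFunc.const X 0)) ω =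
      c * y A ω := by
  -- Factoring through membership in `A` avoids separate cases for c = 0 and for A empty or the
  -- whole space, where the range of the indicator collapses.
  set π : SimpleFunc X Prop := SimpleFunc.piecewise A hA (SimpleFunc.const X True)
    (SimpleFunc.const X False)
  classical
  have h := hy.simpleInt_map π (fun p => if p then c else 0) (s := {True, False}) (by
    intro p _
    by_cases hp : p <;> simp [hp])
  have e : π.map (fun p => if p then c else 0) =
      SimpleFunc.piecewise A hA (SimpleFunc.const X c) (SimpleFunc.const X 0) := by
    ext x
    by_cases hx : x ∈ A <;> simp [π, hx]
  have e2 : π ⁻¹' {True} = A := by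
    ext x
    by_cases hx : x ∈ A <;> simp [π, hx]
  rw [e] at h
  filter_upwards [h] with ω h
  rw [h, Finset.sum_pair (by simp)]
  simp [e2]

end ExhaustiveContent

end Content


/-! ### Boundedness of the range -/

section Tree

/-- The sequence defined by a recursion in which each term depends on all previous ones. -/
noncomputable def historySeq {α : Type*} [Inhabited α] (g : ℕ → (ℕ → α) → α) : ℕ → α
  | l => g l (fun i => if _h : i < l then historySeq g i else default)

lemma historySeq_eq {α : Type*} [Inhabited α] (g : ℕ → (ℕ → α) → α) (l : ℕ) :
    historySeq g l = g l (fun i => if i < l then historySeq g i else default) := by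
  rw [historySeq]
  simp

variable {X : Type*}

/-- The cell of level `l` with code `F ⊆ {0, …, l - 1}` of the partition generated by
`A 0, …, A (l - 1)`. -/
def treeCell (A : ℕ → Set X) (l : ℕ) (F : Finset ℕ) : Set X :=
  {x | ∀ i < l, x ∈ A i ↔ i ∈ F}

variable {A : ℕ → Set X} {l : ℕ} {F G : Finset ℕ}

lemma treeCell_congr {A' : ℕ → Set X} (h : ∀ i < l, A i = A' i) :
    treeCell A l F = treeCell A' l F := by
  ext x
  exact forall₂_congr fun i hi => by rw [h i hi]

lemma treeCell_succ (hF : F ∈ (Finset.range l).powerset) :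
    treeCell A (l + 1) F = treeCell A l F \ A l := by
  have hl : l ∉ F := fun h => by simpa using Finset.mem_powerset.1 hF h
  ext x
  simp only [treeCell, mem_ofPred_eq, Set.mem_sdiff]
  constructor
  · exact fun h => ⟨fun i hi => h i (by omega), fun hx => hl ((h l (by omega)).1 hx)⟩
  · rintro ⟨h, hx⟩ i hi
    rcases Nat.lt_succ_iff_lt_or_eq.1 hi with hi | rfl
    · exact h i hi
    · simp [hx, hl]

lemma treeCell_succ_insert (hF : F ∈ (Finset.range l).powerset) :
    treeCell A (l + 1) (insert l F) = treeCell A l F ∩ A l := by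
  have hl : l ∉ F := fun h => by simpa using Finset.mem_powerset.1 hF h
  ext x
  simp only [treeCell, mem_ofPred_eq, mem_inter_iff, Finset.mem_insert]
  constructor
  · exact fun h => ⟨fun i hi => by simpa [hi.ne] using h i (by omega), by simpa using h l (by omega)⟩
  · rintro ⟨h, hx⟩ i hi
    rcases Nat.lt_succ_iff_lt_or_eq.1 hi with hi | rfl
    · simpa [hi.ne] using h i hi
    · simp [hx]

lemma disjoint_treeCell (hF : F ∈ (Finset.range l).powerset) (hG : G ∈ (Finset.range l).powerset)
    (h : F ≠ G) : Disjoint (treeCell A l F) (treeCell A l G) := by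
  rw [Set.disjoint_left]
  intro x hxF hxG
  refine h (Finset.ext fun i => ?_)
  rw [Finset.mem_powerset] at hF hG
  constructor
  · intro hi
    have hil := Finset.mem_range.1 (hF hi)
    exact (hxG i hil).1 ((hxF i hil).2 hi)
  · intro hi
    have hil := Finset.mem_range.1 (hG hi)
    exact (hxF i hil).1 ((hxG i hil).2 hi)

lemma iUnion_treeCell (A : ℕ → Set X) (l : ℕ) :
    ⋃ F ∈ (Finset.range l).powerset, treeCell A l F = univ := by
  classical
  refine eq_univ_of_forall fun x => ?_
  rw [mem_iUnion₂]
  refine ⟨{i ∈ Finset.range l | x ∈ A i}, by simp, fun i hi => ?_⟩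
  simp [hi]

lemma treeCell_subset_treeCell {L : ℕ} (h : L ≤ l) :
    treeCell A l F ⊆ treeCell A L (F ∩ Finset.range L) := by
  intro x hx i hi
  rw [hx i (hi.trans_le h)]
  simp [hi]

lemma measurableSet_treeCell [MeasurableSpace X] (hA : ∀ i, MeasurableSet (A i)) (l : ℕ)
    (F : Finset ℕ) : MeasurableSet (treeCell A l F) := by
  have : treeCell A l F = ⋂ i, ⋂ (_ : i < l), {x | x ∈ A i ↔ i ∈ F} := by
    ext x
    simp [treeCell]
  rw [this]
  refine MeasurableSet.iInter fun i => MeasurableSet.iInter fun _ => ?_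
  by_cases h : i ∈ F
  · have : {x | x ∈ A i ↔ i ∈ F} = A i := by ext; simp [h]
    rw [this]
    exact hA i
  · have : {x | x ∈ A i ↔ i ∈ F} = (A i)ᶜ := by ext; simp [h]
    rw [this]
    exact (hA i).compl

/-- In an additive tree of real numbers, halving the threshold at each step, every splitting of a
vertex into two large ones increases the number of large vertices. -/
lemma card_split_le_card_big {z : ℕ → Finset ℕ → ℝ}
    (hz : ∀ l, ∀ F ∈ (Finset.range l).powerset, z l F = z (l + 1) F + z (l + 1) (insert l F))
    {I : ℕ → Finset ℕ → Prop}
    (hI : ∀ l, ∀ F ∈ (Finset.range l).powerset, I l F → I (l + 1) F ∧ I (l + 1) (insert l F))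
    (a m : ℕ) [DecidablePred fun l => ∃ F ∈ (Finset.range l).powerset, I l F ∧
      4 ^ l < |z (l + 1) F| ∧ 4 ^ l < |z (l + 1) (insert l F)|]
    (t : ℝ) [DecidablePred fun F => I (a + m) F ∧ t < |z (a + m) F|] (ht0 : 0 ≤ t)
    (ht : t * 2 ^ m ≤ 4 ^ a) :
    ((Finset.Ico a (a + m)).filter fun l => ∃ F ∈ (Finset.range l).powerset, I l F ∧
      4 ^ l < |z (l + 1) F| ∧ 4 ^ l < |z (l + 1) (insert l F)|).card ≤
    ((Finset.range (a + m)).powerset.filter fun F => I (a + m) F ∧ t < |z (a + m) F|).card := by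
  classical
  induction m generalizing t with
  | zero => simp
  | succ m ih =>
    revert t
    rw [← add_assoc]
    intro t _ ht0 ht
    -- A vertex above 2t has a child above t, so the threshold 2t one level up loses no large
    -- vertex.
    have ih' := ih (2 * t) (by positivity) (by rw [pow_succ] at ht; linarith)
    rw [Finset.range_add_one, Finset.card_filter, Finset.card_filter,
      Finset.sum_Ico_succ_top (Nat.le_add_right a m), Finset.sum_powerset_insert (by simp),
      ← Finset.card_filter, ← Finset.sum_add_distrib]
    refine (Nat.add_le_add_right ih' _).trans ?_
    have htl : t ≤ 4 ^ (a + m) := by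
      have h1 : (1 : ℝ) ≤ 2 ^ (m + 1) := one_le_pow₀ (by norm_num)
      have h2 : (4 : ℝ) ^ a ≤ 4 ^ (a + m) := pow_le_pow_right₀ (by norm_num) (by omega)
      nlinarith
    have hbig : ∀ F ∈ (Finset.range (a + m)).powerset, (I (a + m) F ∧ 2 * t < |z (a + m) F|) →
        (I (a + m + 1) F ∧ t < |z (a + m + 1) F|) ∨
        (I (a + m + 1) (insert (a + m) F) ∧ t < |z (a + m + 1) (insert (a + m) F)|) := by
      rintro F hF ⟨h1, h2⟩
      obtain ⟨h3, h4⟩ := hI _ F hF h1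
      rw [hz _ F hF] at h2
      by_contra! hcon
      have := abs_add_le (z (a + m + 1) F) (z (a + m + 1) (insert (a + m) F))
      linarith [hcon.1 h3, hcon.2 h4]
    rw [Finset.card_filter]
    split_ifs with hs
    · obtain ⟨F₀, hF₀, h1, h2, h3⟩ := hs
      obtain ⟨h4, h5⟩ := hI _ F₀ hF₀ h1
      -- The split vertex counts at most once one level up and contributes one split; below, both
      -- its children are large, which pays for both.
      rw [← Finset.sum_erase_add _ _ hF₀, ← Finset.sum_erase_add _ _ hF₀, add_assoc]
      refine add_le_add (Finset.sum_le_sum fun F hF => ?_) ?_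
      · have := hbig F (Finset.mem_of_mem_erase hF)
        split_ifs <;> first | omega | (exfalso; tauto)
      · have e1 : I (a + m + 1) F₀ ∧ t < |z (a + m + 1) F₀| := ⟨h4, htl.trans_lt h2⟩
        have e2 : I (a + m + 1) (insert (a + m) F₀) ∧
          t < |z (a + m + 1) (insert (a + m) F₀)| := ⟨h5, htl.trans_lt h3⟩
        rw [if_pos e1, if_pos e2]
        split_ifs <;> omega
    · rw [add_zero]
      refine Finset.sum_le_sum fun F hF => ?_
      have := hbig F hF
      split_ifs <;> first | omega | (exfalso; tauto)

end Tree

/-! ### Random colourings and finite families of random variables -/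

section Colouring

variable {Ω : Type*} [MeasurableSpace Ω] {P : Measure Ω} [IsProbabilityMeasure P]

lemma measurableSet_exists_mem {κ : Type*} (s : Finset κ) {p : κ → Ω → Prop}
    (h : ∀ v ∈ s, MeasurableSet {ω | p v ω}) : MeasurableSet {ω | ∃ v ∈ s, p v ω} := by
  have : {ω | ∃ v ∈ s, p v ω} = ⋃ v ∈ s, {ω | p v ω} := by
    ext
    simp
  rw [this]
  exact Finset.measurableSet_biUnion s h

lemma measurableSet_le_card {κ : Type*} (s : Finset κ) {p : κ → Ω → Prop}
    [∀ ω, DecidablePred fun v => p v ω]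
    (h : ∀ v ∈ s, MeasurableSet {ω | p v ω}) (M : ℕ) :
    MeasurableSet {ω | M ≤ (s.filter fun v => p v ω).card} := by
  classical
  have : {ω | M ≤ (s.filter fun v => p v ω).card} =
      {ω | ∃ t ∈ s.powersetCard M, ∀ v ∈ t, p v ω} := by
    ext ω
    simp only [mem_ofPred_eq, Finset.mem_powersetCard]
    constructor
    · intro hM
      obtain ⟨t, ht, htc⟩ := Finset.exists_subset_card_eq hM
      exact ⟨t, ⟨ht.trans (Finset.filter_subset _ _), htc⟩,
        fun v hv => (Finset.mem_filter.1 (ht hv)).2⟩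
    · rintro ⟨t, ⟨hts, htM⟩, ht⟩
      rw [← htM]
      exact Finset.card_le_card fun v hv => Finset.mem_filter.2 ⟨hts hv, ht v hv⟩
  rw [this]
  refine measurableSet_exists_mem _ fun t ht => ?_
  have : {ω | ∀ v ∈ t, p v ω} = ⋂ v ∈ t, {ω | p v ω} := by
    ext
    simp
  rw [this]
  exact Finset.measurableSet_biInter t fun v hv => h v ((Finset.mem_powersetCard.1 ht).1 hv)

/-- A random colouring misses a given colour on a set of `b` points with probability
`(1 - 1 / N) ^ b`. -/
lemma card_colourings_avoiding {κ : Type*} [Fintype κ] [DecidableEq κ] (N : ℕ) (hN : 0 < N)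
    (s : Finset κ) (j : Fin N) :
    ∑ c : κ → Fin N, ((N : ℝ) ^ Fintype.card κ)⁻¹ * (if ∀ v ∈ s, c v ≠ j then 1 else 0) =
      (1 - 1 / (N : ℝ)) ^ s.card := by
  have hN' : (N : ℝ) ≠ 0 := by positivity
  have h1 : ∀ c : κ → Fin N, ((N : ℝ) ^ Fintype.card κ)⁻¹ * (if ∀ v ∈ s, c v ≠ j then 1 else 0) =
      ∏ v, (N : ℝ)⁻¹ * (if v ∈ s ∧ c v = j then 0 else 1) := by
    intro c
    rw [Finset.prod_mul_distrib, Finset.prod_const, Finset.card_univ, inv_pow]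
    congr 1
    split_ifs with h
    · exact (Finset.prod_eq_one fun v _ => if_neg fun hv => h v hv.1 hv.2).symm
    · push Not at h
      obtain ⟨v, hv, hvj⟩ := h
      refine (Finset.prod_eq_zero (Finset.mem_univ v) ?_).symm
      exact if_pos ⟨hv, hvj⟩
  simp_rw [h1]
  have h2 := Finset.prod_univ_sum (fun _ : κ => (Finset.univ : Finset (Fin N)))
    (fun v (a : Fin N) => (N : ℝ)⁻¹ * (if v ∈ s ∧ a = j then (0 : ℝ) else 1))
  rw [Fintype.piFinset_univ] at h2
  rw [← h2]
  have h3 : ∀ v, ∑ a : Fin N, (N : ℝ)⁻¹ * (if v ∈ s ∧ a = j then (0 : ℝ) else 1) =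
      if v ∈ s then 1 - 1 / (N : ℝ) else 1 := by
    intro v
    rw [← Finset.mul_sum]
    by_cases hv : v ∈ s
    · have : ∀ a : Fin N, (if v ∈ s ∧ a = j then (0 : ℝ) else 1) = 1 - if a = j then 1 else 0 := by
        intro a
        by_cases ha : a = j <;> simp [hv, ha]
      simp_rw [this]
      rw [Finset.sum_sub_distrib]
      simp [hv]
      field_simp
    · simp [hv, hN']
  simp_rw [h3]
  rw [Finset.prod_ite_mem, Finset.univ_inter, Finset.prod_const]

/-- For fixed ω with at least `M` marked points, a uniform random colouring misses colour `j` with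
probability at most (1 - 1/N)^M. Averaging over ω and summing over the `N` colours gives one
colouring that is good for all colours simultaneously. -/
lemma exists_colouring {κ : Type*} [Fintype κ] [DecidableEq κ] {N M : ℕ} (hN : 0 < N)
    {η : ℝ} (hM : N * (1 - 1 / (N : ℝ)) ^ M ≤ η) {p : κ → Ω → Prop}
    [∀ ω, DecidablePred fun v => p v ω] (hp : ∀ v, MeasurableSet {ω | p v ω}) :
    ∃ c : κ → Fin N, ∀ j, P.real {ω | M ≤ (Finset.univ.filter fun v => p v ω).card ∧
      ∀ v, p v ω → c v ≠ j} ≤ η := by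
  set Ev : (κ → Fin N) → Fin N → Set Ω := fun c j =>
    {ω | M ≤ (Finset.univ.filter fun v => p v ω).card ∧ ∀ v, p v ω → c v ≠ j} with hEv
  have hN1 : (1 : ℝ) ≤ N := by exact_mod_cast hN
  have h01 : 0 ≤ 1 - 1 / (N : ℝ) := by
    rw [sub_nonneg, div_le_one (by positivity)]
    exact hN1
  have hmeas : ∀ c j, MeasurableSet (Ev c j) := by
    intro c j
    refine (measurableSet_le_card Finset.univ (fun v _ => hp v) M).inter ?_
    have : {ω | ∀ v, p v ω → c v ≠ j} = ⋂ v, {ω | p v ω → c v ≠ j} := by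
      ext
      simp
    change MeasurableSet {ω | ∀ v, p v ω → c v ≠ j}
    rw [this]
    refine MeasurableSet.iInter fun v => ?_
    by_cases hc : c v = j
    · have : {ω | p v ω → c v ≠ j} = {ω | p v ω}ᶜ := by ext; simp [hc]
      rw [this]
      exact (hp v).compl
    · simp [hc]
  set w : ℝ := ((N : ℝ) ^ Fintype.card κ)⁻¹ with hw
  have hw0 : 0 ≤ w := by positivity
  have hw1 : ∑ _c : κ → Fin N, w = 1 := by
    rw [Finset.sum_const, Finset.card_univ, Fintype.card_fun, Fintype.card_fin, nsmul_eq_mul, hw]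
    push_cast
    exact mul_inv_cancel₀ (by positivity)
  have h1 : ∀ j, ∑ c, w * P.real (Ev c j) ≤ (1 - 1 / (N : ℝ)) ^ M := by
    intro j
    have := sum_mul_measureReal_le (P := P) (s := Finset.univ) (w := fun _ : κ → Fin N => w)
      (B := fun c => Ev c j) (Q := ∅) (κ := (1 - 1 / (N : ℝ)) ^ M) (fun _ _ => hw0) hw1.le
      (fun c _ => hmeas c j) MeasurableSet.empty (pow_nonneg h01 _)
      (Eventually.of_forall fun ω _ => ?_)
    · simpa using this
    · by_cases hω : M ≤ (Finset.univ.filter fun v => p v ω).card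
      · refine le_trans (le_of_eq ?_) (pow_le_pow_of_le_one h01 (by
          rw [sub_le_self_iff]; positivity) hω)
        rw [← card_colourings_avoiding N hN _ j]
        refine Finset.sum_congr rfl fun c _ => ?_
        congr 1
        by_cases hc : ∀ v ∈ Finset.univ.filter fun v => p v ω, c v ≠ j
        · rw [if_pos hc, indicator_of_mem]
          · rfl
          · exact ⟨hω, fun v hv => hc v (by simpa using hv)⟩
        · rw [if_neg hc, indicator_of_notMem]
          rintro ⟨_, h⟩
          exact hc fun v hv => h v (by simpa using hv)
      · refine le_trans (Finset.sum_nonpos fun c _ => ?_) (pow_nonneg h01 _)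
        rw [indicator_of_notMem (fun h => hω h.1), mul_zero]
  have h2 : ∑ c, w * ∑ j, P.real (Ev c j) ≤ η := by
    refine le_trans ?_ hM
    simp_rw [Finset.mul_sum]
    rw [Finset.sum_comm]
    refine (Finset.sum_le_sum fun j _ => h1 j).trans ?_
    simp
  obtain ⟨c, -, hc⟩ := exists_le_of_le_sum_mul (s := Finset.univ) (w := fun _ : κ → Fin N => w)
    (a := fun c => - ∑ j, P.real (Ev c j)) (c := -η) (fun _ _ => hw0) hw1 (by
      simp only [mul_neg, Finset.sum_neg_distrib]
      linarith)
  refine ⟨c, fun j => ?_⟩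
  have := Finset.single_le_sum (f := fun j => P.real (Ev c j)) (fun _ _ => measureReal_nonneg)
    (Finset.mem_univ j)
  linarith

/-- Finitely many random variables are bounded in probability. -/
lemma exists_bound_finset {κ : Type*} (s : Finset κ) {Z : κ → Ω → ℝ}
    (hZ : ∀ v ∈ s, Measurable (Z v)) {η : ℝ} (hη : 0 < η) :
    ∃ K : ℝ, 0 ≤ K ∧ P.real {ω | ∃ v ∈ s, K < |Z v ω|} ≤ η := by
  have h := tendsto_measure_iInter_atTop (μ := P) (s := fun n : ℕ => {ω | ∃ v ∈ s, (n : ℝ) < |Z v ω|})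
    (fun n => (measurableSet_exists_mem s fun v hv =>
      measurableSet_lt measurable_const (hZ v hv).abs).nullMeasurableSet)
    (fun m n hmn ω ⟨v, hv, hω⟩ => ⟨v, hv, (Nat.cast_le.2 hmn).trans_lt hω⟩)
    ⟨0, measure_ne_top _ _⟩
  have he : ⋂ n : ℕ, {ω | ∃ v ∈ s, (n : ℝ) < |Z v ω|} = ∅ := by
    refine eq_empty_of_forall_notMem fun ω hω => ?_
    obtain ⟨n, hn⟩ := exists_nat_ge (∑ v ∈ s, |Z v ω|)
    obtain ⟨v, hv, h⟩ := mem_iInter.1 hω n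
    have := Finset.single_le_sum (f := fun v => |Z v ω|) (fun _ _ => abs_nonneg _) hv
    linarith
  rw [he, measure_empty] at h
  obtain ⟨n, hn⟩ := (h.eventually_lt_const (ENNReal.ofReal_pos.2 hη)).exists
  refine ⟨n, Nat.cast_nonneg n, ?_⟩
  exact ENNReal.toReal_le_of_le_ofReal hη.le hn.le

end Colouring


/-! ### Boundedness of the range of an exhaustive content -/

section Range

variable {X : Type*} [MeasurableSpace X] {Ω : Type*} [MeasurableSpace Ω] {P : Measure Ω}

/-- The event that some cell of level `l` inside `E` is split by `A l` into two large parts. -/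
def splitEvent (y : Set X → Ω → ℝ) (A : ℕ → Set X) (l : ℕ) (E : Set X) : Set Ω :=
  {ω | ∃ F ∈ (Finset.range l).powerset, treeCell A l F ⊆ E ∧
    4 ^ l < |y (treeCell A (l + 1) F) ω| ∧ 4 ^ l < |y (treeCell A (l + 1) (insert l F)) ω|}

/-- On infinitely many dyadic windows, the average probability of `splitEvent` is at least `s`. -/
def SplitsOften (P : Measure Ω) (y : Set X → Ω → ℝ) (A : ℕ → Set X) (E : Set X) (s : ℝ) : Prop :=
  ∃ᶠ i : ℕ in atTop,
    s * 2 ^ i ≤ ∑ l ∈ Finset.Ico (2 ^ i) (2 ^ i + 2 ^ i), P.real (splitEvent y A l E)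

omit [MeasurableSpace X] in
lemma SplitsOften.mono {y : Set X → Ω → ℝ} {A : ℕ → Set X} {E : Set X} {s s' : ℝ} (h : SplitsOften P y A E s)
    (hs : s' ≤ s) : SplitsOften P y A E s' :=
  Frequently.mono h fun _ hi => le_trans (by gcongr) hi

namespace ExhaustiveContent

variable {y : Set X → Ω → ℝ}

lemma measurableSet_splitEvent (hy : ExhaustiveContent P y) (A : ℕ → Set X) (l : ℕ) (E : Set X) :
    MeasurableSet (splitEvent y A l E) := by
  refine measurableSet_exists_mem _ fun F _ => ?_
  refine (MeasurableSet.const _).inter (MeasurableSet.inter ?_ ?_)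
  · exact measurableSet_lt measurable_const (hy.measurable _).abs
  · exact measurableSet_lt measurable_const (hy.measurable _).abs

lemma treeCell_add (hy : ExhaustiveContent P y) {A : ℕ → Set X} (hA : ∀ i, MeasurableSet (A i)) :
    ∀ᵐ ω ∂P, ∀ l, ∀ F ∈ (Finset.range l).powerset, y (treeCell A l F) ω =
      y (treeCell A (l + 1) F) ω + y (treeCell A (l + 1) (insert l F)) ω := by
  rw [ae_all_iff]
  intro l
  rw [Finset.eventually_all]
  intro F hF
  have hT := measurableSet_treeCell hA l F
  filter_upwards [hy.union (treeCell A l F \ A l) (treeCell A l F ∩ A l) (hT.diff (hA l))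
    (hT.inter (hA l)) disjoint_sdiff_inter] with ω h
  rw [treeCell_succ hF, treeCell_succ_insert hF, ← h, sdiff_union_inter]

variable [IsProbabilityMeasure P]

/-- If the range is not bounded in probability, every finite partition can be split by a set in
such a way that with positive probability some cell has two large parts. -/
lemma exists_split (hy : ExhaustiveContent P y) {δ : ℝ} (hδ : 0 < δ)
    (h : ∀ C : ℝ, ∃ A, MeasurableSet A ∧ δ < P.real {ω | C < |y A ω|})
    {A : ℕ → Set X} (hA : ∀ i, MeasurableSet (A i)) (l : ℕ) (C : ℝ) :
    ∃ B, MeasurableSet B ∧ δ / 2 ≤ P.real {ω | ∃ F ∈ (Finset.range l).powerset,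
      C < |y (treeCell A l F \ B) ω| ∧ C < |y (treeCell A l F ∩ B) ω|} := by
  set s := (Finset.range l).powerset with hs
  obtain ⟨K, hK, hKP⟩ := exists_bound_finset (P := P) s
    (Z := fun F => y (treeCell A l F)) (fun F _ => hy.measurable _) (half_pos hδ)
  set C' := max C 0 with hC'
  -- When |y B| exceeds this bound, some cell has |y (cell ∩ B)| > C' + K. As |y cell| ≤ K outside
  -- an event of probability δ/2, the other part of that cell exceeds C' ≥ C.
  obtain ⟨B, hB, hBP⟩ := h (s.card • (C' + K))
  refine ⟨B, hB, ?_⟩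
  have hT := measurableSet_treeCell hA l
  have h1 : ∀ᵐ ω ∂P, ∀ F ∈ s, y (treeCell A l F) ω =
      y (treeCell A l F \ B) ω + y (treeCell A l F ∩ B) ω := by
    rw [Finset.eventually_all]
    intro F _
    filter_upwards [hy.union (treeCell A l F \ B) (treeCell A l F ∩ B) ((hT F).diff hB)
      ((hT F).inter hB) disjoint_sdiff_inter] with ω h
    rw [← h, sdiff_union_inter]
  have h2 := hy.biUnion s (V := fun F => treeCell A l F ∩ B) (fun F _ => (hT F).inter hB)
    (fun F hF G hG hFG => ((disjoint_treeCell hF hG hFG).mono inter_subset_left inter_subset_left))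
  have e : (⋃ F ∈ s, treeCell A l F ∩ B) = B := by
    rw [← iUnion₂_inter, iUnion_treeCell, univ_inter]
  rw [e] at h2
  have h3 : P.real {ω | s.card • (C' + K) < |y B ω|} ≤
      P.real {ω | ∃ F ∈ s, C < |y (treeCell A l F \ B) ω| ∧ C < |y (treeCell A l F ∩ B) ω|} +
      P.real {ω | ∃ F ∈ s, K < |y (treeCell A l F) ω|} := by
    refine le_trans ?_ (measureReal_union_le _ _)
    refine ENNReal.toReal_mono (measure_ne_top _ _) (measure_mono_ae ?_)
    filter_upwards [h1, h2] with ω h1 h2 hω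
    change s.card • (C' + K) < |y B ω| at hω
    by_cases hω' : ∃ F ∈ s, K < |y (treeCell A l F) ω|
    · exact Or.inr hω'
    left
    push Not at hω'
    obtain ⟨F, hF, hFB⟩ : ∃ F ∈ s, C' + K < |y (treeCell A l F ∩ B) ω| := by
      by_contra! hcon
      have := Finset.sum_le_card_nsmul s (fun F => |y (treeCell A l F ∩ B) ω|) _ hcon
      rw [h2] at hω
      linarith [Finset.abs_sum_le_sum_abs (fun F => y (treeCell A l F ∩ B) ω) s]
    refine ⟨F, hF, ?_, ?_⟩
    · have h4 := hω' F hF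
      rw [h1 F hF] at h4
      have h5 := abs_sub (y (treeCell A l F \ B) ω + y (treeCell A l F ∩ B) ω)
        (y (treeCell A l F \ B) ω)
      rw [add_sub_cancel_left] at h5
      linarith [le_max_left C 0]
    · linarith [le_max_left C 0]
  linarith

/-- If the range is not bounded in probability, there is a sequence of sets such that each of them
splits some cell of the partition generated by its predecessors into two large parts. -/
lemma exists_splitting_sequence (hy : ExhaustiveContent P y) {δ : ℝ} (hδ : 0 < δ)
    (h : ∀ C : ℝ, ∃ A, MeasurableSet A ∧ δ < P.real {ω | C < |y A ω|}) :
    ∃ A : ℕ → Set X, (∀ i, MeasurableSet (A i)) ∧ ∀ l, δ / 2 ≤ P.real (splitEvent y A l univ) := by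
  have h1 : ∀ (l : ℕ) (A : ℕ → {S : Set X // MeasurableSet S}), ∃ B : {S : Set X // MeasurableSet S},
      δ / 2 ≤ P.real {ω | ∃ F ∈ (Finset.range l).powerset,
      4 ^ l < |y (treeCell (fun i => (A i : Set X)) l F \ B) ω| ∧
      4 ^ l < |y (treeCell (fun i => (A i : Set X)) l F ∩ B) ω|} := by
    intro l A
    obtain ⟨B, hB, hBP⟩ := hy.exists_split hδ h (A := fun i => (A i : Set X))
      (fun i => (A i).2) l (4 ^ l)
    exact ⟨⟨B, hB⟩, hBP⟩
  choose g hg using h1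
  have : Inhabited {S : Set X // MeasurableSet S} := ⟨⟨∅, .empty⟩⟩
  set A : ℕ → {S : Set X // MeasurableSet S} := historySeq g with hAg
  refine ⟨fun l => (A l : Set X), fun l => (A l).2, fun l => ?_⟩
  have h2 := hg l (fun i => if i < l then A i else default)
  rw [hAg, ← historySeq_eq g l, ← hAg] at h2
  refine h2.trans (measureReal_mono ?_)
  rintro ω ⟨F, hF, hω⟩
  refine ⟨F, hF, subset_univ _, ?_⟩
  have e : treeCell (fun i => ((if i < l then A i else default : {S : Set X //
      MeasurableSet S}) : Set X)) l F = treeCell (fun i => (A i : Set X)) l F :=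
    treeCell_congr fun i hi => by rw [if_pos hi]
  rw [e] at hω
  rwa [treeCell_succ hF, treeCell_succ_insert hF]

/-- On a window where cells split often, there are many large cells with positive probability. -/
lemma le_measure_many_big (hy : ExhaustiveContent P y) {A : ℕ → Set X}
    (hA : ∀ i, MeasurableSet (A i)) {E : Set X} {s : ℝ} (hs : 0 < s) {i M : ℕ}
    (h : s * 2 ^ i ≤ ∑ l ∈ Finset.Ico (2 ^ i) (2 ^ i + 2 ^ i), P.real (splitEvent y A l E))
    (hM : (M : ℝ) ≤ s / 2 * 2 ^ i)
    [∀ ω, DecidablePred fun F => treeCell A (2 ^ i + 2 ^ i) F ⊆ E ∧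
      1 < |y (treeCell A (2 ^ i + 2 ^ i) F) ω|] :
    s / 2 ≤ P.real {ω | M ≤ ((Finset.range (2 ^ i + 2 ^ i)).powerset.filter fun F =>
      treeCell A (2 ^ i + 2 ^ i) F ⊆ E ∧ 1 < |y (treeCell A (2 ^ i + 2 ^ i) F) ω|).card} := by
  classical
  have h2 : (0 : ℝ) < 2 ^ i := by positivity
  have hw : ∑ _l ∈ Finset.Ico (2 ^ i) (2 ^ i + 2 ^ i), ((2 : ℝ) ^ i)⁻¹ = 1 := by
    rw [Finset.sum_const, Nat.card_Ico, Nat.add_sub_cancel, nsmul_eq_mul]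
    push_cast
    exact mul_inv_cancel₀ h2.ne'
  have hmeas : ∀ F ∈ (Finset.range (2 ^ i + 2 ^ i)).powerset, MeasurableSet {ω |
      treeCell A (2 ^ i + 2 ^ i) F ⊆ E ∧ 1 < |y (treeCell A (2 ^ i + 2 ^ i) F) ω|} := fun F _ =>
    (MeasurableSet.const _).inter (measurableSet_lt measurable_const (hy.measurable _).abs)
  -- The fraction of splitting levels in the window has mean at least s and is at most 1, so it can
  -- be at most s/2 outside `Q` only if `Q` has probability at least s/2.
  have key := sum_mul_measureReal_le (P := P) (s := Finset.Ico (2 ^ i) (2 ^ i + 2 ^ i))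
    (w := fun _ => ((2 : ℝ) ^ i)⁻¹) (B := fun l => splitEvent y A l E)
    (Q := {ω | M ≤ ((Finset.range (2 ^ i + 2 ^ i)).powerset.filter fun F =>
      treeCell A (2 ^ i + 2 ^ i) F ⊆ E ∧ 1 < |y (treeCell A (2 ^ i + 2 ^ i) F) ω|).card})
    (κ := s / 2) (fun _ _ => by positivity) hw.le (fun l _ => hy.measurableSet_splitEvent A l E)
    (measurableSet_le_card _ hmeas M) (by positivity) ?_
  · rw [← Finset.mul_sum] at key
    have : s ≤ (2 ^ i)⁻¹ * ∑ l ∈ Finset.Ico (2 ^ i) (2 ^ i + 2 ^ i),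
        P.real (splitEvent y A l E) := by
      rw [← div_eq_inv_mul, le_div_iff₀ h2]
      exact h
    linarith
  · filter_upwards [hy.treeCell_add hA] with ω hz hω
    -- The window starts at level 2^i and contains 2^i levels. Halving the threshold 4^(2^i) that
    -- many times leaves at least 1, so each splitting level yields a cell above 1 at the end.
    have hc := card_split_le_card_big (z := fun l F => y (treeCell A l F) ω) hz
      (I := fun l F => treeCell A l F ⊆ E) (fun l F hF hFE => by
        rw [treeCell_succ hF, treeCell_succ_insert hF]
        exact ⟨sdiff_subset.trans hFE, inter_subset_left.trans hFE⟩) (2 ^ i) (2 ^ i) 1 zero_le_one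
      (by
        rw [one_mul]
        exact pow_le_pow_left₀ (by norm_num) (by norm_num) _)
    have hcM := hc.trans_lt (not_le.1 hω)
    have e : ∑ l ∈ Finset.Ico (2 ^ i) (2 ^ i + 2 ^ i), ((2 : ℝ) ^ i)⁻¹ *
        (splitEvent y A l E).indicator 1 ω = ((2 : ℝ) ^ i)⁻¹ *
        (((Finset.Ico (2 ^ i) (2 ^ i + 2 ^ i)).filter fun l => ω ∈ splitEvent y A l E).card : ℝ) := by
      rw [← Finset.mul_sum, Finset.card_filter]
      push_cast
      congr 1
    rw [e, ← div_eq_inv_mul, div_le_iff₀ h2]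
    refine le_trans (Nat.cast_le.2 (le_trans (Finset.card_le_card fun l hl => ?_) hcM.le)) hM
    rw [Finset.mem_filter] at hl ⊢
    exact hl

/-- The union of a family of cells one of which is large with probability at least `t` contains
a set which is large with probability at least `t / 2`. -/
lemma exists_large_union (hy : ExhaustiveContent P y) {A : ℕ → Set X}
    (hA : ∀ i, MeasurableSet (A i)) {L : ℕ} {t : ℝ} {s : Finset (Finset ℕ)}
    (hs : s ⊆ (Finset.range L).powerset)
    (h : t ≤ P.real {ω | ∃ F ∈ s, 1 < |y (treeCell A L F) ω|}) :
    ∃ S ⊆ s, t / 2 ≤ P.real {ω | 1 / 2 < |y (⋃ F ∈ S, treeCell A L F) ω|} := by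
  have hadd : ∀ᵐ ω ∂P, ∀ S ∈ s.powerset,
      y (⋃ F ∈ S, treeCell A L F) ω = ∑ F ∈ S, y (treeCell A L F) ω := by
    rw [Finset.eventually_all]
    intro S hS
    have hS' := (Finset.mem_powerset.1 hS).trans hs
    exact hy.biUnion S (fun F _ => measurableSet_treeCell hA L F)
      fun F hF G hG hFG => disjoint_treeCell (hS' hF) (hS' hG) hFG
  have key := mul_measureReal_le_sum (P := P) (s := s.powerset)
    (w := fun S => bernWeight (fun _ => 1 / 2) s S)
    (B := fun S => {ω | 1 / 2 < |y (⋃ F ∈ S, treeCell A L F) ω|})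
    (G := {ω | ∃ F ∈ s, 1 < |y (treeCell A L F) ω|}) (c := 1 / 2)
    (fun S hS => half_bernWeight_nonneg hS)
    (fun S _ => measurableSet_lt measurable_const (hy.measurable _).abs)
    (measurableSet_exists_mem s fun F _ =>
      measurableSet_lt measurable_const (hy.measurable _).abs) ?_
  · obtain ⟨S, hS, hSP⟩ := exists_le_of_le_sum_mul (c := t / 2)
      (a := fun S => P.real {ω | 1 / 2 < |y (⋃ F ∈ S, treeCell A L F) ω|})
      (fun S hS => half_bernWeight_nonneg (s := s) hS) (sum_bernWeight _ s) (by linarith)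
    exact ⟨S, Finset.mem_powerset.1 hS, hSP⟩
  · filter_upwards [hadd] with ω hadd hω
    obtain ⟨F, hF, hFω⟩ := hω
    refine (half_le_sum_bernWeight (fun F => y (treeCell A L F) ω) s 0 (1 / 2) hF
      (by linarith)).trans (le_of_eq ?_)
    refine Finset.sum_congr rfl fun S hS => ?_
    rw [zero_add, ← hadd S hS]
    rfl

/-- For pairwise disjoint unions of cells of level `L`, removing most of them from `E` does not
affect much the splitting of cells of higher level. -/
lemma exists_splitsOften_diff {A : ℕ → Set X} (hy : ExhaustiveContent P y) {E : Set X} {s : ℝ}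
    (h : SplitsOften P y A E s) {L N : ℕ} (hN : 0 < N) (c : Finset ℕ → Fin N)
    {U : Fin N → Set X} (hU : ∀ j, U j = ⋃ F ∈ (Finset.range L).powerset,
      ⋃ (_ : treeCell A L F ⊆ E ∧ c F = j), treeCell A L F) :
    ∃ j, SplitsOften P y A (E \ U j) ((1 - 1 / (N : ℝ)) * s) := by
  classical
  by_contra! hcon
  simp only [SplitsOften, not_frequently, not_le] at hcon
  rw [← eventually_all] at hcon
  refine h ?_
  filter_upwards [hcon, eventually_ge_atTop L] with i hi hiL hcon2
  have hN' : (0 : ℝ) < N := by exact_mod_cast hN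
  -- A splitting cell of level l ≥ L lies in a single cell of level L, hence meets at most one `U j`
  -- and survives the removal of each of the others. Were every colour to fail on all late windows,
  -- summing over colours would contradict `h`.
  have hl : ∀ l ∈ Finset.Ico (2 ^ i) (2 ^ i + 2 ^ i), ((N : ℝ) - 1) * P.real (splitEvent y A l E) ≤
      ∑ j, P.real (splitEvent y A l (E \ U j)) := by
    intro l hl
    have hLl : L ≤ l := hiL.trans (Nat.lt_two_pow_self.le.trans (Finset.mem_Ico.1 hl).1)
    have := mul_measureReal_le_sum (P := P) (s := Finset.univ) (w := fun _ : Fin N => (1 : ℝ))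
      (B := fun j => splitEvent y A l (E \ U j)) (G := splitEvent y A l E) (c := (N : ℝ) - 1)
      (fun _ _ => zero_le_one) (fun j _ => hy.measurableSet_splitEvent A l _)
      (hy.measurableSet_splitEvent A l _) (Eventually.of_forall ?_)
    · simpa using this
    rintro ω ⟨F, hF, hFE, h1, h2⟩
    have hmem : ∀ j ≠ c (F ∩ Finset.range L), ω ∈ splitEvent y A l (E \ U j) := by
      intro j hj
      refine ⟨F, hF, ?_, h1, h2⟩
      rw [subset_sdiff]
      refine ⟨hFE, ?_⟩
      rw [hU, disjoint_iUnion₂_right]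
      intro G hG
      rw [disjoint_iUnion_right]
      rintro ⟨-, hGc⟩
      refine Disjoint.mono_left (treeCell_subset_treeCell hLl) (disjoint_treeCell ?_ hG ?_)
      · rw [Finset.mem_powerset]
        exact Finset.inter_subset_right
      · rintro rfl
        exact hj hGc.symm
    simp only [one_mul]
    rw [← Finset.sum_erase_add _ _ (Finset.mem_univ (c (F ∩ Finset.range L)))]
    refine le_add_of_le_of_nonneg ?_ (indicator_nonneg (by simp) ω)
    rw [Finset.sum_congr rfl (g := fun _ => (1 : ℝ))]
    · rw [Finset.sum_const, Finset.card_erase_of_mem (Finset.mem_univ _), Finset.card_univ,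
        Fintype.card_fin, nsmul_eq_mul, mul_one, Nat.cast_sub hN]
      simp
    · intro j hj
      rw [indicator_of_mem (hmem j (Finset.ne_of_mem_erase hj))]
      rfl
  have h1 := Finset.sum_le_sum hl
  rw [← Finset.mul_sum, Finset.sum_comm] at h1
  have : Nonempty (Fin N) := ⟨⟨0, hN⟩⟩
  have h2 := Finset.sum_lt_sum_of_nonempty (s := Finset.univ) Finset.univ_nonempty
    fun j _ => hi j
  rw [Finset.sum_const, Finset.card_univ, Fintype.card_fin, nsmul_eq_mul] at h2
  have h3 : (N : ℝ) * ((1 - 1 / (N : ℝ)) * s * 2 ^ i) = ((N : ℝ) - 1) * (s * 2 ^ i) := by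
    field_simp
  rw [h3] at h2
  have h4 : (0 : ℝ) ≤ (N : ℝ) - 1 := by
    rw [sub_nonneg]
    exact_mod_cast hN
  linarith [mul_le_mul_of_nonneg_left hcon2 h4]

/-- The inductive step: a set on which cells split often contains a large set whose removal does
not affect this much. -/
lemma exists_large_of_splitsOften (hy : ExhaustiveContent P y) {A : ℕ → Set X}
    (hA : ∀ i, MeasurableSet (A i)) {E : Set X} {s s' : ℝ} (hs' : 0 < s')
    (hss' : s' < s) (h : SplitsOften P y A E s) :
    ∃ E' ⊆ E, ∃ B ⊆ E, MeasurableSet B ∧ Disjoint B E' ∧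
      s / 8 ≤ P.real {ω | 1 / 2 < |y B ω|} ∧ SplitsOften P y A E' s' := by
  classical
  have hs : 0 < s := hs'.trans hss'
  -- Enough colours that deleting one of them keeps the splitting rate above s'.
  obtain ⟨N, hN⟩ := exists_nat_gt (s / (s - s'))
  have hN0 : (0 : ℝ) < N := (div_pos hs (by linarith)).trans hN
  have hNpos : 0 < N := by exact_mod_cast hN0
  have hNs : s' ≤ (1 - 1 / (N : ℝ)) * s := by
    rw [div_lt_iff₀ (by linarith)] at hN
    have : 1 / (N : ℝ) * s ≤ s - s' := by
      rw [div_mul_eq_mul_div, one_mul, div_le_iff₀ hN0]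
      linarith
    linarith
  have hlt1 : |1 - 1 / (N : ℝ)| < 1 := by
    have h1 : 0 < 1 / (N : ℝ) := by positivity
    have h2 : 1 / (N : ℝ) ≤ 1 := by
      rw [div_le_one hN0]
      exact_mod_cast hNpos
    rw [abs_lt]
    constructor <;> linarith
  obtain ⟨M, hM⟩ : ∃ M : ℕ, N * (1 - 1 / (N : ℝ)) ^ M ≤ s / 4 := by
    have := (tendsto_pow_atTop_nhds_zero_of_abs_lt_one hlt1).const_mul (N : ℝ)
    rw [mul_zero] at this
    exact ((this.eventually_lt_const (show (0 : ℝ) < s / 4 by positivity)).exists).imp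
      fun _ h => h.le
  have hMi : ∀ᶠ i : ℕ in atTop, (M : ℝ) ≤ s / 2 * 2 ^ i :=
    ((tendsto_pow_atTop_atTop_of_one_lt (one_lt_two (α := ℝ))).const_mul_atTop
      (half_pos hs)).eventually_ge_atTop _
  obtain ⟨i, hi, hMi⟩ := (h.and_eventually hMi).exists
  have hbig := hy.le_measure_many_big hA hs hi hMi
  set L := 2 ^ i + 2 ^ i with hL
  set κ := {F // F ∈ (Finset.range L).powerset}
  -- The colour to be removed is dictated by what keeps the remainder splitting often, so the
  -- colouring has to work for every colour.
  obtain ⟨c, hc⟩ := exists_colouring (P := P) (κ := κ) hNpos hM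
    (p := fun F ω => treeCell A L F ⊆ E ∧ 1 < |y (treeCell A L F) ω|) (fun F =>
      (MeasurableSet.const _).inter (measurableSet_lt measurable_const (hy.measurable _).abs))
  set c' : Finset ℕ → Fin N := fun F => if h : F ∈ (Finset.range L).powerset then c ⟨F, h⟩ else
    ⟨0, hNpos⟩ with hc'
  obtain ⟨j, hj⟩ := exists_splitsOften_diff hy h hNpos (L := L) c' (U := fun j =>
    ⋃ F ∈ (Finset.range L).powerset, ⋃ (_ : treeCell A L F ⊆ E ∧ c' F = j), treeCell A L F)
    (fun _ => rfl)
  set t := (Finset.range L).powerset.filter fun F => treeCell A L F ⊆ E ∧ c' F = j with ht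
  -- At least `M` large cells occur with probability s/2, and colour `j` misses all of them with
  -- probability at most s/4.
  have htP : s / 4 ≤ P.real {ω | ∃ F ∈ t, 1 < |y (treeCell A L F) ω|} := by
    have h1 := hc j
    have h2 : P.real {ω | M ≤ ((Finset.range L).powerset.filter fun F =>
        treeCell A L F ⊆ E ∧ 1 < |y (treeCell A L F) ω|).card} ≤
        P.real {ω | ∃ F ∈ t, 1 < |y (treeCell A L F) ω|} +
        P.real {ω | M ≤ (Finset.univ.filter fun F : κ => treeCell A L F ⊆ E ∧
          1 < |y (treeCell A L F) ω|).card ∧ ∀ F : κ, treeCell A L F ⊆ E ∧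
          1 < |y (treeCell A L F) ω| → c F ≠ j} := by
      refine le_trans (measureReal_mono ?_) (measureReal_union_le _ _)
      intro ω hω
      by_cases hex : ∃ F ∈ t, 1 < |y (treeCell A L F) ω|
      · exact Or.inl hex
      · right
        constructor
        · refine le_trans hω (le_of_eq ?_)
          rw [Finset.card_filter, Finset.card_filter, ← Finset.sum_coe_sort]
        · rintro ⟨F, hF⟩ ⟨hFE, hFω⟩ hcF
          refine hex ⟨F, ?_, hFω⟩
          rw [ht, Finset.mem_filter]
          refine ⟨hF, hFE, ?_⟩
          simp only [hc', dif_pos hF]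
          exact hcF
    linarith
  obtain ⟨S, hSt, hS⟩ := hy.exists_large_union hA (Finset.filter_subset _ _) htP
  refine ⟨_, sdiff_subset, ⋃ F ∈ S, treeCell A L F, ?_, ?_, ?_, ?_, hj.mono hNs⟩
  · exact iUnion₂_subset fun F hF => (Finset.mem_filter.1 (hSt hF)).2.1
  · exact Finset.measurableSet_biUnion S fun F _ => measurableSet_treeCell hA L F
  · refine Disjoint.mono_left ?_ disjoint_sdiff_self_right
    refine iUnion₂_subset fun F hF => ?_
    have hF' := Finset.mem_filter.1 (hSt hF)
    exact subset_iUnion₂_of_subset F hF'.1 (subset_iUnion_of_subset hF'.2 subset_rfl)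
  · linarith

/-- **The range of an `L₀`-valued measure is bounded in probability** (Talagrand; Kalton, Peck and
Roberts). -/
theorem bounded_range (hy : ExhaustiveContent P y) {δ : ℝ} (hδ : 0 < δ) :
    ∃ C : ℝ, 0 < C ∧ ∀ A, MeasurableSet A → P.real {ω | C < |y A ω|} ≤ δ := by
  by_contra! hcon
  have h : ∀ C : ℝ, ∃ A, MeasurableSet A ∧ δ < P.real {ω | C < |y A ω|} := by
    intro C
    obtain ⟨A, hA, hAP⟩ := hcon (max C 1) (by positivity)
    exact ⟨A, hA, hAP.trans_le (measureReal_mono fun ω hω => (le_max_left C 1).trans_lt hω)⟩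
  obtain ⟨A, hA, hAs⟩ := hy.exists_splitting_sequence hδ h
  -- The splitting rates decrease strictly from δ/2, the rate of the initial sequence, but stay
  -- above δ/4, so infinitely many removals are possible.
  set σ : ℕ → ℝ := fun k => δ / 4 * (1 + (1 / 2) ^ k) with hσ
  have hσ4 : ∀ k, δ / 4 ≤ σ k := fun k => by
    have : (0 : ℝ) ≤ (1 / 2) ^ k := by positivity
    simp only [hσ]
    nlinarith
  have hσ1 : ∀ k, σ (k + 1) < σ k := fun k => by
    have : (0 : ℝ) < (1 / 2) ^ k := by positivity
    simp only [hσ, pow_succ]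
    nlinarith
  have step : ∀ (k : ℕ) (E : Set X), ∃ E' B : Set X, SplitsOften P y A E (σ k) →
      E' ⊆ E ∧ B ⊆ E ∧ MeasurableSet B ∧ Disjoint B E' ∧
      σ k / 8 ≤ P.real {ω | 1 / 2 < |y B ω|} ∧ SplitsOften P y A E' (σ (k + 1)) := by
    intro k E
    by_cases hE : SplitsOften P y A E (σ k)
    · obtain ⟨E', hE', B, hB⟩ := hy.exists_large_of_splitsOften hA
        ((by positivity : 0 < δ / 4).trans_le (hσ4 (k + 1))) (hσ1 k) hE
      exact ⟨E', B, fun _ => ⟨hE', hB⟩⟩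
    · exact ⟨∅, ∅, fun h => (hE h).elim⟩
  choose nextE nextB hnext using step
  set E : ℕ → Set X := fun k => Nat.rec univ (fun k E => nextE k E) k with hE
  have hES : ∀ k, SplitsOften P y A (E k) (σ k) := by
    intro k
    induction k with
    | zero =>
      refine Frequently.of_forall fun i => ?_
      refine le_trans (le_of_eq ?_) (Finset.sum_le_sum fun l _ => hAs l)
      rw [Finset.sum_const, Nat.card_Ico, Nat.add_sub_cancel, nsmul_eq_mul]
      push_cast
      simp only [hσ, pow_zero]
      ring
    | succ k ih => exact (hnext k (E k) ih).2.2.2.2.2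
  set B : ℕ → Set X := fun k => nextB k (E k) with hB
  have hanti : Antitone E := antitone_nat_of_succ_le fun k => (hnext k (E k) (hES k)).1
  have hdisj : ∀ i j, i < j → Disjoint (B i) (B j) := fun i j hij =>
    (hnext i (E i) (hES i)).2.2.2.1.mono_right
      ((hnext j (E j) (hES j)).2.1.trans (hanti (Nat.succ_le_of_lt hij)))
  have hlim := hy.exhaustive B (fun k => (hnext k (E k) (hES k)).2.2.1)
    (fun i j hij => by
      rcases lt_or_gt_of_ne hij with h | h
      · exact hdisj i j h
      · exact (hdisj j i h).symm) (1 / 2) (by norm_num)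
  -- The disjoint sets `B k` exceed 1/2 with probability at least σ k / 8 ≥ δ/32, against
  -- exhaustivity.
  obtain ⟨n, hn⟩ := (hlim.eventually_lt_const (show 0 < δ / 32 by positivity)).exists
  have := (hnext n (E n) (hES n)).2.2.2.2.1
  linarith [hσ4 n]

end ExhaustiveContent

end Range


/-! ### Convex boundedness and the theorem of Nikishin -/

lemma bernDev_eq {ι : Type*} [DecidableEq ι] (p x : ι → ℝ) {s S : Finset ι} (hS : S ⊆ s) :
    bernDev p x s S = ∑ i ∈ S, x i - ∑ i ∈ s, p i * x i := by
  unfold bernDev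
  simp_rw [sub_mul, ite_mul, one_mul, zero_mul]
  rw [Finset.sum_sub_distrib, Finset.sum_ite_mem, Finset.inter_eq_right.2 hS]

lemma abs_bernDev_half_le {ι : Type*} [DecidableEq ι] (x : ι → ℝ) (s S : Finset ι) :
    |bernDev (fun _ => 1 / 2) x s S| ≤ (∑ i ∈ s, |x i|) / 2 := by
  rw [Finset.sum_div]
  refine (Finset.abs_sum_le_sum_abs _ _).trans (Finset.sum_le_sum fun i _ => ?_)
  rw [abs_mul]
  have : |(if i ∈ S then (1 : ℝ) else 0) - 1 / 2| = 1 / 2 := by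
    split_ifs <;> norm_num [abs_of_neg, abs_of_pos]
  rw [this]
  linarith

lemma MeasureTheory.SimpleFunc.finset_sum_smul_apply {X ι : Type*} [MeasurableSpace X]
    (s : Finset ι) (a : ι → ℝ) (f : ι → SimpleFunc X ℝ) (x : X) :
    (∑ i ∈ s, a i • f i) x = ∑ i ∈ s, a i * f i x := by
  classical
  induction s using Finset.induction_on with
  | empty => simp
  | insert i s hi ih => rw [Finset.sum_insert hi, Finset.sum_insert hi, SimpleFunc.add_apply, ih,
      SimpleFunc.smul_apply, smul_eq_mul]

section Nikishin

variable {X : Type*} [MeasurableSpace X] {Ω : Type*} [MeasurableSpace Ω] {P : Measure Ω}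
  [IsProbabilityMeasure P] {y : Set X → Ω → ℝ}

lemma measureReal_lt_abs_le_add {Z Z₁ Z₂ : Ω → ℝ} {a b c : ℝ} (hab : a + b ≤ c)
    (h : ∀ᵐ ω ∂P, |Z ω| ≤ |Z₁ ω| + |Z₂ ω|) :
    P.real {ω | c < |Z ω|} ≤ P.real {ω | a < |Z₁ ω|} + P.real {ω | b < |Z₂ ω|} := by
  refine le_trans ?_ (measureReal_union_le _ _)
  refine ENNReal.toReal_mono (measure_ne_top _ _) (measure_mono_ae ?_)
  filter_upwards [h] with ω h hω
  by_contra hcon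
  change ¬ (a < |Z₁ ω| ∨ b < |Z₂ ω|) at hcon
  change c < |Z ω| at hω
  push Not at hcon
  linarith [hcon.1, hcon.2]

namespace ExhaustiveContent

/-- A centred random subset sum is y(f⁻¹ S) - y(f⁻¹ range)/2, which exceeds 2C with probability at
most 2δ for each S. On the event considered, Paley-Zygmund with r = 2C makes at least a ninth of
these sums exceed 2C; averaging gives 9 · 2δ. -/
lemma measure_sum_sq_le (hy : ExhaustiveContent P y) {δ C : ℝ}
    (h : ∀ A, MeasurableSet A → P.real {ω | C < |y A ω|} ≤ δ) (f : SimpleFunc X ℝ) :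
    P.real {ω | 32 * C ^ 2 < ∑ c ∈ f.range, y (f ⁻¹' {c}) ω ^ 2} ≤ 18 * δ := by
  classical
  have key := mul_measureReal_le_sum (P := P) (s := f.range.powerset)
    (w := fun S => bernWeight (fun _ => 1 / 2) f.range S)
    (B := fun S => {ω | 2 * C < |bernDev (fun _ => 1 / 2) (fun c => y (f ⁻¹' {c}) ω) f.range S|})
    (G := {ω | 32 * C ^ 2 < ∑ c ∈ f.range, y (f ⁻¹' {c}) ω ^ 2}) (c := 1 / 9)
    (fun S hS => half_bernWeight_nonneg hS)
    (fun S _ => measurableSet_lt measurable_const (Measurable.abs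
      (Finset.measurable_sum _ fun _ _ => (hy.measurable _).const_mul _)))
    (measurableSet_lt measurable_const (Finset.measurable_sum _ fun _ _ =>
      (hy.measurable _).pow_const _)) (Eventually.of_forall fun ω hω => ?_)
  · have h2 : ∀ S ∈ f.range.powerset, P.real {ω | 2 * C <
        |bernDev (fun _ => 1 / 2) (fun c => y (f ⁻¹' {c}) ω) f.range S|} ≤ 2 * δ := by
      intro S hS
      have h3 := measureReal_lt_abs_le_add (P := P) (a := C) (b := C) (c := 2 * C)
        (Z := fun ω => bernDev (fun _ => 1 / 2) (fun c => y (f ⁻¹' {c}) ω) f.range S)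
        (Z₁ := y (f ⁻¹' S)) (Z₂ := y (f ⁻¹' f.range)) (by linarith) ?_
      · linarith [h _ (f.measurableSet_preimage S), h _ (f.measurableSet_preimage f.range)]
      · filter_upwards [hy.preimage_finset f S, hy.preimage_finset f f.range] with ω h1 h2
        rw [bernDev_eq _ _ (Finset.mem_powerset.1 hS), ← Finset.mul_sum, ← h1, ← h2]
        refine (abs_sub _ _).trans ?_
        rw [abs_mul, abs_of_pos (by norm_num : (0 : ℝ) < 1 / 2)]
        linarith [abs_nonneg (y (f ⁻¹' f.range) ω)]
    have h3 := Finset.sum_le_sum fun S hS =>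
      mul_le_mul_of_nonneg_left (h2 S hS) (half_bernWeight_nonneg (s := f.range) hS)
    rw [← Finset.sum_mul, sum_bernWeight] at h3
    linarith
  · change 32 * C ^ 2 < ∑ c ∈ f.range, y (f ⁻¹' {c}) ω ^ 2 at hω
    exact paley_zygmund_bernDev (fun c => y (f ⁻¹' {c}) ω) f.range (r := 2 * C) (by linarith)

/-- Integrals of simple functions with values in `[0, 1]` are bounded in probability. -/
lemma measure_sum_mul_le (hy : ExhaustiveContent P y) {δ C K : ℝ}
    (h : ∀ A, MeasurableSet A → P.real {ω | C < |y A ω|} ≤ δ) (hC : 0 < C) (hK1 : 1 ≤ K)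
    (hK : 8 ≤ δ * K ^ 2) (f : SimpleFunc X ℝ) {a : ℝ → ℝ} (ha : ∀ c ∈ f.range, 0 ≤ a c ∧ a c ≤ 1) :
    P.real {ω | 2 * (K * C) < |∑ c ∈ f.range, a c * y (f ⁻¹' {c}) ω|} ≤ 20 * δ := by
  classical
  have hKC : 0 < K * C := by positivity
  have hδ : 0 ≤ δ := measureReal_nonneg.trans (h ∅ .empty)
  have hCK : C ≤ K * C := le_mul_of_one_le_left hC.le hK1
  -- Choose each level set `c` independently with probability `a c`. Off `Q` the variance is at most
  -- 32C²/4 = 8C², so Chebyshev bounds the deviation probability by 8/K² ≤ δ. The total is 18δ from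
  -- `Q`, δ from Chebyshev and δ from y(f⁻¹ S).
  have key := sum_mul_measureReal_le (P := P) (s := f.range.powerset)
    (w := fun S => bernWeight a f.range S)
    (B := fun S => {ω | K * C < |bernDev a (fun c => y (f ⁻¹' {c}) ω) f.range S|})
    (Q := {ω | 32 * C ^ 2 < ∑ c ∈ f.range, y (f ⁻¹' {c}) ω ^ 2}) (κ := δ)
    (fun S hS => bernWeight_nonneg ha hS) (sum_bernWeight a f.range).le
    (fun S _ => measurableSet_lt measurable_const (Measurable.abs
      (Finset.measurable_sum _ fun _ _ => (hy.measurable _).const_mul _)))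
    (measurableSet_lt measurable_const (Finset.measurable_sum _ fun _ _ =>
      (hy.measurable _).pow_const _)) hδ (Eventually.of_forall fun ω hω => ?_)
  · have h1 : ∀ S ∈ f.range.powerset,
        P.real {ω | 2 * (K * C) < |∑ c ∈ f.range, a c * y (f ⁻¹' {c}) ω|} ≤ δ +
        P.real {ω | K * C < |bernDev a (fun c => y (f ⁻¹' {c}) ω) f.range S|} := by
      intro S hS
      have h3 := measureReal_lt_abs_le_add (P := P) (a := C) (b := K * C) (c := 2 * (K * C))
        (Z := fun ω => ∑ c ∈ f.range, a c * y (f ⁻¹' {c}) ω) (Z₁ := y (f ⁻¹' S))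
        (Z₂ := fun ω => bernDev a (fun c => y (f ⁻¹' {c}) ω) f.range S) (by linarith) ?_
      · linarith [h _ (f.measurableSet_preimage S)]
      · filter_upwards [hy.preimage_finset f S] with ω h1
        rw [bernDev_eq _ _ (Finset.mem_powerset.1 hS), ← h1]
        have := abs_sub (y (f ⁻¹' S) ω)
          (y (f ⁻¹' S) ω - ∑ c ∈ f.range, a c * y (f ⁻¹' {c}) ω)
        rwa [sub_sub_cancel] at this
    have h3 := Finset.sum_le_sum fun S hS =>
      mul_le_mul_of_nonneg_left (h1 S hS) (bernWeight_nonneg ha hS)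
    simp_rw [mul_add] at h3
    rw [Finset.sum_add_distrib, ← Finset.sum_mul, ← Finset.sum_mul, sum_bernWeight] at h3
    have h4 := hy.measure_sum_sq_le h f
    linarith
  · change ¬ (32 * C ^ 2 < ∑ c ∈ f.range, y (f ⁻¹' {c}) ω ^ 2) at hω
    have h2 := sum_bernWeight_sq a (fun c => y (f ⁻¹' {c}) ω) f.range
    have h3 : ∑ c ∈ f.range, a c * (1 - a c) * y (f ⁻¹' {c}) ω ^ 2 ≤ 8 * C ^ 2 := by
      have : ∑ c ∈ f.range, a c * (1 - a c) * y (f ⁻¹' {c}) ω ^ 2 ≤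
          ∑ c ∈ f.range, 1 / 4 * y (f ⁻¹' {c}) ω ^ 2 := by
        refine Finset.sum_le_sum fun c _ => mul_le_mul_of_nonneg_right ?_ (sq_nonneg _)
        nlinarith [sq_nonneg (a c - 1 / 2)]
      rw [← Finset.mul_sum] at this
      linarith
    have h4 : (K * C) ^ 2 * ∑ S ∈ f.range.powerset, bernWeight a f.range S *
        {ω | K * C < |bernDev a (fun c => y (f ⁻¹' {c}) ω) f.range S|}.indicator 1 ω ≤
        ∑ S ∈ f.range.powerset, bernWeight a f.range S *
          bernDev a (fun c => y (f ⁻¹' {c}) ω) f.range S ^ 2 := by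
      rw [Finset.mul_sum]
      refine Finset.sum_le_sum fun S hS => ?_
      rw [mul_left_comm]
      refine mul_le_mul_of_nonneg_left ?_ (bernWeight_nonneg ha hS)
      by_cases hω : K * C < |bernDev a (fun c => y (f ⁻¹' {c}) ω) f.range S|
      · rw [indicator_of_mem (by exact hω), Pi.one_apply, mul_one, ← sq_abs (bernDev _ _ _ _)]
        exact pow_le_pow_left₀ hKC.le hω.le 2
      · rw [indicator_of_notMem (by exact hω), mul_zero]
        exact sq_nonneg _
    rw [h2] at h4
    have h5 : 8 * C ^ 2 ≤ (K * C) ^ 2 * δ := by nlinarith [sq_nonneg C]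
    exact le_of_mul_le_mul_left (h4.trans (h3.trans h5)) (by positivity)

/-- **The convex hull of the range of an `L₀`-valued measure is bounded in probability.** -/
theorem bounded_simpleInt (hy : ExhaustiveContent P y) {δ : ℝ} (hδ : 0 < δ) :
    ∃ C : ℝ, 0 < C ∧ ∀ f : SimpleFunc X ℝ, (∀ x, |f x| ≤ 1) →
      P.real {ω | C < |simpleInt y f ω|} ≤ δ := by
  -- 20 parts are spent on (f + 1)/2 and one on the correction in f = 2 · (f + 1)/2 - 1.
  obtain ⟨C, hC, h⟩ := hy.bounded_range (show 0 < δ / 21 by positivity)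
  obtain ⟨K, hK1, hK⟩ : ∃ K : ℝ, 1 ≤ K ∧ 8 ≤ δ / 21 * K ^ 2 := by
    refine ⟨max 1 (168 / δ), le_max_left _ _, ?_⟩
    have h1 : 1 ≤ max 1 (168 / δ) := le_max_left _ _
    have h2 : 168 / δ ≤ max 1 (168 / δ) := le_max_right _ _
    rw [div_le_iff₀ hδ] at h2
    nlinarith
  have hCK : C ≤ K * C := le_mul_of_one_le_left hC.le hK1
  refine ⟨5 * (K * C), by positivity, fun f hf => ?_⟩
  have ha : ∀ c ∈ f.range, 0 ≤ (c + 1) / 2 ∧ (c + 1) / 2 ≤ 1 := by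
    intro c hc
    obtain ⟨x, rfl⟩ := SimpleFunc.mem_range.1 hc
    have := abs_le.1 (hf x)
    constructor <;> linarith
  have h1 := hy.measure_sum_mul_le h hC hK1 hK f ha
  have h2 := measureReal_lt_abs_le_add (P := P) (a := 4 * (K * C)) (b := C) (c := 5 * (K * C))
    (Z := simpleInt y f) (Z₁ := fun ω => 2 * ∑ c ∈ f.range, (c + 1) / 2 * y (f ⁻¹' {c}) ω)
    (Z₂ := y (f ⁻¹' f.range)) (by linarith) ?_
  · have e : {ω | 4 * (K * C) < |2 * ∑ c ∈ f.range, (c + 1) / 2 * y (f ⁻¹' {c}) ω|} =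
        {ω | 2 * (K * C) < |∑ c ∈ f.range, (c + 1) / 2 * y (f ⁻¹' {c}) ω|} := by
      ext ω
      simp only [mem_ofPred_eq, abs_mul, abs_two]
      constructor <;> intro h <;> linarith
    rw [e] at h2
    linarith [h _ (f.measurableSet_preimage f.range)]
  · filter_upwards [hy.preimage_finset f f.range] with ω hω
    rw [hω]
    refine le_trans (le_of_eq ?_) (abs_sub _ _)
    congr 1
    rw [Finset.mul_sum, ← Finset.sum_sub_distrib, simpleInt]
    exact Finset.sum_congr rfl fun _ _ => by ring

/-- A measurable set `B` on which `c |∫ f dμ| > 1` for some `|f| ≤ 1` and `c ≤ P(B) / K`. -/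
def IsLargeOn (P : Measure Ω) (y : Set X → Ω → ℝ) (K : ℝ) (B : Set Ω) : Prop :=
  MeasurableSet B ∧ ∃ (f : SimpleFunc X ℝ) (c : ℝ), (∀ x, |f x| ≤ 1) ∧ 0 ≤ c ∧
    (∀ ω ∈ B, 1 < c * |simpleInt y f ω|) ∧ c * K ≤ P.real B

/-- Since ∑ cᵢ K ≤ ∑ P(Bᵢ) ≤ 1, all combinations ∑ ±(1/2) cᵢ K fᵢ are bounded by 1. At a point of
the union some cᵢ K |∫ fᵢ| exceeds K, so at least half of the sign choices give an integral above
K/2; averaging bounds P(⋃ Bᵢ)/2 by δ/2. -/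
lemma measure_biUnion_isLargeOn_le (hy : ExhaustiveContent P y) {δ K : ℝ} (hK0 : 0 < K)
    (hK : ∀ f : SimpleFunc X ℝ, (∀ x, |f x| ≤ 1) → P.real {ω | K / 2 < |simpleInt y f ω|} ≤ δ / 2)
    {ι : Type*} (s : Finset ι) {B : ι → Set Ω} (hB : ∀ i, IsLargeOn P y K (B i))
    (hd : (s : Set ι).PairwiseDisjoint B) : P.real (⋃ i ∈ s, B i) ≤ δ := by
  classical
  choose hm f c hf hc hB1 hcK using hB
  set a : Finset ι → ι → ℝ := fun S i => ((if i ∈ S then 1 else 0) - 1 / 2) * (c i * K) with ha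
  set F : Finset ι → SimpleFunc X ℝ := fun S => ∑ i ∈ s, a S i • f i with hF
  have hsum : ∑ i ∈ s, c i * K ≤ 1 := by
    refine (Finset.sum_le_sum fun i _ => hcK i).trans ?_
    rw [← measureReal_biUnion_finset hd fun i _ => hm i]
    exact measureReal_le_one
  have hF1 : ∀ S x, |F S x| ≤ 1 := by
    intro S x
    simp only [hF]
    rw [SimpleFunc.finset_sum_smul_apply]
    have h1 : ∑ i ∈ s, a S i * f i x = bernDev (fun _ => 1 / 2) (fun i => c i * K * f i x) s S :=
      Finset.sum_congr rfl fun i _ => by simp only [ha]; ring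
    rw [h1]
    refine (abs_bernDev_half_le _ _ _).trans ?_
    have h2 : ∑ i ∈ s, |c i * K * f i x| ≤ ∑ i ∈ s, c i * K := by
      refine Finset.sum_le_sum fun i _ => ?_
      have : 0 ≤ c i * K := mul_nonneg (hc i) hK0.le
      rw [abs_mul, abs_of_nonneg this]
      exact mul_le_of_le_one_right this (hf i x)
    linarith
  have key := mul_measureReal_le_sum (P := P) (s := s.powerset)
    (w := fun S => bernWeight (fun _ => 1 / 2) s S)
    (B := fun S => {ω | K / 2 < |simpleInt y (F S) ω|}) (G := ⋃ i ∈ s, B i) (c := 1 / 2)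
    (fun S hS => half_bernWeight_nonneg hS)
    (fun S _ => measurableSet_lt measurable_const (hy.measurable_simpleInt _).abs)
    (Finset.measurableSet_biUnion s fun i _ => hm i) ?_
  · have h3 := Finset.sum_le_sum fun S hS =>
      mul_le_mul_of_nonneg_left (hK (F S) (hF1 S)) (half_bernWeight_nonneg (s := s) hS)
    rw [← Finset.sum_mul, sum_bernWeight] at h3
    linarith
  · have h1 : ∀ᵐ ω ∂P, ∀ S ∈ s.powerset,
        simpleInt y (F S) ω = ∑ i ∈ s, a S i * simpleInt y (f i) ω := by
      rw [Finset.eventually_all]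
      exact fun S _ => hy.simpleInt_sum s (a S) f
    filter_upwards [h1] with ω h1 hω
    obtain ⟨i, hi, hiω⟩ := mem_iUnion₂.1 hω
    have hbig : 2 * (K / 2) < |c i * K * simpleInt y (f i) ω| := by
      rw [abs_mul, abs_of_nonneg (mul_nonneg (hc i) hK0.le)]
      nlinarith [hB1 i ω hiω]
    refine (half_le_sum_bernWeight (fun i => c i * K * simpleInt y (f i) ω) s
      (- ∑ i ∈ s, 1 / 2 * (c i * K * simpleInt y (f i) ω)) (K / 2) hi hbig).trans (le_of_eq ?_)
    refine Finset.sum_congr rfl fun S hS => ?_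
    congr 1
    have h2 : - ∑ i ∈ s, 1 / 2 * (c i * K * simpleInt y (f i) ω) +
        ∑ i ∈ S, c i * K * simpleInt y (f i) ω = simpleInt y (F S) ω := by
      rw [h1 S hS, neg_add_eq_sub, ← bernDev_eq (fun _ => 1 / 2) _ (Finset.mem_powerset.1 hS)]
      exact Finset.sum_congr rfl fun i _ => by simp only [ha]; ring
    rw [h2]
    rfl

/-- One step of a greedy exhaustion: the supremum of the admissible probabilities need not be
attained, so an event with more than half of it is taken, or `∅` if all are null. -/
lemma exists_maximal_isLargeOn (P : Measure Ω) [IsProbabilityMeasure P] (y : Set X → Ω → ℝ) (K : ℝ)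
    (D : Set Ω) : ∃ B, IsLargeOn P y K B ∧ Disjoint B D ∧
      ∀ B', IsLargeOn P y K B' → Disjoint B' D → P.real B' ≤ 2 * P.real B := by
  have h0 : IsLargeOn P y K ∅ := ⟨.empty, 0, 0, by simp, le_rfl, by simp, by simp⟩
  by_cases h : ∀ B', IsLargeOn P y K B' → Disjoint B' D → P.real B' ≤ 0
  · exact ⟨∅, h0, empty_disjoint D, by simpa using h⟩
  push Not at h
  obtain ⟨B₀, hB₀, hB₀D, hB₀P⟩ := h
  set R := {r | ∃ B, IsLargeOn P y K B ∧ Disjoint B D ∧ P.real B = r} with hR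
  have hbdd : BddAbove R := ⟨1, by rintro _ ⟨B, -, -, rfl⟩; exact measureReal_le_one⟩
  have hmem : P.real B₀ ∈ R := ⟨B₀, hB₀, hB₀D, rfl⟩
  have hpos : 0 < sSup R := hB₀P.trans_le (le_csSup hbdd hmem)
  obtain ⟨_, ⟨B, hB, hBD, rfl⟩, hlt⟩ := exists_lt_of_lt_csSup ⟨_, hmem⟩ (half_lt_self hpos)
  refine ⟨B, hB, hBD, fun B' hB' hB'D => ?_⟩
  have := le_csSup hbdd (show P.real B' ∈ R from ⟨B', hB', hB'D, rfl⟩)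
  linarith

/-- **Nikishin's theorem** for the integrals of simple functions with respect to an `L₀`-valued
measure: a weak type estimate off a set of small probability. -/
theorem exists_weak_type (hy : ExhaustiveContent P y) {δ : ℝ} (hδ : 0 < δ) :
    ∃ Ω' : Set Ω, MeasurableSet Ω' ∧ P.real Ω'ᶜ ≤ δ ∧ ∃ K : ℝ, 0 < K ∧
      ∀ f : SimpleFunc X ℝ, (∀ x, |f x| ≤ 1) → ∀ t : ℝ, 0 < t →
        P.real (Ω' ∩ {ω | t < |simpleInt y f ω|}) ≤ K / t := by
  obtain ⟨C, hC, hCP⟩ := hy.bounded_simpleInt (half_pos hδ)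
  have hK0 : 0 < 2 * C := by positivity
  have hK : ∀ f : SimpleFunc X ℝ, (∀ x, |f x| ≤ 1) →
      P.real {ω | 2 * C / 2 < |simpleInt y f ω|} ≤ δ / 2 := by
    intro f hf
    rw [mul_div_cancel_left₀ C two_ne_zero]
    exact hCP f hf
  generalize 2 * C = K at hK0 hK
  choose next hnext hdisj hmax using exists_maximal_isLargeOn P y K
  set D : ℕ → Set Ω := fun n => Nat.rec ∅ (fun _ D => D ∪ next D) n with hD
  have hDsucc : ∀ n, D (n + 1) = D n ∪ next (D n) := fun _ => rfl
  have hmono : Monotone D := monotone_nat_of_le_succ fun n => subset_union_left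
  have hDU : ∀ n, D n = ⋃ i ∈ Finset.range n, next (D i) := by
    intro n
    induction n with
    | zero => simp [hD]
    | succ n ih => rw [hDsucc, Finset.range_add_one, Finset.set_biUnion_insert, ← ih, union_comm]
  have hlt : ∀ i j, i < j → Disjoint (next (D i)) (next (D j)) := fun i j hij =>
    (hdisj (D j)).symm.mono_left (subset_union_right.trans (hmono (Nat.succ_le_of_lt hij)))
  have hDm : ∀ n, MeasurableSet (D n) := by
    intro n
    rw [hDU]
    exact Finset.measurableSet_biUnion _ fun i _ => (hnext (D i)).1
  have hDP : ∀ n, P.real (D n) ≤ δ := by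
    intro n
    rw [hDU]
    refine hy.measure_biUnion_isLargeOn_le hK0 hK (Finset.range n) (fun i => hnext (D i)) ?_
    intro i _ j _ hij
    rcases lt_or_gt_of_ne hij with h | h
    · exact hlt i j h
    · exact (hlt j i h).symm
  have hlim : Tendsto (fun n => P.real (D n)) atTop (𝓝 (P.real (⋃ n, D n))) :=
    (ENNReal.tendsto_toReal (measure_ne_top _ _)).comp (tendsto_measure_iUnion_atTop hmono)
  refine ⟨(⋃ n, D n)ᶜ, (MeasurableSet.iUnion hDm).compl, ?_, K, hK0, fun f hf t ht => ?_⟩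
  · rw [compl_compl]
    exact le_of_tendsto' hlim hDP
  by_contra! hcon
  set B := (⋃ n, D n)ᶜ ∩ {ω | t < |simpleInt y f ω|} with hB
  have hBL : IsLargeOn P y K B := by
    refine ⟨(MeasurableSet.iUnion hDm).compl.inter
      (measurableSet_lt measurable_const (hy.measurable_simpleInt f).abs), f, 1 / t, hf,
      by positivity, ?_, ?_⟩
    · rintro ω ⟨-, hω⟩
      rw [one_div, ← div_eq_inv_mul, one_lt_div ht]
      exact hω
    · rw [one_div, ← div_eq_inv_mul]
      exact hcon.le
  -- A violation of the weak type bound is admissible at every stage, so it has at most twice the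
  -- probability of each removed event. These probabilities tend to zero.
  have h1 : ∀ n, P.real B ≤ 2 * (P.real (D (n + 1)) - P.real (D n)) := by
    intro n
    have h2 : P.real (D (n + 1)) = P.real (D n) + P.real (next (D n)) := by
      rw [hDsucc]
      exact measureReal_union (hdisj (D n)).symm (hnext (D n)).1
    rw [h2, add_sub_cancel_left]
    refine hmax (D n) B hBL ?_
    rw [Set.disjoint_left]
    exact fun ω hω hωD => hω.1 (mem_iUnion_of_mem n hωD)
  have h2 := ((hlim.comp (tendsto_add_atTop_nat 1)).sub hlim).const_mul 2
  rw [sub_self, mul_zero] at h2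
  have h3 := ge_of_tendsto' h2 h1
  have : 0 < K / t := by positivity
  linarith

end ExhaustiveContent

open scoped ENNReal in
/-- A weak type estimate implies integrability of the square root. -/
lemma lintegral_sqrt_le_of_weak_type {Z : Ω → ℝ} (hZ : Measurable Z) {Ω' : Set Ω} {K : ℝ}
    (hK : 0 < K) (h : ∀ t : ℝ, 0 < t → P.real (Ω' ∩ {ω | t < |Z ω|}) ≤ K / t) :
    ∫⁻ ω in Ω', ENNReal.ofReal (√|Z ω|) ∂P ≤ ENNReal.ofReal (2 + 4 * K) := by
  -- Dyadic layers: if 2^n ≤ √|u| < 2^(n+1), then 2^(n+1) = 2(1 + ∑_{k<n} 2^k). Integrating layer k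
  -- costs at most 2^k · K/4^k, and 2(1 + 2K) = 2 + 4K.
  have hpt : ∀ u : ℝ, ENNReal.ofReal (√|u|) ≤
      2 * (1 + ∑' k : ℕ, ENNReal.ofReal (2 ^ k) * {v : ℝ | 4 ^ k < |v|}.indicator 1 u) := by
    intro u
    rcases lt_or_ge (√|u|) 1 with hu | hu
    · calc ENNReal.ofReal (√|u|) ≤ ENNReal.ofReal 2 := ENNReal.ofReal_le_ofReal (by linarith)
        _ = 2 * 1 := by simp
        _ ≤ _ := by gcongr; exact le_self_add
    · obtain ⟨n, hn1, hn2⟩ := exists_nat_pow_near hu (one_lt_two (α := ℝ))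
      have h1 : ∀ k ∈ Finset.range n, ENNReal.ofReal (2 ^ k) =
          ENNReal.ofReal (2 ^ k) * {v : ℝ | 4 ^ k < |v|}.indicator 1 u := by
        intro k hk
        rw [indicator_of_mem, Pi.one_apply, mul_one]
        change (4 : ℝ) ^ k < |u|
        have h2 : (2 : ℝ) ^ k < √|u| :=
          (pow_lt_pow_right₀ one_lt_two (Finset.mem_range.1 hk)).trans_le hn1
        rw [Real.lt_sqrt (by positivity), ← pow_mul, mul_comm k 2, pow_mul] at h2
        norm_num at h2
        exact h2
      calc ENNReal.ofReal (√|u|) ≤ ENNReal.ofReal (2 * (1 + ∑ k ∈ Finset.range n, 2 ^ k)) := by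
            refine ENNReal.ofReal_le_ofReal (hn2.le.trans (le_of_eq ?_))
            rw [geom_sum_eq (by norm_num) n, pow_succ]
            norm_num
            ring
        _ = 2 * (1 + ∑ k ∈ Finset.range n, ENNReal.ofReal (2 ^ k)) := by
            rw [ENNReal.ofReal_mul (by norm_num), ENNReal.ofReal_add (by norm_num)
              (Finset.sum_nonneg fun _ _ => by positivity),
              ENNReal.ofReal_sum_of_nonneg fun _ _ => by positivity]
            simp
        _ ≤ _ := by
            rw [Finset.sum_congr rfl h1]
            gcongr
            exact ENNReal.sum_le_tsum _
  have hmeas : ∀ k : ℕ, MeasurableSet {ω | (4 : ℝ) ^ k < |Z ω|} := fun k =>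
    measurableSet_lt measurable_const hZ.abs
  have hind : ∀ k : ℕ, ∫⁻ ω in Ω', ENNReal.ofReal (2 ^ k) *
      {v : ℝ | 4 ^ k < |v|}.indicator 1 (Z ω) ∂P ≤ ENNReal.ofReal (K * (1 / 2) ^ k) := by
    intro k
    have e : (fun ω => ENNReal.ofReal (2 ^ k) * {v : ℝ | 4 ^ k < |v|}.indicator 1 (Z ω)) =
        fun ω => ENNReal.ofReal (2 ^ k) * {ω | (4 : ℝ) ^ k < |Z ω|}.indicator 1 ω := rfl
    rw [e, lintegral_const_mul _ ((measurable_one).indicator (hmeas k)),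
      lintegral_indicator_one (hmeas k), Measure.restrict_apply (hmeas k), inter_comm,
      ← ofReal_measureReal, ← ENNReal.ofReal_mul (by positivity)]
    refine ENNReal.ofReal_le_ofReal ?_
    refine (mul_le_mul_of_nonneg_left (h (4 ^ k) (by positivity)) (by positivity)).trans
      (le_of_eq ?_)
    rw [show (4 : ℝ) = 2 * 2 by norm_num, mul_pow, one_div_pow]
    field_simp
  calc ∫⁻ ω in Ω', ENNReal.ofReal (√|Z ω|) ∂P
      ≤ ∫⁻ ω in Ω', 2 * (1 + ∑' k : ℕ, ENNReal.ofReal (2 ^ k) *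
        {v : ℝ | 4 ^ k < |v|}.indicator 1 (Z ω)) ∂P := lintegral_mono fun ω => hpt (Z ω)
    _ = 2 * (P Ω' + ∑' k : ℕ, ∫⁻ ω in Ω', ENNReal.ofReal (2 ^ k) *
        {v : ℝ | 4 ^ k < |v|}.indicator 1 (Z ω) ∂P) := by
        have hm : ∀ k : ℕ, Measurable fun ω => ENNReal.ofReal (2 ^ k) *
            {v : ℝ | 4 ^ k < |v|}.indicator (1 : ℝ → ℝ≥0∞) (Z ω) := fun k =>
          ((measurable_one).indicator (hmeas k)).const_mul _
        rw [lintegral_const_mul' _ _ (by simp), lintegral_add_left measurable_const,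
          lintegral_tsum fun k => (hm k).aemeasurable]
        simp
    _ ≤ 2 * (1 + ∑' k : ℕ, ENNReal.ofReal (K * (1 / 2) ^ k)) := by
        gcongr
        · exact prob_le_one
        · exact hind _
    _ = ENNReal.ofReal (2 + 4 * K) := by
        have hsum : HasSum (fun k : ℕ => K * (1 / 2) ^ k) (K * 2) :=
          hasSum_geometric_two.mul_left K
        rw [← ENNReal.ofReal_tsum_of_nonneg (fun _ => by positivity) hsum.summable, hsum.tsum_eq,
          ← ENNReal.ofReal_one, ← ENNReal.ofReal_add (by norm_num) (by positivity)]
        rw [show (2 : ℝ≥0∞) = ENNReal.ofReal 2 by simp, ← ENNReal.ofReal_mul (by norm_num)]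
        congr 1
        ring

end Nikishin


/-! ### Square functions: the theorem of Maurey -/

section Inequalities

variable {ι : Type*}

/-- Khinchin's inequality in `L^{1/2}`. -/
lemma sqrt_sqrt_sum_sq_le [DecidableEq ι] (x : ι → ℝ) (s : Finset ι) :
    √(√(∑ i ∈ s, x i ^ 2)) ≤ 18 * ∑ S ∈ s.powerset, bernWeight (fun _ => 1 / 2) s S *
      √|bernDev (fun _ => 1 / 2) x s S| := by
  set Q := ∑ i ∈ s, x i ^ 2 with hQ
  have hQ0 : 0 ≤ Q := Finset.sum_nonneg fun _ _ => sq_nonneg _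
  rcases hQ0.eq_or_lt with h | h
  · rw [← h]
    simp only [Real.sqrt_zero]
    exact mul_nonneg (by norm_num) (Finset.sum_nonneg fun S hS =>
      mul_nonneg (half_bernWeight_nonneg hS) (Real.sqrt_nonneg _))
  -- With r = √Q/4 one has 8r² = Q/2 < Q and √r = √√Q / 2, whence the constant 9 · 2 = 18.
  have h1 := paley_zygmund_bernDev x s (r := √Q / 4) (by
    rw [← hQ, div_pow, Real.sq_sqrt hQ0]
    linarith)
  have h2 : √(√Q / 4) = √(√Q) / 2 := by
    rw [Real.sqrt_div (Real.sqrt_nonneg _), show (4 : ℝ) = 2 ^ 2 by norm_num,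
      Real.sqrt_sq (by norm_num)]
  have h3 : √(√Q) / 2 * ∑ S ∈ s.powerset, bernWeight (fun _ => 1 / 2) s S *
      (if √Q / 4 < |bernDev (fun _ => 1 / 2) x s S| then 1 else 0) ≤
      ∑ S ∈ s.powerset, bernWeight (fun _ => 1 / 2) s S *
      √|bernDev (fun _ => 1 / 2) x s S| := by
    rw [Finset.mul_sum]
    refine Finset.sum_le_sum fun S hS => ?_
    rw [mul_left_comm]
    refine mul_le_mul_of_nonneg_left ?_ (half_bernWeight_nonneg hS)
    split_ifs with h
    · rw [mul_one, ← h2]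
      exact Real.sqrt_le_sqrt h.le
    · rw [mul_zero]
      exact Real.sqrt_nonneg _
  have h4 : 0 ≤ √(√Q) / 2 := by positivity
  nlinarith [mul_le_mul_of_nonneg_left h1 h4]

/-- Jensen's inequality for t ↦ t⁴ applied to √|a i|. -/
lemma sum_mul_sqrt_abs_le {s : Finset ι} {w a : ι → ℝ} (hw : ∀ i ∈ s, 0 ≤ w i)
    (hw1 : ∑ i ∈ s, w i = 1) :
    ∑ i ∈ s, w i * √|a i| ≤ √(√(∑ i ∈ s, w i * a i ^ 2)) := by
  have h := Real.pow_arith_mean_le_arith_mean_pow s w (fun i => √|a i|) hw hw1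
    (fun i _ => Real.sqrt_nonneg _) 4
  have h1 : ∀ i, √|a i| ^ 4 = a i ^ 2 := fun i => by
    rw [show 4 = 2 * 2 by norm_num, pow_mul, Real.sq_sqrt (abs_nonneg _), sq_abs]
  simp_rw [h1] at h
  refine Real.le_sqrt_of_sq_le (Real.le_sqrt_of_sq_le ?_)
  rwa [← pow_mul]

lemma sqrt_sum_le_sum_sqrt (s : Finset ι) {a : ι → ℝ} (ha : ∀ i, 0 ≤ a i) :
    √(∑ i ∈ s, a i) ≤ ∑ i ∈ s, √(a i) := by
  classical
  induction s using Finset.induction_on with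
  | empty => simp
  | insert i s hi ih =>
    rw [Finset.sum_insert hi, Finset.sum_insert hi]
    refine Real.sqrt_le_iff.2 ⟨add_nonneg (Real.sqrt_nonneg _)
      (Finset.sum_nonneg fun _ _ => Real.sqrt_nonneg _), ?_⟩
    have h1 : ∑ i ∈ s, a i ≤ (∑ i ∈ s, √(a i)) ^ 2 :=
      (Real.sqrt_le_left (Finset.sum_nonneg fun _ _ => Real.sqrt_nonneg _)).1 ih
    have h2 := Real.sq_sqrt (ha i)
    nlinarith [mul_nonneg (Real.sqrt_nonneg (a i))
      (Finset.sum_nonneg fun i (_ : i ∈ s) => Real.sqrt_nonneg (a i))]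

/-- Minkowski's inequality for a family of linear combinations. -/
lemma sqrt_sqrt_sum_sq_le_sum_sqrt {β : Type*} {s : Finset ι} {R : Finset β} {φ : ι → β → ℝ}
    (hφ : ∀ v ∈ R, ∑ i ∈ s, φ i v ^ 2 ≤ 1) (z : β → ℝ) :
    √(√(∑ i ∈ s, (∑ v ∈ R, φ i v * z v) ^ 2)) ≤ ∑ v ∈ R, √|z v| := by
  refine le_trans (Real.sqrt_le_sqrt ?_) (sqrt_sum_le_sum_sqrt R fun v => abs_nonneg (z v))
  have h0 : 0 ≤ ∑ v ∈ R, |z v| := Finset.sum_nonneg fun _ _ => abs_nonneg _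
  refine Real.sqrt_le_iff.2 ⟨h0, ?_⟩
  have h1 : ∀ i, (∑ v ∈ R, φ i v * z v) ^ 2 ≤
      (∑ v ∈ R, |z v|) * ∑ v ∈ R, φ i v ^ 2 * |z v| := fun i =>
    Finset.sum_sq_le_sum_mul_sum_of_sq_le_mul R (fun v _ => abs_nonneg _)
      (fun v _ => mul_nonneg (sq_nonneg _) (abs_nonneg _)) fun v _ => by
        rw [mul_pow, ← sq_abs (z v)]
        exact le_of_eq (by ring)
  refine (Finset.sum_le_sum fun i _ => h1 i).trans ?_
  rw [← Finset.mul_sum, Finset.sum_comm, sq]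
  refine mul_le_mul_of_nonneg_left (Finset.sum_le_sum fun v hv => ?_) h0
  rw [← Finset.sum_mul]
  exact mul_le_of_le_one_left (abs_nonneg _) (hφ v hv)

end Inequalities

/-! ### Absorption argument for square functions -/

section Maurey

open scoped ENNReal

variable {Ω : Type*} [MeasurableSpace Ω] {ν : Measure Ω} {β : Type*}

lemma measurable_sum_mul {R : Finset β} {z : β → Ω → ℝ} (hz : ∀ v, Measurable (z v)) (φ : β → ℝ) :
    Measurable fun ω => ∑ v ∈ R, φ v * z v ω :=
  Finset.measurable_sum _ fun v _ => (hz v).const_mul _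

/-- The absorption step in the theorem of Maurey: randomize, truncate, and apply the a priori bound
to the family of the remainders. -/
lemma lintegral_square_function_improve {R : Finset β} {z : β → Ω → ℝ}
    (hz : ∀ v, Measurable (z v)) {K B : ℝ≥0∞}
    (hK : ∀ φ : β → ℝ, (∀ v ∈ R, |φ v| ≤ 1) →
      ∫⁻ ω, ENNReal.ofReal √|∑ v ∈ R, φ v * z v ω| ∂ν ≤ K)
    (hB : ∀ (ι : Type) (s : Finset ι) (φ : ι → β → ℝ), (∀ v ∈ R, ∑ i ∈ s, φ i v ^ 2 ≤ 1) →
      ∫⁻ ω, ENNReal.ofReal √(√(∑ i ∈ s, (∑ v ∈ R, φ i v * z v ω) ^ 2)) ∂ν ≤ B)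
    {ι : Type} (s : Finset ι) (φ : ι → β → ℝ) (hφ : ∀ v ∈ R, ∑ i ∈ s, φ i v ^ 2 ≤ 1) :
    ∫⁻ ω, ENNReal.ofReal √(√(∑ i ∈ s, (∑ v ∈ R, φ i v * z v ω) ^ 2)) ∂ν ≤ 648 * K + B / 2 := by
  classical
  set w : Finset ι → ℝ := fun S => bernWeight (fun _ => 1 / 2) s S with hw
  have hw0 : ∀ S ∈ s.powerset, 0 ≤ w S := fun S hS => half_bernWeight_nonneg hS
  have hw1 : ∑ S ∈ s.powerset, w S = 1 := sum_bernWeight _ s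
  set F : Finset ι → β → ℝ := fun S v => bernDev (fun _ => 1 / 2) (fun i => φ i v) s S with hF
  -- The level 36² makes the remainder cost 18/√(36²) = 1/2 of the a priori bound.
  set G : Finset ι → β → ℝ := fun S v => if |F S v| ≤ 36 ^ 2 then F S v else 0 with hG
  set H : Finset ι → β → ℝ := fun S v => if |F S v| ≤ 36 ^ 2 then 0 else F S v with hH
  -- Including √(w S) makes the average over S a plain square sum. Where `H` is nonzero, 36⁴ H² ≤
  -- F⁴, and the fourth moment of `F` is at most 3/16, so the new family is again admissible.
  set ψ : Finset ι → β → ℝ := fun S v => √(w S) * 36 ^ 2 * H S v with hψ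
  have hψ1 : ∀ v ∈ R, ∑ S ∈ s.powerset, ψ S v ^ 2 ≤ 1 := by
    intro v hv
    have h4 := sum_bernWeight_half_pow_four_le (fun i => φ i v) s
    have h5 : ∑ S ∈ s.powerset, ψ S v ^ 2 ≤ ∑ S ∈ s.powerset, w S * F S v ^ 4 := by
      refine Finset.sum_le_sum fun S hS => ?_
      simp only [hψ]
      rw [mul_pow, mul_pow, Real.sq_sqrt (hw0 S hS), mul_assoc]
      refine mul_le_mul_of_nonneg_left ?_ (hw0 S hS)
      simp only [hH]
      split_ifs with h
      · have : 0 ≤ F S v ^ 4 := by positivity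
        linarith
      · have h6 : ((36 : ℝ) ^ 2) ^ 2 ≤ F S v ^ 2 := by
          rw [← sq_abs (F S v)]
          exact pow_le_pow_left₀ (by norm_num) (not_le.1 h).le 2
        nlinarith [sq_nonneg (F S v)]
    have h6 : 0 ≤ ∑ i ∈ s, φ i v ^ 2 := Finset.sum_nonneg fun _ _ => sq_nonneg _
    have h7 := hφ v hv
    refine h5.trans (h4.trans ?_)
    nlinarith
  have hLG : ∀ S, ∫⁻ ω, ENNReal.ofReal √|∑ v ∈ R, G S v * z v ω| ∂ν ≤ 36 * K := by
    intro S
    have h1 := hK (fun v => G S v / 36 ^ 2) (fun v _ => by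
      rw [abs_div, abs_of_pos (by norm_num : (0 : ℝ) < 36 ^ 2), div_le_one (by norm_num)]
      simp only [hG]
      split_ifs with h
      · exact h
      · norm_num)
    have h2 : ∀ ω, ENNReal.ofReal √|∑ v ∈ R, G S v * z v ω| =
        36 * ENNReal.ofReal √|∑ v ∈ R, G S v / 36 ^ 2 * z v ω| := by
      intro ω
      have : ∑ v ∈ R, G S v / 36 ^ 2 * z v ω = (∑ v ∈ R, G S v * z v ω) / 36 ^ 2 := by
        rw [Finset.sum_div]
        exact Finset.sum_congr rfl fun _ _ => by ring
      rw [this, abs_div, abs_of_pos (by norm_num : (0 : ℝ) < 36 ^ 2),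
        Real.sqrt_div (abs_nonneg _), Real.sqrt_sq (by norm_num),
        show (36 : ℝ≥0∞) = ENNReal.ofReal 36 by simp, ← ENNReal.ofReal_mul (by norm_num)]
      congr 1
      ring
    simp_rw [h2]
    rw [lintegral_const_mul' _ _ (by simp)]
    gcongr
  have hpt : ∀ ω, ENNReal.ofReal √(√(∑ i ∈ s, (∑ v ∈ R, φ i v * z v ω) ^ 2)) ≤
      18 * (∑ S ∈ s.powerset, ENNReal.ofReal (w S) *
        ENNReal.ofReal √|∑ v ∈ R, G S v * z v ω|) + 1 / 2 *
        ENNReal.ofReal √(√(∑ S ∈ s.powerset, (∑ v ∈ R, ψ S v * z v ω) ^ 2)) := by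
    intro ω
    have h1 := sqrt_sqrt_sum_sq_le (fun i => ∑ v ∈ R, φ i v * z v ω) s
    have h2 : ∀ S, bernDev (fun _ => 1 / 2) (fun i => ∑ v ∈ R, φ i v * z v ω) s S =
        ∑ v ∈ R, G S v * z v ω + ∑ v ∈ R, H S v * z v ω := by
      intro S
      rw [← Finset.sum_add_distrib]
      have : ∀ v, G S v * z v ω + H S v * z v ω = F S v * z v ω := by
        intro v
        simp only [hG, hH]
        split_ifs <;> ring
      simp_rw [this, hF, bernDev, Finset.mul_sum, Finset.sum_mul]
      rw [Finset.sum_comm]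
      exact Finset.sum_congr rfl fun _ _ => Finset.sum_congr rfl fun _ _ => by ring
    have h3 : ∑ S ∈ s.powerset, w S *
        √|bernDev (fun _ => 1 / 2) (fun i => ∑ v ∈ R, φ i v * z v ω) s S| ≤
        ∑ S ∈ s.powerset, w S * √|∑ v ∈ R, G S v * z v ω| +
        ∑ S ∈ s.powerset, w S * √|∑ v ∈ R, H S v * z v ω| := by
      rw [← Finset.sum_add_distrib]
      refine Finset.sum_le_sum fun S hS => ?_
      rw [← mul_add, h2]
      refine mul_le_mul_of_nonneg_left ?_ (hw0 S hS)
      refine (Real.sqrt_le_sqrt (abs_add_le _ _)).trans ?_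
      have := sqrt_sum_le_sum_sqrt (Finset.univ : Finset (Fin 2))
        (a := ![|∑ v ∈ R, G S v * z v ω|, |∑ v ∈ R, H S v * z v ω|]) (by
          intro i
          fin_cases i <;> exact abs_nonneg _)
      simpa using this
    have h4 := sum_mul_sqrt_abs_le (a := fun S => ∑ v ∈ R, H S v * z v ω) hw0 hw1
    have h5 : √(√(∑ S ∈ s.powerset, w S * (∑ v ∈ R, H S v * z v ω) ^ 2)) =
        √(√(∑ S ∈ s.powerset, (∑ v ∈ R, ψ S v * z v ω) ^ 2)) / 36 := by
      have : ∑ S ∈ s.powerset, w S * (∑ v ∈ R, H S v * z v ω) ^ 2 =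
          (∑ S ∈ s.powerset, (∑ v ∈ R, ψ S v * z v ω) ^ 2) / (36 ^ 2) ^ 2 := by
        rw [Finset.sum_div]
        refine Finset.sum_congr rfl fun S hS => ?_
        have : ∑ v ∈ R, ψ S v * z v ω = √(w S) * 36 ^ 2 * ∑ v ∈ R, H S v * z v ω := by
          rw [Finset.mul_sum]
          exact Finset.sum_congr rfl fun _ _ => by simp only [hψ]; ring
        rw [this, mul_pow, mul_pow, Real.sq_sqrt (hw0 S hS)]
        ring
      rw [this, Real.sqrt_div (Finset.sum_nonneg fun _ _ => sq_nonneg _),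
        Real.sqrt_sq (by norm_num), Real.sqrt_div (Real.sqrt_nonneg _),
        Real.sqrt_sq (by norm_num)]
    have h6 : √(√(∑ i ∈ s, (∑ v ∈ R, φ i v * z v ω) ^ 2)) ≤
        18 * ∑ S ∈ s.powerset, w S * √|∑ v ∈ R, G S v * z v ω| +
        1 / 2 * √(√(∑ S ∈ s.powerset, (∑ v ∈ R, ψ S v * z v ω) ^ 2)) := by
      rw [h5] at h4
      linarith
    refine (ENNReal.ofReal_le_ofReal h6).trans ?_
    refine ENNReal.ofReal_add_le.trans (le_of_eq ?_)
    rw [ENNReal.ofReal_mul (by norm_num), ENNReal.ofReal_mul (by norm_num),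
      ENNReal.ofReal_sum_of_nonneg fun S hS => mul_nonneg (hw0 S hS) (Real.sqrt_nonneg _)]
    congr 1
    · congr 1
      · simp
      · exact Finset.sum_congr rfl fun S hS => ENNReal.ofReal_mul (hw0 S hS)
    · congr 1
      rw [ENNReal.ofReal_div_of_pos (by norm_num)]
      simp
  have hmG : ∀ S, Measurable fun ω => ENNReal.ofReal √|∑ v ∈ R, G S v * z v ω| := fun S =>
    (measurable_sum_mul hz _).abs.sqrt.ennreal_ofReal
  calc ∫⁻ ω, ENNReal.ofReal √(√(∑ i ∈ s, (∑ v ∈ R, φ i v * z v ω) ^ 2)) ∂ν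
      ≤ ∫⁻ ω, (18 * (∑ S ∈ s.powerset, ENNReal.ofReal (w S) *
        ENNReal.ofReal √|∑ v ∈ R, G S v * z v ω|) + 1 / 2 *
        ENNReal.ofReal √(√(∑ S ∈ s.powerset, (∑ v ∈ R, ψ S v * z v ω) ^ 2))) ∂ν :=
        lintegral_mono hpt
    _ = 18 * (∑ S ∈ s.powerset, ENNReal.ofReal (w S) *
        ∫⁻ ω, ENNReal.ofReal √|∑ v ∈ R, G S v * z v ω| ∂ν) + 1 / 2 *
        ∫⁻ ω, ENNReal.ofReal √(√(∑ S ∈ s.powerset, (∑ v ∈ R, ψ S v * z v ω) ^ 2)) ∂ν := by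
        rw [lintegral_add_left, lintegral_const_mul' _ _ (by simp),
          lintegral_const_mul' _ _ (by simp), lintegral_finsetSum]
        · congr 2
          exact Finset.sum_congr rfl fun S _ => lintegral_const_mul _ (hmG S)
        · exact fun S _ => (hmG S).const_mul _
        · exact (Finset.measurable_sum _ fun S _ => (hmG S).const_mul _).const_mul _
    _ ≤ 18 * (∑ S ∈ s.powerset, ENNReal.ofReal (w S) * (36 * K)) + 1 / 2 * B := by
        gcongr with S hS
        · exact hLG S
        · exact hB _ s.powerset ψ hψ1
    _ = 648 * K + B / 2 := by
        rw [← Finset.sum_mul, ← ENNReal.ofReal_sum_of_nonneg hw0, hw1, ENNReal.ofReal_one, one_mul,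
          ← mul_assoc, one_div, ENNReal.div_eq_inv_mul]
        norm_num

/-- **Maurey's theorem**: bounds for the images of bounded functions imply bounds for the square
functions of families with bounded square functions. -/
theorem lintegral_square_function_le {R : Finset β} {z : β → Ω → ℝ}
    (hz : ∀ v, Measurable (z v)) {K : ℝ≥0∞} (hKtop : K ≠ ∞)
    (hK : ∀ φ : β → ℝ, (∀ v ∈ R, |φ v| ≤ 1) →
      ∫⁻ ω, ENNReal.ofReal √|∑ v ∈ R, φ v * z v ω| ∂ν ≤ K)
    {ι : Type} (s : Finset ι) (φ : ι → β → ℝ) (hφ : ∀ v ∈ R, ∑ i ∈ s, φ i v ^ 2 ≤ 1) :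
    ∫⁻ ω, ENNReal.ofReal √(√(∑ i ∈ s, (∑ v ∈ R, φ i v * z v ω) ^ 2)) ∂ν ≤ 1296 * K := by
  classical
  set 𝒮 : Set ℝ≥0∞ := {r | ∃ (ι : Type) (s : Finset ι) (φ : ι → β → ℝ),
    (∀ v ∈ R, ∑ i ∈ s, φ i v ^ 2 ≤ 1) ∧
    r = ∫⁻ ω, ENNReal.ofReal √(√(∑ i ∈ s, (∑ v ∈ R, φ i v * z v ω) ^ 2)) ∂ν} with h𝒮
  have h1 : sSup 𝒮 ≤ R.card * K := by
    refine sSup_le ?_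
    rintro _ ⟨ι, s, φ, hφ, rfl⟩
    calc ∫⁻ ω, ENNReal.ofReal √(√(∑ i ∈ s, (∑ v ∈ R, φ i v * z v ω) ^ 2)) ∂ν
        ≤ ∫⁻ ω, ∑ v ∈ R, ENNReal.ofReal √|z v ω| ∂ν := by
          refine lintegral_mono fun ω => ?_
          refine (ENNReal.ofReal_le_ofReal
            (sqrt_sqrt_sum_sq_le_sum_sqrt hφ (fun v => z v ω))).trans (le_of_eq ?_)
          exact ENNReal.ofReal_sum_of_nonneg fun _ _ => Real.sqrt_nonneg _
      _ = ∑ v ∈ R, ∫⁻ ω, ENNReal.ofReal √|z v ω| ∂ν :=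
          lintegral_finsetSum _ fun v _ => (hz v).abs.sqrt.ennreal_ofReal
      _ ≤ ∑ v ∈ R, K := by
          refine Finset.sum_le_sum fun v hv => ?_
          have := hK (fun u => if u = v then 1 else 0) (fun u _ => by split_ifs <;> simp)
          simpa [hv] using this
      _ = R.card * K := by rw [Finset.sum_const, nsmul_eq_mul]
  -- Absorbing half of the supremum requires it to be finite. The crude bound by the number of atoms
  -- suffices, as it does not enter the final constant.
  have htop : sSup 𝒮 ≠ ∞ := ne_top_of_le_ne_top (ENNReal.mul_ne_top (by simp) hKtop) h1
  have h2 : sSup 𝒮 ≤ 648 * K + sSup 𝒮 / 2 := by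
    refine sSup_le ?_
    rintro _ ⟨ι, s, φ, hφ, rfl⟩
    exact lintegral_square_function_improve hz hK
      (fun ι s φ hφ => le_sSup (show _ ∈ 𝒮 from ⟨ι, s, φ, hφ, rfl⟩)) s φ hφ
  have h3 : sSup 𝒮 / 2 ≤ 648 * K := by
    rw [← ENNReal.add_le_add_iff_right (ENNReal.div_ne_top htop (two_ne_zero)), ENNReal.add_halves]
    exact h2
  have hmem : ∫⁻ ω, ENNReal.ofReal √(√(∑ i ∈ s, (∑ v ∈ R, φ i v * z v ω) ^ 2)) ∂ν ∈ 𝒮 :=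
    ⟨ι, s, φ, hφ, rfl⟩
  calc _ ≤ sSup 𝒮 := le_sSup hmem
    _ = sSup 𝒮 / 2 + sSup 𝒮 / 2 := (ENNReal.add_halves _).symm
    _ ≤ 648 * K + 648 * K := add_le_add h3 h3
    _ = 1296 * K := by
      rw [← add_mul]
      norm_num

end Maurey

/-! ### Square functions bounded in probability -/

section SquareFunction

variable {X : Type*} [MeasurableSpace X] {Ω : Type*} [MeasurableSpace Ω] {P : Measure Ω}
  [IsProbabilityMeasure P] {y : Set X → Ω → ℝ}

/-- The simple function with finitely many given coordinates. -/
def MeasureTheory.SimpleFunc.piFin {n : ℕ} (f : Fin n → SimpleFunc X ℝ) :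
    SimpleFunc X (Fin n → ℝ) where
  toFun x i := f i x
  measurableSet_fiber' v := by
    have : (fun x i => f i x) ⁻¹' {v} = ⋂ i, f i ⁻¹' {v i} := by
      ext x
      simp [funext_iff]
    rw [this]
    exact MeasurableSet.iInter fun i => (f i).measurableSet_fiber _
  finite_range' := by
    refine (Set.Finite.pi' fun i => (f i).finite_range).subset ?_
    rintro _ ⟨x, rfl⟩ i
    exact Set.mem_range_self x

/-- For every `L₀`-valued measure, the square functions of the integrals of simple functions
`f i` with `∑ f i ^ 2 ≤ 1` are bounded in probability. -/
theorem ExhaustiveContent.bounded_square_function (hy : ExhaustiveContent P y) {δ : ℝ}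
    (hδ : 0 < δ) : ∃ C : ℝ, 0 < C ∧ ∀ (n : ℕ) (f : Fin n → SimpleFunc X ℝ),
      (∀ x, ∑ i, f i x ^ 2 ≤ 1) → P.real {ω | C < ∑ i, simpleInt y (f i) ω ^ 2} ≤ δ := by
  obtain ⟨Ω', hΩ', hP, K, hK, hw⟩ := hy.exists_weak_type (half_pos hδ)
  set K' : ℝ := 1296 * (2 + 4 * K) with hK'
  have hK'0 : 0 < K' := by positivity
  -- Markov's inequality for the fourth root of the square sum gives probability at most K'/r = δ/2
  -- on `Ω'`; its complement takes the other δ/2.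
  set r : ℝ := K' * (2 / δ) with hr
  have hr0 : 0 < r := by positivity
  refine ⟨r ^ 4, by positivity, fun n f hf => ?_⟩
  -- The fibres of the joint map are atoms on which all `f i` are constant, which reduces the claim
  -- to finitely many random variables.
  set π := SimpleFunc.piFin f with hπ
  have hsq := lintegral_square_function_le (ν := P.restrict Ω') (R := π.range)
    (z := fun v => y (π ⁻¹' {v})) (fun v => hy.measurable _)
    (K := ENNReal.ofReal (2 + 4 * K)) ENNReal.ofReal_ne_top (fun φ hφ => by
      refine le_trans (le_of_eq ?_) (lintegral_sqrt_le_of_weak_type (P := P)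
        (hy.measurable_simpleInt (π.map φ)) hK
        (hw (π.map φ) fun x => hφ _ (SimpleFunc.mem_range_self π x)))
      refine lintegral_congr_ae (ae_restrict_of_ae ?_)
      filter_upwards [hy.simpleInt_map π φ subset_rfl] with ω hω
      rw [hω]) (Finset.univ : Finset (Fin n)) (fun i v => v i) (fun v hv => by
      obtain ⟨x, rfl⟩ := SimpleFunc.mem_range.1 hv
      exact hf x)
  have hae : ∀ᵐ ω ∂P, ∀ i, simpleInt y (f i) ω = ∑ v ∈ π.range, v i * y (π ⁻¹' {v}) ω := by
    rw [ae_all_iff]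
    intro i
    exact hy.simpleInt_map π (fun v => v i) subset_rfl
  have hsq' : ∫⁻ ω in Ω', ENNReal.ofReal √(√(∑ i, simpleInt y (f i) ω ^ 2)) ∂P ≤
      ENNReal.ofReal K' := by
    rw [hK', ENNReal.ofReal_mul (by norm_num)]
    refine le_trans (le_of_eq ?_) (hsq.trans (by norm_num))
    refine lintegral_congr_ae (ae_restrict_of_ae ?_)
    filter_upwards [hae] with ω hω
    simp_rw [hω]
  have hm : Measurable fun ω => ∑ i, simpleInt y (f i) ω ^ 2 :=
    Finset.measurable_sum _ fun i _ => (hy.measurable_simpleInt (f i)).pow_const 2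
  have hset : MeasurableSet {ω | r ^ 4 < ∑ i, simpleInt y (f i) ω ^ 2} :=
    measurableSet_lt measurable_const hm
  have hmarkov := mul_meas_ge_le_lintegral₀ (μ := P.restrict Ω')
    (f := fun ω => ENNReal.ofReal √(√(∑ i, simpleInt y (f i) ω ^ 2)))
    hm.sqrt.sqrt.ennreal_ofReal.aemeasurable (ENNReal.ofReal r)
  have hin : P.real ({ω | r ^ 4 < ∑ i, simpleInt y (f i) ω ^ 2} ∩ Ω') ≤ δ / 2 := by
    have h1 : ENNReal.ofReal r * P ({ω | r ^ 4 < ∑ i, simpleInt y (f i) ω ^ 2} ∩ Ω') ≤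
        ENNReal.ofReal K' := by
      refine le_trans ?_ (hmarkov.trans hsq')
      rw [← Measure.restrict_apply hset]
      refine mul_le_mul' le_rfl (measure_mono ?_)
      refine fun ω hω => ENNReal.ofReal_le_ofReal ?_
      refine Real.le_sqrt_of_sq_le (Real.le_sqrt_of_sq_le ?_)
      rw [← pow_mul]
      exact le_of_lt hω
    rw [← ofReal_measureReal, ← ENNReal.ofReal_mul hr0.le,
      ENNReal.ofReal_le_ofReal_iff hK'0.le, hr, mul_assoc] at h1
    have h2 := le_of_mul_le_mul_left (h1.trans (mul_one K').ge) hK'0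
    rw [div_mul_eq_mul_div, div_le_one hδ] at h2
    linarith
  have hsplit : P.real {ω | r ^ 4 < ∑ i, simpleInt y (f i) ω ^ 2} ≤
      P.real ({ω | r ^ 4 < ∑ i, simpleInt y (f i) ω ^ 2} ∩ Ω') + P.real Ω'ᶜ := by
    refine le_trans (measureReal_mono ?_) (measureReal_union_le _ _)
    intro ω hω
    by_cases h : ω ∈ Ω'
    · exact Or.inl ⟨hω, h⟩
    · exact Or.inr h
  linarith

end SquareFunction


/-! ### Riemann integrable functions -/

section Riemann

/-- The oscillation sums of a Riemann integrable function tend to zero. -/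
lemma RiemannIntegrableOn.exists_osc_lt {f : ℝ → ℝ} {a b : ℝ} (hf : RiemannIntegrableOn f a b)
    {η : ℝ} (hη : 0 < η) : ∃ δ : ℝ, 0 < δ ∧ ∀ (n : ℕ) (x ξ ξ' : ℕ → ℝ), x 0 = a → x n = b →
      (∀ k < n, x k ≤ ξ k ∧ ξ k ≤ x (k + 1) ∧ x k ≤ ξ' k ∧ ξ' k ≤ x (k + 1) ∧
        x (k + 1) - x k < δ) →
      ∑ k ∈ Finset.range n, |f (ξ k) - f (ξ' k)| * (x (k + 1) - x k) < η := by
  obtain ⟨I, hI⟩ := hf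
  obtain ⟨δ, hδ, h⟩ := hI (η / 2) (half_pos hη)
  refine ⟨δ, hδ, fun n x ξ ξ' h0 hn hx => ?_⟩
  -- Putting the larger of the two values in one Riemann sum and the smaller in the other makes
  -- their difference the oscillation sum; both are within η/2 of the integral.
  have h1 := h n x (fun k => if f (ξ' k) ≤ f (ξ k) then ξ k else ξ' k) h0 hn (fun k hk => by
    obtain ⟨h1, h2, h3, h4, h5⟩ := hx k hk
    split_ifs
    · exact ⟨h1, h2, h5⟩
    · exact ⟨h3, h4, h5⟩)
  have h2 := h n x (fun k => if f (ξ' k) ≤ f (ξ k) then ξ' k else ξ k) h0 hn (fun k hk => by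
    obtain ⟨h1, h2, h3, h4, h5⟩ := hx k hk
    split_ifs
    · exact ⟨h3, h4, h5⟩
    · exact ⟨h1, h2, h5⟩)
  have e : ∑ k ∈ Finset.range n, |f (ξ k) - f (ξ' k)| * (x (k + 1) - x k) =
      ∑ k ∈ Finset.range n, f (if f (ξ' k) ≤ f (ξ k) then ξ k else ξ' k) * (x (k + 1) - x k) -
      ∑ k ∈ Finset.range n, f (if f (ξ' k) ≤ f (ξ k) then ξ' k else ξ k) * (x (k + 1) - x k) := by
    rw [← Finset.sum_sub_distrib]
    refine Finset.sum_congr rfl fun k _ => ?_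
    rw [← sub_mul]
    congr 1
    split_ifs with h
    · exact abs_of_nonneg (by linarith)
    · rw [abs_of_neg (by linarith)]
      ring
  rw [e]
  linarith [abs_lt.1 h1, abs_lt.1 h2, (abs_lt.1 h1).2, (abs_lt.1 h2).1]

/-- The oscillation sums along equidistant partitions of subintervals tend to zero. -/
lemma RiemannIntegrableOn.exists_uniform_osc_lt {f : ℝ → ℝ} {T : ℝ} (hT : 0 ≤ T)
    (hf : RiemannIntegrableOn f 0 T) {η : ℝ} (hη : 0 < η) :
    ∃ δ : ℝ, 0 < δ ∧ ∀ (c h : ℝ) (n : ℕ) (ξ ξ' : ℕ → ℝ), 0 < h → h < δ → 0 ≤ c → c + n * h ≤ T →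
      (∀ k < n, ξ k ∈ Icc (c + k * h) (c + (k + 1) * h) ∧
        ξ' k ∈ Icc (c + k * h) (c + (k + 1) * h)) →
      ∑ k ∈ Finset.range n, |f (ξ k) - f (ξ' k)| * h < η := by
  obtain ⟨δ, hδ, hosc⟩ := hf.exists_osc_lt hη
  refine ⟨δ, hδ, fun c h n ξ ξ' h0 hhδ hc hcn hξ => ?_⟩
  set j := ⌈c / h⌉₊ with hj
  set m := ⌈(T - c) / h⌉₊ with hm
  have hjc : c ≤ j * h := by
    rw [← div_le_iff₀ h0]
    exact Nat.le_ceil _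
  have hmT : T - c ≤ m * h := by
    rw [← div_le_iff₀ h0]
    exact Nat.le_ceil _
  have hnm : n ≤ m := by
    have : (n : ℝ) ≤ (T - c) / h := by
      rw [le_div_iff₀ h0]
      linarith
    exact_mod_cast this.trans (Nat.le_ceil _)
  -- The grid through `c` is extended in both directions and clamped to [0, T], so that cell `j + i`
  -- is the i-th given cell. On other cells both tags are the left endpoint and contribute nothing.
  set x : ℕ → ℝ := fun k => max 0 (min T (c + ((k : ℝ) - j) * h)) with hx
  have hx0 : x 0 = 0 := by
    simp only [hx, Nat.cast_zero]
    exact max_eq_left ((min_le_right _ _).trans (by linarith))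
  have hxN : x (j + m) = T := by
    simp only [hx]
    push_cast
    rw [min_eq_left (by linarith), max_eq_right hT]
  have hmono : ∀ k, x k ≤ x (k + 1) := by
    intro k
    simp only [hx]
    push_cast
    gcongr
    linarith
  have hmesh : ∀ k, x (k + 1) - x k < δ := by
    intro k
    refine lt_of_le_of_lt ?_ hhδ
    simp only [hx]
    push_cast
    rw [sub_le_iff_le_add]
    refine max_le (by linarith [le_max_left 0 (min T (c + ((k : ℝ) - j) * h))]) ?_
    have h1 := le_max_right 0 (min T (c + ((k : ℝ) - j) * h))
    rcases min_choice T (c + ((k : ℝ) - j) * h) with h2 | h2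
    · rw [h2] at h1 ⊢
      exact (min_le_left _ _).trans (by linarith)
    · rw [h2] at h1 ⊢
      exact (min_le_right _ _).trans (by linarith)
  have hxi : ∀ i ≤ n, x (j + i) = c + i * h := by
    intro i hi
    have h1 : (i : ℝ) * h ≤ n * h := by
      gcongr
    have h2 : 0 ≤ (i : ℝ) * h := by positivity
    simp only [hx]
    push_cast
    rw [add_sub_cancel_left, min_eq_right (by linarith), max_eq_right (by linarith)]
  have hmem : ∀ ζ : ℕ → ℝ, (∀ k < n, ζ k ∈ Icc (c + k * h) (c + (k + 1) * h)) → ∀ k,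
      x k ≤ (if j ≤ k ∧ k < j + n then ζ (k - j) else x k) ∧
      (if j ≤ k ∧ k < j + n then ζ (k - j) else x k) ≤ x (k + 1) := by
    intro ζ hζ k
    split_ifs with hk
    · obtain ⟨i, rfl⟩ := Nat.exists_eq_add_of_le hk.1
      have hi : i < n := by omega
      rw [Nat.add_sub_cancel_left, hxi i hi.le, add_assoc, hxi (i + 1) hi]
      push_cast
      exact hζ i hi
    · exact ⟨le_rfl, hmono k⟩
  have key := hosc (j + m) x (fun k => if j ≤ k ∧ k < j + n then ξ (k - j) else x k)
    (fun k => if j ≤ k ∧ k < j + n then ξ' (k - j) else x k) hx0 hxN fun k _ =>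
      ⟨(hmem ξ (fun k hk => (hξ k hk).1) k).1, (hmem ξ (fun k hk => (hξ k hk).1) k).2,
        (hmem ξ' (fun k hk => (hξ k hk).2) k).1, (hmem ξ' (fun k hk => (hξ k hk).2) k).2, hmesh k⟩
  refine lt_of_le_of_lt ?_ key
  have hsub : Finset.Ico j (j + n) ⊆ Finset.range (j + m) := by
    intro k hk
    rw [Finset.mem_Ico] at hk
    rw [Finset.mem_range]
    omega
  refine le_trans (le_of_eq ?_) (Finset.sum_le_sum_of_subset_of_nonneg hsub fun k _ _ =>
    mul_nonneg (abs_nonneg _) (sub_nonneg.2 (hmono k)))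
  rw [Finset.sum_Ico_eq_sum_range, Nat.add_sub_cancel_left]
  refine Finset.sum_congr rfl fun i hi => ?_
  have hi' := Finset.mem_range.1 hi
  rw [if_pos ⟨by omega, by omega⟩, if_pos ⟨by omega, by omega⟩, Nat.add_sub_cancel_left, hxi i hi'.le,
    add_assoc, hxi (i + 1) hi']
  push_cast
  ring

/-- Every point of `[0, a)` lies in a cell of the equidistant partition. -/
lemma exists_mem_Ico_grid {a : ℝ} (ha : 0 < a) {n : ℕ} (hn : 0 < n) {s : ℝ} (hs : s ∈ Ico 0 a) :
    ∃ k < n, s ∈ Ico (k * (a / n)) ((k + 1) * (a / n)) := by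
  have hn' : (0 : ℝ) < n := by exact_mod_cast hn
  have hh : 0 < a / n := by positivity
  have h1 := Nat.floor_le (div_nonneg hs.1 hh.le)
  have h2 := Nat.lt_floor_add_one (s / (a / n))
  rw [le_div_iff₀ hh] at h1
  rw [div_lt_iff₀ hh] at h2
  refine ⟨⌊s / (a / n)⌋₊, ?_, h1, h2⟩
  have h3 : (⌊s / (a / n)⌋₊ : ℝ) * (a / n) < n * (a / n) := by
    rw [mul_div_cancel₀ a hn'.ne']
    exact h1.trans_lt hs.2
  exact_mod_cast lt_of_mul_lt_mul_right h3 hh.le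

/-- Moving only the tag of one cell bounds the oscillation there by 1/h; adding the finitely many
grid values bounds `f`. The half-open cells leave out `T`, treated separately. -/
lemma RiemannIntegrableOn.exists_bound {f : ℝ → ℝ} {T : ℝ} (hT : 0 < T)
    (hf : RiemannIntegrableOn f 0 T) : ∃ M : ℝ, 0 < M ∧ ∀ t ∈ Icc 0 T, |f t| ≤ M := by
  obtain ⟨δ, hδ, hosc⟩ := hf.exists_uniform_osc_lt hT.le one_pos
  obtain ⟨n, hn⟩ := exists_nat_gt (T / δ)
  have hn0 : (0 : ℝ) < n := (div_pos hT hδ).trans hn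
  have hnpos : 0 < n := by exact_mod_cast hn0
  set h := T / n with hh
  have h0 : 0 < h := by positivity
  have hhδ : h < δ := by
    rw [hh, div_lt_iff₀ hn0]
    rw [div_lt_iff₀ hδ] at hn
    linarith
  have hsum : 0 ≤ ∑ k ∈ Finset.range n, |f (k * h)| := Finset.sum_nonneg fun _ _ => abs_nonneg _
  refine ⟨1 / h + ∑ k ∈ Finset.range n, |f (k * h)| + |f T|, by positivity, fun t ht => ?_⟩
  rcases ht.2.eq_or_lt with rfl | htT
  · have : 0 < 1 / h := by positivity
    linarith
  obtain ⟨k, hk, hkt⟩ := exists_mem_Ico_grid hT hnpos ⟨ht.1, htT⟩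
  have hnh : n * h = T := mul_div_cancel₀ T hn0.ne'
  have h1 := hosc 0 h n (fun i => if i = k then t else i * h) (fun i => i * h) h0 hhδ le_rfl
    (by rw [zero_add, hnh]) (fun i _ => by
      have h2 : (i : ℝ) * h ≤ (i + 1) * h := by linarith
      simp only [zero_add]
      refine ⟨?_, le_rfl, h2⟩
      split_ifs with hi
      · rw [hi]
        exact ⟨hkt.1, hkt.2.le⟩
      · exact ⟨le_rfl, h2⟩)
  have h2 := Finset.single_le_sum (f := fun i : ℕ =>
    |f (if i = k then t else i * h) - f (i * h)| * h)
    (fun i _ => mul_nonneg (abs_nonneg _) h0.le) (Finset.mem_range.2 hk)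
  simp only [if_true] at h2
  have h3 : |f t - f (k * h)| ≤ 1 / h := by
    rw [le_div_iff₀ h0]
    linarith
  have h4 := Finset.single_le_sum (f := fun i : ℕ => |f (i * h)|) (fun i _ => abs_nonneg _)
    (Finset.mem_range.2 hk)
  have h5 := abs_sub_abs_le_abs_sub (f t) (f (k * h))
  linarith [abs_nonneg (f T)]

/-- The step function with values `c k` on the cells of the equidistant partition of `[0, a)`. -/
noncomputable def gridStep (a : ℝ) (n : ℕ) (c : ℕ → ℝ) (s : ℝ) : ℝ :=
  ∑ k ∈ Finset.range n, (Ico (k * (a / n)) ((k + 1) * (a / n))).indicator (fun _ => c k) s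

lemma measurable_gridStep (a : ℝ) (n : ℕ) (c : ℕ → ℝ) : Measurable (gridStep a n c) :=
  Finset.measurable_sum _ fun _ _ => measurable_const.indicator measurableSet_Ico

lemma gridStep_eq {a : ℝ} (ha : 0 < a) {n k : ℕ} (hk : k < n) (c : ℕ → ℝ) {s : ℝ}
    (hs : s ∈ Ico (k * (a / n)) ((k + 1) * (a / n))) : gridStep a n c s = c k := by
  have hn : (0 : ℝ) < n := by exact_mod_cast (Nat.zero_le k).trans_lt hk
  have hh : 0 < a / n := by positivity
  rw [gridStep, Finset.sum_eq_single k]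
  · exact indicator_of_mem hs _
  · intro i _ hik
    refine indicator_of_notMem (fun hi => hik ?_) _
    have h1 : (i : ℝ) < k + 1 := lt_of_mul_lt_mul_right (hi.1.trans_lt hs.2) hh.le
    have h2 : (k : ℝ) < i + 1 := lt_of_mul_lt_mul_right (hs.1.trans_lt hi.2) hh.le
    have h1' : i < k + 1 := by exact_mod_cast h1
    have h2' : k < i + 1 := by exact_mod_cast h2
    omega
  · intro h
    exact (h (Finset.mem_range.2 hk)).elim

lemma Ico_grid_subset {a : ℝ} (ha : 0 < a) {n k : ℕ} (hk : k < n) :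
    Icc (k * (a / n)) ((k + 1) * (a / n)) ⊆ Icc 0 a := by
  have hn : (0 : ℝ) < n := by exact_mod_cast (Nat.zero_le k).trans_lt hk
  refine Icc_subset_Icc (by positivity) ?_
  have h1 : ((k : ℝ) + 1) ≤ n := by exact_mod_cast hk
  calc ((k : ℝ) + 1) * (a / n) ≤ n * (a / n) := by gcongr
    _ = a := mul_div_cancel₀ a hn.ne'

lemma integrableOn_gridStep (a : ℝ) (n : ℕ) (c : ℕ → ℝ) :
    IntegrableOn (gridStep a n c) (Ico 0 a) := by
  refine integrable_finsetSum _ fun k _ => ?_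
  exact (integrable_const (c k)).indicator measurableSet_Ico

lemma setIntegral_gridStep {a : ℝ} (ha : 0 < a) (n : ℕ) (c : ℕ → ℝ) :
    ∫ s in Ico 0 a, gridStep a n c s = ∑ k ∈ Finset.range n, c k * (a / n) := by
  unfold gridStep
  rw [integral_finsetSum _ fun k _ => (integrable_const (c k)).indicator measurableSet_Ico]
  refine Finset.sum_congr rfl fun k hk => ?_
  have hk' := Finset.mem_range.1 hk
  have hn : (0 : ℝ) < n := by exact_mod_cast (Nat.zero_le k).trans_lt hk'
  have hsub : Ico (k * (a / n)) ((k + 1) * (a / n)) ⊆ Ico 0 a := by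
    have h1 : ((k : ℝ) + 1) ≤ n := by exact_mod_cast hk'
    refine Ico_subset_Ico (by positivity) ?_
    calc ((k : ℝ) + 1) * (a / n) ≤ n * (a / n) := by gcongr
      _ = a := mul_div_cancel₀ a hn.ne'
  rw [setIntegral_indicator measurableSet_Ico, inter_eq_right.2 hsub, setIntegral_const,
    measureReal_def, Real.volume_Ico, smul_eq_mul, add_mul, one_mul, add_sub_cancel_left,
    ENNReal.toReal_ofReal (by positivity), mul_comm]

/-- A bounded function whose oscillation sums along equidistant partitions tend to zero is Lebesgue
integrable, and its left Riemann sums converge to its integral. -/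
lemma integrableOn_and_tendsto_of_osc {φ : ℝ → ℝ} {a M : ℝ} (ha : 0 < a)
    (hM : ∀ t ∈ Icc 0 a, |φ t| ≤ M)
    (hosc : ∀ η > 0, ∀ᶠ n : ℕ in atTop, ∀ ξ ξ' : ℕ → ℝ,
      (∀ k < n, ξ k ∈ Icc (k * (a / n)) ((k + 1) * (a / n)) ∧
        ξ' k ∈ Icc (k * (a / n)) ((k + 1) * (a / n))) →
      ∑ k ∈ Finset.range n, |φ (ξ k) - φ (ξ' k)| * (a / n) < η) :
    IntegrableOn φ (Icc 0 a) ∧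
    Tendsto (fun n : ℕ => ∑ k ∈ Finset.range n, φ (k * (a / n)) * (a / n)) atTop
      (𝓝 (∫ s in Icc 0 a, φ s)) := by
  rw [integrableOn_Icc_iff_integrableOn_Ico, integral_Icc_eq_integral_Ico]
  set O : ℕ → ℕ → Set ℝ := fun n k => {r | ∃ s ∈ Icc ((k : ℝ) * (a / n)) ((k + 1) * (a / n)),
    ∃ t ∈ Icc ((k : ℝ) * (a / n)) ((k + 1) * (a / n)), r = |φ s - φ t|} with hO
  have hbdd : ∀ n, ∀ k < n, BddAbove (O n k) := by
    rintro n k hk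
    refine ⟨2 * M, ?_⟩
    rintro _ ⟨s, hs, t, ht, rfl⟩
    have := abs_sub (φ s) (φ t)
    linarith [hM s (Ico_grid_subset ha hk hs), hM t (Ico_grid_subset ha hk ht)]
  have hsum : Tendsto (fun n : ℕ => ∑ k ∈ Finset.range n, sSup (O n k) * (a / n)) atTop (𝓝 0) := by
    have hnonneg : ∀ n : ℕ, 0 ≤ ∑ k ∈ Finset.range n, sSup (O n k) * (a / n) := fun n =>
      Finset.sum_nonneg fun k _ => mul_nonneg (Real.sSup_nonneg (by
        rintro _ ⟨s, -, t, -, rfl⟩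
        exact abs_nonneg _)) (by positivity)
    rw [Metric.tendsto_nhds]
    intro η hη
    filter_upwards [hosc (η / 2) (half_pos hη), eventually_gt_atTop 0] with n hn hn0
    have hn0' : (0 : ℝ) < n := by exact_mod_cast hn0
    have hh : 0 < a / n := by positivity
    rw [Real.dist_eq, sub_zero, abs_of_nonneg (hnonneg n)]
    -- Tags nearly attaining the supremal oscillation; the error η/(2a) over total length a costs
    -- η/2.
    have hex : ∀ k : ℕ, ∃ s t : ℝ, s ∈ Icc ((k : ℝ) * (a / n)) ((k + 1) * (a / n)) ∧
        t ∈ Icc ((k : ℝ) * (a / n)) ((k + 1) * (a / n)) ∧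
        sSup (O n k) - η / (2 * a) < |φ s - φ t| := by
      intro k
      have hmem : |φ (k * (a / n)) - φ (k * (a / n))| ∈ O n k :=
        ⟨_, ⟨le_rfl, by linarith⟩, _, ⟨le_rfl, by linarith⟩, rfl⟩
      obtain ⟨_, ⟨s, hs, t, ht, rfl⟩, hlt⟩ := exists_lt_of_lt_csSup ⟨_, hmem⟩
        (sub_lt_self (sSup (O n k)) (show 0 < η / (2 * a) by positivity))
      exact ⟨s, t, hs, ht, hlt⟩
    choose ξ ξ' h1 h2 h3 using hex
    have h4 := hn ξ ξ' fun k _ => ⟨h1 k, h2 k⟩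
    have h5 : ∑ k ∈ Finset.range n, sSup (O n k) * (a / n) ≤
        ∑ k ∈ Finset.range n, (|φ (ξ k) - φ (ξ' k)| * (a / n) + η / (2 * a) * (a / n)) := by
      refine Finset.sum_le_sum fun k _ => ?_
      rw [← add_mul]
      exact mul_le_mul_of_nonneg_right (by linarith [h3 k]) hh.le
    rw [Finset.sum_add_distrib, Finset.sum_const, Finset.card_range, nsmul_eq_mul] at h5
    have h6 : (n : ℝ) * (η / (2 * a) * (a / n)) = η / 2 := by
      field_simp
    linarith
  have hclose : ∀ n : ℕ, 0 < n → ∀ s ∈ Ico 0 a,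
      |gridStep a n (fun k => φ (k * (a / n))) s - φ s| ≤ gridStep a n (fun k => sSup (O n k)) s := by
    intro n hn s hs
    obtain ⟨k, hk, hks⟩ := exists_mem_Ico_grid ha hn hs
    rw [gridStep_eq ha hk _ hks, gridStep_eq ha hk _ hks]
    exact le_csSup (hbdd n k hk) ⟨_, ⟨le_rfl, hks.1.trans hks.2.le⟩, s, ⟨hks.1, hks.2.le⟩, rfl⟩
  have hOint : Tendsto (fun n : ℕ => ∫ s in Ico 0 a, gridStep a n (fun k => sSup (O n k)) s) atTop
      (𝓝 0) := by
    simp_rw [setIntegral_gridStep ha]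
    exact hsum
  -- No measurability of φ is assumed. The left step functions differ from φ by at most the
  -- oscillation steps, which tend to zero in L¹ and so almost everywhere along a subsequence.
  have hmeas : AEStronglyMeasurable φ (volume.restrict (Ico 0 a)) := by
    have htim : TendstoInMeasure (volume.restrict (Ico 0 a))
        (fun n : ℕ => gridStep a n (fun k => sSup (O n k))) atTop (fun _ => 0) := by
      refine tendstoInMeasure_of_tendsto_eLpNorm (p := 1) one_ne_zero
        (fun n => (measurable_gridStep a n _).aestronglyMeasurable) aestronglyMeasurable_const ?_
      have h1 : ∀ᶠ n : ℕ in atTop, eLpNorm (gridStep a n (fun k => sSup (O n k)) - fun _ => 0) 1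
          (volume.restrict (Ico 0 a)) =
          ENNReal.ofReal (∫ s in Ico 0 a, gridStep a n (fun k => sSup (O n k)) s) := by
        filter_upwards [eventually_gt_atTop 0] with n hn
        have h2 : gridStep a n (fun k => sSup (O n k)) - (fun _ => 0) =
            gridStep a n (fun k => sSup (O n k)) := by
          ext s
          simp
        rw [h2, eLpNorm_one_eq_lintegral_enorm,
          ← ofReal_integral_norm_eq_lintegral_enorm (integrableOn_gridStep a n _)]
        congr 1
        refine setIntegral_congr_fun measurableSet_Ico fun s hs => ?_
        exact Real.norm_of_nonneg ((abs_nonneg _).trans (hclose n hn s hs))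
      rw [tendsto_congr' h1, ← ENNReal.ofReal_zero]
      exact ENNReal.tendsto_ofReal hOint
    obtain ⟨ns, hns, hlim⟩ := htim.exists_seq_tendsto_ae
    refine aestronglyMeasurable_of_tendsto_ae atTop
      (f := fun i => gridStep a (ns i) (fun k => φ (k * (a / (ns i : ℕ)))))
      (fun i => (measurable_gridStep a _ _).aestronglyMeasurable) ?_
    filter_upwards [hlim, ae_restrict_mem measurableSet_Ico] with s hs hsa
    rw [tendsto_iff_dist_tendsto_zero]
    refine squeeze_zero' (Eventually.of_forall fun _ => dist_nonneg) ?_ hs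
    filter_upwards [hns.tendsto_atTop.eventually_gt_atTop 0] with i hi
    exact hclose (ns i) hi s hsa
  have hint : IntegrableOn φ (Ico 0 a) := by
    refine Integrable.of_bound hmeas M ?_
    filter_upwards [ae_restrict_mem measurableSet_Ico] with s hs
    exact hM s ⟨hs.1, hs.2.le⟩
  refine ⟨hint, ?_⟩
  rw [tendsto_iff_dist_tendsto_zero]
  refine squeeze_zero' (Eventually.of_forall fun _ => dist_nonneg) ?_ hOint
  filter_upwards [eventually_gt_atTop 0] with n hn
  rw [← setIntegral_gridStep ha n fun k => φ (k * (a / n)), Real.dist_eq,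
    ← integral_sub (integrableOn_gridStep a n _) hint]
  refine (abs_integral_le_integral_abs).trans ?_
  refine setIntegral_mono_on ((integrableOn_gridStep a n _).sub hint).abs
    (integrableOn_gridStep a n _) measurableSet_Ico fun s hs => ?_
  exact hclose n hn s hs

/-- The squared increments of a Riemann integrable function are Lebesgue integrable, and their
Riemann sums converge to the integral. -/
lemma RiemannIntegrableOn.sq_increment {f : ℝ → ℝ} {T a ε : ℝ} (hf : RiemannIntegrableOn f 0 T)
    (ha : 0 < a) (hε : 0 < ε) (haT : a + ε ≤ T) :
    IntegrableOn (fun s => |f (s + ε) - f s| ^ 2 / ε) (Icc 0 a) ∧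
    Tendsto (fun n : ℕ => ∑ k ∈ Finset.range n,
      |f (k * (a / n) + ε) - f (k * (a / n))| ^ 2 / ε * (a / n)) atTop
      (𝓝 (∫ s in Icc 0 a, |f (s + ε) - f s| ^ 2 / ε)) := by
  have hT : 0 < T := by linarith
  obtain ⟨M, hM0, hM⟩ := hf.exists_bound hT
  have hincr : ∀ s ∈ Icc 0 a, |f (s + ε) - f s| ≤ 2 * M := by
    intro s hs
    have := abs_sub (f (s + ε)) (f s)
    linarith [hM s ⟨hs.1, by linarith [hs.2]⟩, hM (s + ε) ⟨by linarith [hs.1], by linarith [hs.2]⟩]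
  refine integrableOn_and_tendsto_of_osc ha (M := (2 * M) ^ 2 / ε) (fun s hs => ?_) fun η hη => ?_
  · rw [abs_of_nonneg (by positivity)]
    gcongr
    exact hincr s hs
  -- For increments u and v, |u² - v²| = |u + v| |u - v| ≤ 4M |u - v|, and u - v involves
  -- oscillations on the grid and on its translate by ε. Each receives ηε/(8M).
  · obtain ⟨δ, hδ, hosc⟩ := hf.exists_uniform_osc_lt hT.le
      (show 0 < η * ε / (8 * M) by positivity)
    obtain ⟨N, hN⟩ := exists_nat_gt (a / δ)
    filter_upwards [eventually_ge_atTop (N + 1)] with n hn ξ ξ' hξ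
    have hn0 : (0 : ℝ) < n := by exact_mod_cast (Nat.succ_pos N).trans_le hn
    have hNn : (N : ℝ) ≤ n := by exact_mod_cast (Nat.le_succ N).trans hn
    have hh : 0 < a / n := by positivity
    have hhδ : a / n < δ := by
      rw [div_lt_iff₀ hn0]
      rw [div_lt_iff₀ hδ] at hN
      nlinarith
    have hna : n * (a / n) = a := mul_div_cancel₀ a hn0.ne'
    have h1 := hosc 0 (a / n) n ξ ξ' hh hhδ le_rfl (by rw [zero_add, hna]; linarith) (by
      simpa using hξ)
    have h2 := hosc ε (a / n) n (fun k => ξ k + ε) (fun k => ξ' k + ε) hh hhδ hε.le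
      (by rw [hna]; linarith) (fun k hk => by
        obtain ⟨h3, h4⟩ := hξ k hk
        exact ⟨⟨by linarith [h3.1], by linarith [h3.2]⟩, ⟨by linarith [h4.1], by linarith [h4.2]⟩⟩)
    have h3 : ∑ k ∈ Finset.range n, |(|f (ξ k + ε) - f (ξ k)| ^ 2 / ε) -
        |f (ξ' k + ε) - f (ξ' k)| ^ 2 / ε| * (a / n) ≤
        4 * M / ε * (∑ k ∈ Finset.range n, |f (ξ k + ε) - f (ξ' k + ε)| * (a / n) +
        ∑ k ∈ Finset.range n, |f (ξ k) - f (ξ' k)| * (a / n)) := by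
      rw [← Finset.sum_add_distrib, Finset.mul_sum]
      refine Finset.sum_le_sum fun k hk => ?_
      obtain ⟨h3, h4⟩ := hξ k (Finset.mem_range.1 hk)
      rw [← add_mul, ← mul_assoc]
      refine mul_le_mul_of_nonneg_right ?_ hh.le
      have h5 := hincr _ (Ico_grid_subset ha (Finset.mem_range.1 hk) h3)
      have h6 := hincr _ (Ico_grid_subset ha (Finset.mem_range.1 hk) h4)
      set u := f (ξ k + ε) - f (ξ k) with hu
      set v := f (ξ' k + ε) - f (ξ' k) with hv
      have h7 : |u - v| ≤ |f (ξ k + ε) - f (ξ' k + ε)| + |f (ξ k) - f (ξ' k)| := by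
        refine le_trans (le_of_eq ?_) (abs_sub _ _)
        congr 1
        rw [hu, hv]
        ring
      have h8 : |u + v| ≤ 4 * M := (abs_add_le _ _).trans (by linarith)
      rw [sq_abs, sq_abs, ← sub_div, abs_div, abs_of_pos hε, div_mul_eq_mul_div]
      refine div_le_div_of_nonneg_right ?_ hε.le
      rw [sq_sub_sq, abs_mul]
      exact mul_le_mul h8 h7 (abs_nonneg _) (by positivity)
    refine h3.trans_lt ?_
    have h4 : 4 * M / ε * (η * ε / (8 * M) + η * ε / (8 * M)) = η := by
      field_simp
      norm_num
    rw [← h4]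
    exact mul_lt_mul_of_pos_left (add_lt_add h2 h1) (by positivity)

end Riemann


/-! ### Boundedness in probability of the normalized squared increments -/

/-- At most `ε / h + 1` of the intervals `(k h, k h + ε]` contain a given point. -/
lemma card_filter_grid_le {h ε : ℝ} (hh : 0 < h) (hε : 0 < ε) (n : ℕ) (x : ℝ) :
    (((Finset.range n).filter fun k : ℕ => k * h < x ∧ x ≤ k * h + ε).card : ℝ) ≤ ε / h + 1 := by
  rcases le_or_gt x 0 with hx | hx
  · rw [Finset.filter_false_of_mem]
    · simp only [Finset.card_empty, Nat.cast_zero]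
      positivity
    · rintro k - ⟨h1, -⟩
      have : 0 ≤ k * h := by positivity
      linarith
  -- The admissible k satisfy x/h - ε/h ≤ k < x/h. The natural ceiling truncates a negative left end
  -- to 0, which is harmless as k ≥ 0.
  have hsub : ((Finset.range n).filter fun k : ℕ => k * h < x ∧ x ≤ k * h + ε) ⊆
      Finset.Ico ⌈x / h - ε / h⌉₊ ⌈x / h⌉₊ := by
    intro k hk
    obtain ⟨-, h1, h2⟩ := Finset.mem_filter.1 hk
    rw [Finset.mem_Ico, Nat.ceil_le, Nat.lt_ceil, ← sub_div, div_le_iff₀ hh, lt_div_iff₀ hh]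
    exact ⟨by linarith, h1⟩
  have h1 := Finset.card_le_card hsub
  rw [Nat.card_Ico] at h1
  have h2 : (⌈x / h⌉₊ : ℝ) < x / h + 1 := Nat.ceil_lt_add_one (by positivity)
  have h3 := Nat.le_ceil (x / h - ε / h)
  have h4 : 0 ≤ ε / h := by positivity
  have h5 : (⌈x / h - ε / h⌉₊ : ℕ) ≤ ⌈x / h⌉₊ := Nat.ceil_le_ceil (by linarith)
  have h6 : ((⌈x / h⌉₊ - ⌈x / h - ε / h⌉₊ : ℕ) : ℝ) = ⌈x / h⌉₊ - ⌈x / h - ε / h⌉₊ :=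
    Nat.cast_sub h5
  have h7 : (((Finset.range n).filter fun k : ℕ => k * h < x ∧ x ≤ k * h + ε).card : ℝ) ≤
      ((⌈x / h⌉₊ - ⌈x / h - ε / h⌉₊ : ℕ) : ℝ) := by exact_mod_cast h1
  linarith

section Increments

variable {Ω : Type*} [MeasurableSpace Ω] {P : Measure Ω} {T : ℝ}

/-- The value of an additive set function on `(s, t]` is the increment of its distribution
process. -/
lemma ExhaustiveContent.increment {y : Set (Icc (0 : ℝ) T) → Ω → ℝ} (hy : ExhaustiveContent P y)
    {X : ℝ → Ω → ℝ}
    (hX : ∀ t ∈ Icc (0 : ℝ) T, X t =ᵐ[P] y {x : Icc (0 : ℝ) T | 0 < (x : ℝ) ∧ (x : ℝ) ≤ t})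
    {s t : ℝ} (hs : 0 ≤ s) (hst : s ≤ t) (ht : t ≤ T) :
    ∀ᵐ ω ∂P, y {x : Icc (0 : ℝ) T | s < (x : ℝ) ∧ (x : ℝ) ≤ t} ω = X t ω - X s ω := by
  have hm : ∀ u v : ℝ, MeasurableSet {x : Icc (0 : ℝ) T | u < (x : ℝ) ∧ (x : ℝ) ≤ v} := fun u v =>
    measurable_subtype_coe measurableSet_Ioc
  have e : {x : Icc (0 : ℝ) T | 0 < (x : ℝ) ∧ (x : ℝ) ≤ s} ∪
      {x : Icc (0 : ℝ) T | s < (x : ℝ) ∧ (x : ℝ) ≤ t} =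
      {x : Icc (0 : ℝ) T | 0 < (x : ℝ) ∧ (x : ℝ) ≤ t} := by
    ext x
    constructor
    · rintro (⟨h1, h2⟩ | ⟨h1, h2⟩)
      · exact ⟨h1, h2.trans hst⟩
      · exact ⟨hs.trans_lt h1, h2⟩
    · rintro ⟨h1, h2⟩
      rcases le_or_gt (x : ℝ) s with h | h
      · exact Or.inl ⟨h1, h⟩
      · exact Or.inr ⟨h, h2⟩
  have hu := hy.union _ _ (hm 0 s) (hm s t) (disjoint_left.2 fun x h1 h2 => h2.1.not_ge h1.2)
  rw [e] at hu
  filter_upwards [hu, hX s ⟨hs, hst.trans ht⟩, hX t ⟨hs.trans hst, ht⟩] with ω h1 h2 h3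
  rw [h2, h3, h1]
  ring

/-- Riemann sums of the normalized squared increments. -/
noncomputable def incrementSum (X : ℝ → Ω → ℝ) (a ε : ℝ) (n : ℕ) (ω : Ω) : ℝ :=
  ∑ k ∈ Finset.range n, |X (k * (a / n) + ε) ω - X (k * (a / n)) ω| ^ 2 / ε * (a / n)

lemma grid_mem {a ε : ℝ} (ha : 0 < a) (haT : a + ε ≤ T) {n k : ℕ} (hk : k < n) :
    0 ≤ k * (a / n) ∧ k * (a / n) + ε ≤ T := by
  have hn : (0 : ℝ) < n := by exact_mod_cast (Nat.zero_le k).trans_lt hk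
  have hk' : (k : ℝ) ≤ n := by exact_mod_cast hk.le
  refine ⟨by positivity, ?_⟩
  have : k * (a / n) ≤ n * (a / n) := by gcongr
  rw [mul_div_cancel₀ _ hn.ne'] at this
  linarith

/-- The Riemann sums are bounded in probability, uniformly in the step and the increment. -/
lemma ExhaustiveContent.exists_measureReal_incrementSum_le [IsProbabilityMeasure P]
    {y : Set (Icc (0 : ℝ) T) → Ω → ℝ}
    (hy : ExhaustiveContent P y) {X : ℝ → Ω → ℝ}
    (hX : ∀ t ∈ Icc (0 : ℝ) T, X t =ᵐ[P] y {x : Icc (0 : ℝ) T | 0 < (x : ℝ) ∧ (x : ℝ) ≤ t})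
    {a δ : ℝ} (ha : 0 < a) (hδ : 0 < δ) :
    ∃ C : ℝ, 0 < C ∧ ∀ ε : ℝ, 0 < ε → a + ε ≤ T → ∀ n : ℕ, 0 < n → a / n ≤ ε →
      P.real {ω | C < incrementSum X a ε n ω} ≤ δ := by
  obtain ⟨C, hC, h⟩ := hy.bounded_square_function hδ
  refine ⟨2 * C, by positivity, fun ε hε haT n hn hnε => ?_⟩
  have hn' : (0 : ℝ) < n := by exact_mod_cast hn
  have hh : 0 < a / n := by positivity
  -- Each point is covered at most ε/h + 1 times with h = a/n ≤ ε, so c² = h/(2ε) gives a square sum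
  -- of at most 1/2 + h/(2ε) ≤ 1. The factor 2 reappears in the bound 2C.
  set c : ℝ := √(a / n / (2 * ε)) with hc
  have hc2 : c ^ 2 = a / n / (2 * ε) := Real.sq_sqrt (by positivity)
  set A : ℕ → Set (Icc (0 : ℝ) T) := fun k =>
    {x | k * (a / n) < (x : ℝ) ∧ (x : ℝ) ≤ k * (a / n) + ε} with hA
  have hAm : ∀ k, MeasurableSet (A k) := fun k => measurable_subtype_coe measurableSet_Ioc
  set f : Fin n → SimpleFunc (Icc (0 : ℝ) T) ℝ := fun k =>
    SimpleFunc.piecewise (A k) (hAm k) (SimpleFunc.const _ c) (SimpleFunc.const _ 0) with hf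
  have hsum : ∀ x, ∑ i, f i x ^ 2 ≤ 1 := by
    intro x
    classical
    have e : ∑ i, f i x ^ 2 =
        ∑ k ∈ Finset.range n, if k * (a / n) < (x : ℝ) ∧ (x : ℝ) ≤ k * (a / n) + ε then c ^ 2
          else 0 := by
      rw [Finset.sum_range]
      refine Finset.sum_congr rfl fun k _ => ?_
      by_cases hx : x ∈ A k
      · refine Eq.trans ?_ (if_pos hx).symm
        simp [hf, SimpleFunc.piecewise_apply, hx]
      · refine Eq.trans ?_ (if_neg hx).symm
        simp [hf, SimpleFunc.piecewise_apply, hx]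
    rw [e, ← Finset.sum_filter, Finset.sum_const, nsmul_eq_mul, hc2]
    have h1 := card_filter_grid_le hh hε n x
    calc _ ≤ (ε / (a / n) + 1) * (a / n / (2 * ε)) := by gcongr
      _ = 1 / 2 + (a / n) / (2 * ε) := by field_simp
      _ ≤ 1 / 2 + ε / (2 * ε) := by gcongr
      _ = 1 := by field_simp; norm_num
  refine le_trans (ENNReal.toReal_mono (measure_ne_top _ _) (measure_mono_ae ?_)) (h n f hsum)
  have h1 : ∀ᵐ ω ∂P, ∀ i : Fin n, simpleInt y (f i) ω = c * y (A i) ω :=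
    ae_all_iff.2 fun i => hy.simpleInt_indicator (hAm i) c
  have h2 : ∀ᵐ ω ∂P, ∀ i : Fin n,
      y (A i) ω = X (i * (a / n) + ε) ω - X (i * (a / n)) ω :=
    ae_all_iff.2 fun i => by
      obtain ⟨h3, h4⟩ := grid_mem ha haT i.2
      exact hy.increment hX h3 (by linarith) h4
  filter_upwards [h1, h2] with ω h1 h2 hω
  have e : ∑ i, simpleInt y (f i) ω ^ 2 = incrementSum X a ε n ω / 2 := by
    rw [incrementSum, Finset.sum_range, Finset.sum_div]
    refine Finset.sum_congr rfl fun i _ => ?_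
    rw [h1, h2, mul_pow, hc2, sq_abs]
    field_simp
  change C < ∑ i, simpleInt y (f i) ω ^ 2
  change 2 * C < incrementSum X a ε n ω at hω
  rw [e]
  linarith

lemma aemeasurable_incrementSum {X : ℝ → Ω → ℝ}
    (hX : ∀ t ∈ Icc (0 : ℝ) T, AEMeasurable (X t) P)
    {a ε : ℝ} (ha : 0 < a) (hε : 0 < ε) (haT : a + ε ≤ T) (n : ℕ) :
    AEMeasurable (incrementSum X a ε n) P := by
  unfold incrementSum
  refine Finset.aemeasurable_fun_sum _ fun k hk => ?_
  obtain ⟨h1, h2⟩ := grid_mem ha haT (Finset.mem_range.1 hk)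
  have h3 := (hX _ ⟨by linarith, h2⟩).sub (hX _ ⟨h1, by linarith⟩)
  simp only [sq_abs]
  exact ((h3.pow_const 2).div_const _).mul_const _

/-- A tail bound for an almost sure limit, from tail bounds for the sequence. -/
lemma measureReal_lt_abs_le_of_tendsto_ae [IsProbabilityMeasure P] {Y : ℕ → Ω → ℝ} {Z : Ω → ℝ} {C δ : ℝ} (hδ : 0 < δ)
    (hY : ∀ n, AEMeasurable (Y n) P) (hY0 : ∀ n ω, 0 ≤ Y n ω)
    (hlim : ∀ᵐ ω ∂P, Tendsto (fun n => Y n ω) atTop (𝓝 (Z ω)))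
    (hC : ∀ᶠ n in atTop, P.real {ω | C < Y n ω} ≤ δ) :
    P.real {ω | C + 1 < |Z ω|} ≤ 2 * δ := by
  have h := tendstoInMeasure_iff_measureReal_norm.1
    (tendstoInMeasure_of_tendsto_ae (fun n => (hY n).aestronglyMeasurable) hlim) 1 one_pos
  obtain ⟨n, h1, h2⟩ := ((h.eventually (ge_mem_nhds hδ)).and hC).exists
  have hsub : {ω | C + 1 < |Z ω|} ⊆ {ω | 1 ≤ ‖Y n ω - Z ω‖} ∪ {ω | C < Y n ω} := by
    intro ω hω
    by_contra hcon
    change ¬ ((1 ≤ ‖Y n ω - Z ω‖) ∨ (C < Y n ω)) at hcon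
    push Not at hcon
    obtain ⟨h3, h4⟩ := hcon
    change C + 1 < |Z ω| at hω
    rw [Real.norm_eq_abs, abs_sub_comm] at h3
    have h5 := abs_sub_abs_le_abs_sub (Z ω) (Y n ω)
    rw [abs_of_nonneg (hY0 n ω)] at h5
    linarith
  calc _ ≤ P.real ({ω | 1 ≤ ‖Y n ω - Z ω‖} ∪ {ω | C < Y n ω}) := measureReal_mono hsub
    _ ≤ _ := measureReal_union_le _ _
    _ ≤ δ + δ := add_le_add h1 h2
    _ = 2 * δ := by ring

end Increments

/-! ### Conclusion: passage from the Riemann sums to the integrals -/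

lemma boundedInProbability_of_forall_exists {Ω : Type*} [MeasurableSpace Ω] {P : Measure Ω}
    [IsFiniteMeasure P] {ι : Type*} {Y : ι → Ω → ℝ}
    (h : ∀ δ : ℝ, 0 < δ → ∃ C : ℝ, ∀ i, P.real {ω | C < |Y i ω|} ≤ δ) :
    BoundedInProbability P Y := by
  refine ENNReal.tendsto_nhds_zero.2 fun η hη => ?_
  obtain ⟨r, hr, hrη⟩ := ENNReal.lt_iff_exists_nnreal_btwn.1 hη
  obtain ⟨C, hC⟩ := h r (by exact_mod_cast hr)
  filter_upwards [eventually_ge_atTop C] with C' hC'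
  refine iSup_le fun i => le_trans ?_ hrη.le
  have hsub : {ω | C' < |Y i ω|} ⊆ {ω | C < |Y i ω|} := fun ω hω => lt_of_le_of_lt hC' hω
  refine (measure_mono hsub).trans ?_
  rw [← ENNReal.ofReal_coe_nnreal, ← ofReal_measureReal]
  exact ENNReal.ofReal_le_ofReal (hC i)

theorem mainTheorem4 {Ω : Type*} [MeasurableSpace Ω] (P : Measure Ω) [IsProbabilityMeasure P]
    (T T₁ : ℝ) (hT₁ : 0 < T₁) (hT : T₁ < T)
    (μ : StochasticMeasure (Set.Icc (0 : ℝ) T) P)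
    (hμ : μ.SquareIntegrableImpliesIntegrable)
    (X : ℝ → Ω → ℝ)
    (hX : ∀ t ∈ Set.Icc (0 : ℝ) T,
      X t =ᵐ[P] (μ.val {x : Set.Icc (0 : ℝ) T | 0 < (x : ℝ) ∧ (x : ℝ) ≤ t} : Ω → ℝ))
    (hR : ∀ᵐ ω ∂P, RiemannIntegrableOn (fun t => X t ω) 0 T) :
    (∀ ε ∈ Set.Ioo (0 : ℝ) (T - T₁),
      (∀ᵐ ω ∂P, IntegrableOn (fun s => |X (s + ε) ω - X s ω| ^ 2 / ε) (Set.Icc 0 T₁) volume) ∧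
      AEMeasurable (fun ω => ∫ s in Set.Icc 0 T₁, |X (s + ε) ω - X s ω| ^ 2 / ε) P) ∧
    BoundedInProbability P (fun (ε : Set.Ioo (0 : ℝ) (T - T₁)) (ω : Ω) =>
      ∫ s in Set.Icc 0 T₁, |X (s + ε) ω - X s ω| ^ 2 / (ε : ℝ)) := by
  have hy := μ.exhaustiveContent
  have hXm : ∀ t ∈ Icc (0 : ℝ) T, AEMeasurable (X t) P := fun t ht =>
    (μ.val _).aemeasurable.congr (hX t ht).symm
  have hlim : ∀ ε ∈ Ioo (0 : ℝ) (T - T₁), ∀ᵐ ω ∂P,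
      Tendsto (fun n => incrementSum X T₁ ε n ω) atTop
        (𝓝 (∫ s in Icc 0 T₁, |X (s + ε) ω - X s ω| ^ 2 / ε)) := fun ε hε => by
    filter_upwards [hR] with ω hω
    exact (hω.sq_increment hT₁ hε.1 (by linarith [hε.2])).2
  have hSm : ∀ ε ∈ Ioo (0 : ℝ) (T - T₁), ∀ n, AEMeasurable (incrementSum X T₁ ε n) P :=
    fun ε hε n => aemeasurable_incrementSum hXm hT₁ hε.1 (by linarith [hε.2]) n
  refine ⟨fun ε hε => ⟨?_, aemeasurable_of_tendsto_metrizable_ae atTop (hSm ε hε) (hlim ε hε)⟩,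
    boundedInProbability_of_forall_exists fun δ hδ => ?_⟩
  · filter_upwards [hR] with ω hω
    exact (hω.sq_increment hT₁ hε.1 (by linarith [hε.2])).1
  -- The constant depends neither on ε nor on n. For fixed ε, the condition T₁/n ≤ ε holds for all
  -- large n, and the limit costs only an increase of `C` by 1 and a doubling of δ/2.
  obtain ⟨C, -, hC⟩ := hy.exists_measureReal_incrementSum_le hX hT₁ (half_pos hδ)
  refine ⟨C + 1, fun ε => ?_⟩
  rw [← mul_div_cancel₀ δ (two_ne_zero (α := ℝ))]
  refine measureReal_lt_abs_le_of_tendsto_ae (half_pos hδ) (hSm ε ε.2)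
    (fun n ω => Finset.sum_nonneg fun k _ => ?_) (hlim ε ε.2) ?_
  · have := ε.2.1
    positivity
  · have h1 := tendsto_const_div_atTop_nhds_zero_nat T₁
    filter_upwards [h1.eventually (ge_mem_nhds ε.2.1), eventually_gt_atTop 0] with n h2 h3
    exact hC ε ε.2.1 (by linarith [ε.2.2]) n h3 h2
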